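/- Let $\mathbb K$ be an algebraically closed field of characteristic zero, let $k\ge 2$, let $S_3$ be the space of cubic forms in $x_0,\dots,x_{2k}$ over $\mathbb K$, and let $\mathcal H=(\mathrm{hess}=0)\subset\mathbb P(S_3)$ be the closed subscheme whose ideal is generated by the coefficients of the Hessian determinant $\det\left(\partial^2 f/\partial x_i\partial x_j\right)$, regarded as polynomials in the coefficients of the cubic form $f$. Let $\mathbb X_{max}\subset\mathbb P(S_3)$ be the Zariski closure (with its reduced structure) of the set of irreducible cubics which, after a linear change of coordinates, have the form $$x_0g_0+x_1g_1+\dots+x_kg_k+h,$$ where $g_0,\dots,g_k\in\mathbb K[x_{k+1},\dots,x_{2k}]_2$ are linearly independent and algebraically dependent quadratic forms and $h\in\mathbb K[x_{k+1},\dots,x_{2k}]_3$. Let $$f=x_0x_{k+1}^2+x_1x_{k+2}^2+\dots+x_{k-1}x_{2k}^2+x_kL^2,\qquad L=x_{k+1}+\dots+x_{2k}.$$ Then $[f]$ lies in $\mathbb X_{max}$ and in $\mathcal H$, it is a non-singular point of $\mathbb X_{max}$ (the local ring of $\mathbb X_{max}$ at $[f]$ is regular), and the Zariski tangent space of the scheme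 $\mathcal H$ at $[f]$ has dimension equal to $\dim\mathbb X_{max}$. Consequently $\mathbb X_{max}\subset\mathcal H$ is an irreducible component of $\mathcal H$, and it is generically reduced: the local ring of $\mathcal H$ at the generic point of $\mathbb X_{max}$ is reduced. -/

import Mathlib

open MvPolynomial AlgebraicGeometry

attribute [local instance] MvPolynomial.gradedAlgebra

noncomputable section

universe u

/-! ### `Proj` of the quotient of a graded algebra by a homogeneous ideal -/

section GradedQuotient

variable {K A : Type u} [Field K] [CommRing A] [Algebra K A]
  (𝒜 : ℕ → Submodule K A) [GradedAlgebra 𝒜]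

/-- The grading of `A ⧸ J` induced by the grading of `A`. -/
def quotientGrading (J : HomogeneousIdeal 𝒜) (n : ℕ) : Submodule K (A ⧸ J.toIdeal) :=
  (𝒜 n).map (Ideal.Quotient.mkₐ K J.toIdeal).toLinearMap

variable (J : HomogeneousIdeal 𝒜)

theorem quotientGrading_mk_mem {n : ℕ} {a : A} (ha : a ∈ 𝒜 n) :
    Ideal.Quotient.mk J.toIdeal a ∈ quotientGrading 𝒜 J n :=
  ⟨a, ha, rfl⟩

instance quotientGrading.gradedMonoid : SetLike.GradedMonoid (quotientGrading 𝒜 J) where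
  one_mem := ⟨1, SetLike.GradedOne.one_mem, map_one (Ideal.Quotient.mk J.toIdeal)⟩
  mul_mem := by
    rintro i j _ _ ⟨a, ha, rfl⟩ ⟨b, hb, rfl⟩
    exact ⟨a * b, SetLike.GradedMul.mul_mem ha hb, map_mul (Ideal.Quotient.mk J.toIdeal) a b⟩

/-- The class of an element of degree `n`, as an element of the degree `n` part. -/
def quotientGradingMap (n : ℕ) : 𝒜 n →ₗ[K] quotientGrading 𝒜 J n :=
  ((Ideal.Quotient.mkₐ K J.toIdeal).toLinearMap.comp (𝒜 n).subtype).codRestrict _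
    fun a => ⟨a, a.2, rfl⟩

theorem quotientGradingMap_one :
    ((DirectSum.lof K ℕ (fun n => quotientGrading 𝒜 J n) 0).comp (quotientGradingMap 𝒜 J 0))
      (GradedMonoid.GOne.one (A := fun n => 𝒜 n)) = 1 :=
  rfl

theorem quotientGradingMap_mul {i j : ℕ} (a : 𝒜 i) (b : 𝒜 j) :
    ((DirectSum.lof K ℕ (fun n => quotientGrading 𝒜 J n) (i + j)).comp
      (quotientGradingMap 𝒜 J (i + j))) (GradedMonoid.GMul.mul (A := fun n => 𝒜 n) a b) =
    ((DirectSum.lof K ℕ (fun n => quotientGrading 𝒜 J n) i).comp (quotientGradingMap 𝒜 J i)) a *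
    ((DirectSum.lof K ℕ (fun n => quotientGrading 𝒜 J n) j).comp (quotientGradingMap 𝒜 J j)) b := by
  simp only [LinearMap.comp_apply, DirectSum.lof_eq_of, DirectSum.of_mul_of]
  rfl

/-- The algebra map sending `a` to the classes of its homogeneous components. -/
def quotientDecomposeAux : A →ₐ[K] DirectSum ℕ fun n => quotientGrading 𝒜 J n :=
  (DirectSum.toAlgebra K (fun n => 𝒜 n)
    (fun n => (DirectSum.lof K ℕ (fun n => quotientGrading 𝒜 J n) n).comp
      (quotientGradingMap 𝒜 J n))
    (quotientGradingMap_one 𝒜 J) (quotientGradingMap_mul 𝒜 J)).comp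
    (DirectSum.decomposeAlgEquiv 𝒜).toAlgHom

theorem quotientDecomposeAux_of_mem {n : ℕ} {a : A} (ha : a ∈ 𝒜 n) :
    quotientDecomposeAux 𝒜 J a =
      DirectSum.of (fun n => quotientGrading 𝒜 J n) n (quotientGradingMap 𝒜 J n ⟨a, ha⟩) := by
  have h : DirectSum.decomposeAlgEquiv 𝒜 a = DirectSum.of (fun n => 𝒜 n) n ⟨a, ha⟩ :=
    DirectSum.decompose_of_mem 𝒜 ha
  have h' : quotientDecomposeAux 𝒜 J a =
      DirectSum.toAlgebra K (fun n => 𝒜 n) _ (quotientGradingMap_one 𝒜 J)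
        (quotientGradingMap_mul 𝒜 J) (DirectSum.decomposeAlgEquiv 𝒜 a) := rfl
  rw [h', h]
  exact DirectSum.toAddMonoid_of _ _ _

theorem quotientDecomposeAux_eq_zero {a : A} (ha : a ∈ J.toIdeal) :
    quotientDecomposeAux 𝒜 J a = 0 := by
  classical
  rw [← DirectSum.sum_support_decompose 𝒜 a, map_sum]
  refine Finset.sum_eq_zero fun n _ => ?_
  rw [quotientDecomposeAux_of_mem 𝒜 J (SetLike.coe_mem _)]
  have : quotientGradingMap 𝒜 J n ⟨_, SetLike.coe_mem (DirectSum.decompose 𝒜 a n)⟩ = 0 :=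
    Subtype.ext (Ideal.Quotient.eq_zero_iff_mem.mpr (J.isHomogeneous n ha))
  rw [this, map_zero]

instance quotientGrading.gradedAlgebra : GradedAlgebra (quotientGrading 𝒜 J) :=
  GradedAlgebra.ofAlgHom _
    (Ideal.Quotient.liftₐ J.toIdeal (quotientDecomposeAux 𝒜 J)
      fun _ ha => quotientDecomposeAux_eq_zero 𝒜 J ha)
    (by
      classical
      refine Ideal.Quotient.algHom_ext _ (AlgHom.ext fun a => ?_)
      change (DirectSum.coeAlgHom (quotientGrading 𝒜 J)) (quotientDecomposeAux 𝒜 J a) =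
        Ideal.Quotient.mkₐ K J.toIdeal a
      conv_rhs => rw [← DirectSum.sum_support_decompose 𝒜 a]
      conv_lhs => rw [← DirectSum.sum_support_decompose 𝒜 a]
      rw [map_sum, map_sum, map_sum]
      refine Finset.sum_congr rfl fun n _ => ?_
      rw [quotientDecomposeAux_of_mem 𝒜 J (SetLike.coe_mem _), DirectSum.coeAlgHom_of]
      rfl)
    (by
      rintro n ⟨_, a, ha, rfl⟩
      exact quotientDecomposeAux_of_mem 𝒜 J ha)

/-- The projection `A → A ⧸ J` as a homomorphism of graded rings. -/
def quotientGradedHom : GradedRingHom 𝒜 (quotientGrading 𝒜 J) where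
  toRingHom := Ideal.Quotient.mk J.toIdeal
  map_mem ha := quotientGrading_mk_mem 𝒜 J ha

theorem irrelevant_le_map_quotientGradedHom :
    HomogeneousIdeal.irrelevant (quotientGrading 𝒜 J) ≤
      (HomogeneousIdeal.irrelevant 𝒜).map (quotientGradedHom 𝒜 J) := by
  classical
  intro b hb
  rw [← DirectSum.sum_support_decompose (quotientGrading 𝒜 J) b]
  refine sum_mem fun n hn => ?_
  obtain ⟨a, ha, hab⟩ := (DirectSum.decompose (quotientGrading 𝒜 J) b n).2
  rw [← hab]
  rcases Nat.eq_zero_or_pos n with rfl | hpos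
  · exfalso
    rw [DFinsupp.mem_support_iff] at hn
    exact hn (Subtype.ext ((HomogeneousIdeal.mem_irrelevant_iff _ _).mp hb))
  · exact Ideal.mem_map_of_mem (quotientGradedHom 𝒜 J)
      (HomogeneousIdeal.mem_irrelevant_of_mem 𝒜 hpos ha)

/-- The closed subscheme `V(J) = Proj (A ⧸ J)` of `Proj A`. -/
abbrev projQuotient : Scheme.{u} := Proj (quotientGrading 𝒜 J)

/-- The closed immersion `Proj (A ⧸ J) ⟶ Proj A`. -/
abbrev projQuotientι : projQuotient 𝒜 J ⟶ Proj 𝒜 :=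
  Proj.map (quotientGradedHom 𝒜 J) (irrelevant_le_map_quotientGradedHom 𝒜 J)

end GradedQuotient

/-! ### Hessians and the space of cubics -/

/-- The Hessian determinant of a polynomial. -/
def hessianDet {ι R : Type*} [Fintype ι] [DecidableEq ι] [CommRing R] (f : MvPolynomial ι R) :
    MvPolynomial ι R :=
  (Matrix.of fun i j => pderiv i (pderiv j f)).det

theorem coeff_mul_isHomogeneous {ι τ K : Type*} [Field K] [DecidableEq ι]
    {p q : MvPolynomial ι (MvPolynomial τ K)} {a b : ℕ}
    (hp : ∀ d, (coeff d p).IsHomogeneous a) (hq : ∀ d, (coeff d q).IsHomogeneous b) (d : ι →₀ ℕ) :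
    (coeff d (p * q)).IsHomogeneous (a + b) := by
  rw [coeff_mul]
  exact IsHomogeneous.sum _ _ _ fun x _ => (hp x.1).mul (hq x.2)

theorem coeff_prod_isHomogeneous {ι τ K α : Type*} [Field K] [DecidableEq ι]
    (s : Finset α)
    (p : α → MvPolynomial ι (MvPolynomial τ K))
    (hp : ∀ x d, (coeff d (p x)).IsHomogeneous 1) (d : ι →₀ ℕ) :
    (coeff d (∏ x ∈ s, p x)).IsHomogeneous s.card := by
  classical
  induction s using Finset.induction_on generalizing d with
  | empty =>
    rw [Finset.prod_empty, coeff_one]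
    split_ifs
    · exact isHomogeneous_one _ _
    · exact isHomogeneous_zero _ _ _
  | insert x s hx ih =>
    rw [Finset.prod_insert hx, Finset.card_insert_of_notMem hx, add_comm]
    exact coeff_mul_isHomogeneous (hp x) ih d

theorem coeff_pderiv_isHomogeneous {ι τ K : Type*} [Field K]
    {p : MvPolynomial ι (MvPolynomial τ K)}
    (hp : ∀ d, (coeff d p).IsHomogeneous 1) (i : ι) (d : ι →₀ ℕ) :
    (coeff d (pderiv i p)).IsHomogeneous 1 := by
  rw [coeff_pderiv]
  have h : ((d i : MvPolynomial τ K) + 1) = C ((d i : K) + 1) := by simp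
  rw [h, mul_comm]
  exact (hp _).C_mul _

section SpaceOfCubics

variable (ι : Type) [Fintype ι] [DecidableEq ι] (K : Type u) [Field K]

/-- The homogeneous coordinate ring of `ℙ(S₃)`, where `S₃` is the space of cubic forms in the
variables `x i`, `i : ι`: there is one coordinate for each monomial of degree three. -/
abbrev CubicCoordRing : Type u := MvPolynomial (Sym ι 3) K

/-- The projective space `ℙ(S₃)` of cubic forms (its closed points are the lines in `S₃`). -/
abbrev CubicSpace : Scheme.{u} := Proj (homogeneousSubmodule (Sym ι 3) K)

variable {ι} in
/-- The exponent vector of a monomial of degree three. -/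
def cubicExponent (m : Sym ι 3) : ι →₀ ℕ := Multiset.toFinsupp (m : Multiset ι)

/-- The generic cubic form: its coefficients are the coordinates on `S₃`. -/
def genericCubic : MvPolynomial ι (CubicCoordRing ι K) :=
  ∑ m : Sym ι 3, monomial (cubicExponent m) (X m)

/-- The ideal generated by the coefficients of the Hessian determinant of the generic cubic. -/
def hessianIdeal : Ideal (CubicCoordRing ι K) :=
  Ideal.span (Set.range fun d : ι →₀ ℕ => coeff d (hessianDet (genericCubic ι K)))

theorem coeff_genericCubic_isHomogeneous (d : ι →₀ ℕ) :
    (coeff d (genericCubic ι K)).IsHomogeneous 1 := by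
  rw [genericCubic, coeff_sum]
  refine IsHomogeneous.sum _ _ _ fun m _ => ?_
  rw [coeff_monomial]
  split_ifs
  · exact isHomogeneous_X _ _
  · exact isHomogeneous_zero _ _ _

theorem coeff_hessianDet_isHomogeneous (d : ι →₀ ℕ) :
    (coeff d (hessianDet (genericCubic ι K))).IsHomogeneous (Fintype.card ι) := by
  rw [hessianDet, Matrix.det_apply, coeff_sum]
  refine IsHomogeneous.sum _ _ _ fun s _ => ?_
  have h := coeff_prod_isHomogeneous Finset.univ
    (fun i => (Matrix.of fun i j => pderiv i (pderiv j (genericCubic ι K))) (s i) i)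
    (fun i d => coeff_pderiv_isHomogeneous
      (coeff_pderiv_isHomogeneous (coeff_genericCubic_isHomogeneous ι K) i) (s i) d) d
  rw [Finset.card_univ] at h
  rcases Int.units_eq_one_or (Equiv.Perm.sign s) with hs | hs
  · rw [hs, one_smul]
    exact h
  · rw [hs, Units.neg_smul, one_smul, coeff_neg]
    exact h.neg

/-- `hessianIdeal` as a homogeneous ideal. -/
def hessianHomogeneousIdeal : HomogeneousIdeal (homogeneousSubmodule (Sym ι 3) K) where
  toSubmodule := hessianIdeal ι K
  is_homogeneous' := by
    refine Ideal.homogeneous_span _ _ ?_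
    rintro _ ⟨d, rfl⟩
    exact ⟨_, coeff_hessianDet_isHomogeneous ι K d⟩

/-- The closed subscheme `ℋ = (hess = 0)` of `ℙ(S₃)`. -/
abbrev HessianScheme : Scheme.{u} :=
  projQuotient (homogeneousSubmodule (Sym ι 3) K) (hessianHomogeneousIdeal ι K)

/-- The inclusion `ℋ ⟶ ℙ(S₃)`. -/
abbrev HessianScheme.incl : HessianScheme ι K ⟶ CubicSpace ι K :=
  projQuotientι (homogeneousSubmodule (Sym ι 3) K) (hessianHomogeneousIdeal ι K)

variable {ι K} in
/-- The point `p` of `ℙ(S₃)` is the closed point `[f]`: its homogeneous prime ideal consists of the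
polynomials that vanish on the line spanned by `f` in `S₃`. -/
def IsPointOfCubic (p : CubicSpace ι K) (f : MvPolynomial ι K) : Prop :=
  (ProjectiveSpectrum.asHomogeneousIdeal p).toIdeal =
    vanishingIdeal K (Set.range fun t : K => fun m : Sym ι 3 => t * coeff (cubicExponent m) f)

end SpaceOfCubics

/-! ### The maximal family -/

section MaximalFamily

variable {K : Type u} [Field K]

/-- The coordinates of `ℙ^{2k}`: `Sum.inl i` (`i = 0, …, k`) stands for `x_i`, and
`Sum.inr j` (`j = 0, …, k - 1`) stands for `x_{k+1+j}`. -/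
abbrev MaxVar (k : ℕ) : Type := Fin (k + 1) ⊕ Fin k

/-- The linear change of variables `x_i ↦ ∑ j, A i j x_j`. -/
def linearSubst {ι : Type*} [Fintype ι] [DecidableEq ι] (A : GL ι K) (f : MvPolynomial ι K) :
    MvPolynomial ι K :=
  bind₁ (fun i => ∑ j, C (A.1 i j) * X j) f

/-- A cubic form of the maximal family in `ℙ^{2k}`: an irreducible cubic form which, up to a
projective transformation, has the canonical form `∑_{i ≤ k} x_i g_i + h` with linearly independent
and algebraically dependent quadratic forms `g_i` and a cubic form `h` in `x_{k+1}, …, x_{2k}`. -/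
def IsMaximalPerazzo (k : ℕ) (f : MvPolynomial (MaxVar k) K) : Prop :=
  f.IsHomogeneous 3 ∧ Irreducible f ∧
    ∃ (A : GL (MaxVar k) K) (g : Fin (k + 1) → MvPolynomial (Fin k) K) (h : MvPolynomial (Fin k) K),
      (∀ i, (g i).IsHomogeneous 2) ∧ h.IsHomogeneous 3 ∧
      LinearIndependent K g ∧ ¬ AlgebraicIndependent K g ∧
      linearSubst A f = ∑ i, X (Sum.inl i) * rename Sum.inr (g i) + rename Sum.inr h

variable (K) in
/-- `X_max`: the closure in `ℙ(S₃)` of the maximal family. -/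
def maximalLocus (k : ℕ) : TopologicalSpace.Closeds (CubicSpace (MaxVar k) K) :=
  .closure {p | ∃ f : MvPolynomial (MaxVar k) K, IsMaximalPerazzo k f ∧ IsPointOfCubic p f}

variable (K) in
/-- `X_max` as a projective variety, that is, with its reduced scheme structure. -/
abbrev MaximalVariety (k : ℕ) : Scheme.{u} :=
  (Scheme.IdealSheafData.vanishingIdeal (maximalLocus K k)).subscheme

variable (K) in
/-- The inclusion of `X_max` in `ℙ(S₃)`. -/
abbrev MaximalVariety.incl (k : ℕ) : MaximalVariety K k ⟶ CubicSpace (MaxVar k) K :=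
  (Scheme.IdealSheafData.vanishingIdeal (maximalLocus K k)).subschemeι

variable (K) in
/-- The cubic `∑_{i < k} x_i x_{k+1+i}² + x_k L²` with `L = x_{k+1} + ⋯ + x_{2k}`. -/
def specialCubic (k : ℕ) : MvPolynomial (MaxVar k) K :=
  ∑ i : Fin k, X (Sum.inl i.castSucc) * X (Sum.inr i) ^ 2 +
    X (Sum.inl (Fin.last k)) * (∑ j : Fin k, X (Sum.inr j)) ^ 2

end MaximalFamily

/-- The Zariski tangent space `(𝔪 / 𝔪²)^*` of a scheme at a point. -/
abbrev ZariskiTangentSpace (Y : Scheme.{u}) (y : Y) : Type u :=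
  Module.Dual (IsLocalRing.ResidueField (Y.presheaf.stalk y))
    (IsLocalRing.CotangentSpace (Y.presheaf.stalk y))

/-- The dimension of the Zariski tangent space over the residue field. -/
def zariskiTangentDim (Y : Scheme.{u}) (y : Y) : ℕ :=
  Module.finrank (IsLocalRing.ResidueField (Y.presheaf.stalk y)) (ZariskiTangentSpace Y y)

end

/-! Write `x` for the first `k + 1` variables and `y` for the other `k`. A cubic that is linear in
`x` has a Hessian matrix with a zero block of size `k + 1 > k`, so its Hessian vanishes. The cubics
`v ∘ A`, with `v` linear in `x` and `A` any matrix, form a cone `perazzoCone` parametrized by a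
vector space. Its ideal `perazzoIdeal` is therefore prime, and it contains the Hessian ideal. Almost
every member of a pencil in the cone through `f` belongs to the maximal family
(`exists_polynomial_isMaximalPerazzo`), so `perazzoIdeal` is the generic point of `X_max`
(`maximalLocus_eq_closure`).

The core is the tangent space of `ℋ` at `[f]`. Let `hess (f + ε τ) = 0` with `ε² = 0`, let `H`, `H'`
be the Hessian matrices of `f` and `τ`, and let `H w = 0`. Multiplying `(H + ε H') w` by the
adjugate gives `adj(H) H' w = 0`. A nonzero row of `adj(H)` is proportional to `w`, hence `wᵀ H' w =
0`. Along `y_j = ∏_{l ≠ j} t_l` the kernel of `H` is spanned by a polynomial vector in the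
`x`-directions, `w = (E t_1, …, E t_k, -∏ t)` with `E = ∑_l ∏_{j ≠ l} t_j`. Comparing the identity
`wᵀ H' w = 0` on the hyperplanes `t_i = 0` forces `τ = v' + ∑_l M_l(x) ∂f/∂y_l` with `v'` linear in
`x` and `M_l` linear forms (`exists_tangent_decomposition`). This is the velocity at `s = 0` of the
curve `(f + s v')(x, y + s M(x))`, which stays in the cone. So every tangent vector of `ℋ` at `[f]`
is the velocity of an arc inside `X_max`.

The passage from arcs to regularity is `isRegularLocalRing_of_arcs`. Let `F` be a form of degree `i`
in minimal generators of the maximal ideal whose value has order greater than `i`. Along an arc with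
velocity `c` the coefficient of order `i` is `F(c)`, so `F` vanishes at every `c` and is zero. The
associated graded ring is thus a polynomial ring, the local ring is a regular domain, and, again by
leading forms, an element vanishing on all arcs is zero. For `ℋ` at `[f]` this says that the local
ring is regular and that every form in `perazzoIdeal` is multiplied into the Hessian ideal by a form
not vanishing at `f`. Hence `ℋ` and `X_max` have the same local ring at `[f]`
(`nonempty_stalk_ringEquiv`), `X_max` is a component of `ℋ`, and the local ring of `ℋ` at its
generic point is a field.

For the dimension, the tangent space of a regular local ring has the Krull dimension of that ring.
This is at most `dim X_max`, because the spectrum of a stalk embeds. Conversely `dim X_max + 1` is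
at most the dimension of the coordinate ring of the cone. That is the height of the maximal ideal of
the affine point `f`, which exceeds the dimension of the local ring of `[f]` by at most one
(`topologicalKrullDim_maximalLocus_le`). -/

/-! ### Leading forms and quasi-regular generators of a maximal ideal -/

open IsLocalRing in
/-- Every element of a power of the maximal ideal has a leading form. -/
theorem exists_leadingForm {K O : Type*} [Field K] [CommRing O] [IsLocalRing O] [Algebra K O]
    (hres : ∀ a : O, ∃ c : K, a - algebraMap K O c ∈ maximalIdeal O) {n : ℕ} {x : Fin n → O}
    (hx : Ideal.span (Set.range x) = maximalIdeal O) (i : ℕ) {a : O}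
    (ha : a ∈ maximalIdeal O ^ i) :
    ∃ F : MvPolynomial (Fin n) K, F.IsHomogeneous i ∧ a - aeval x F ∈ maximalIdeal O ^ (i + 1) := by
  induction i generalizing a with
  | zero =>
    obtain ⟨c, hc⟩ := hres a
    exact ⟨C c, isHomogeneous_C _ _, by simpa using hc⟩
  | succ i ih =>
    rw [pow_succ'] at ha
    induction ha using Submodule.mul_induction_on' with
    | mem_mul_mem r hr s hs =>
      obtain ⟨G, hG, hGs⟩ := ih hs
      rw [← hx] at hr
      obtain ⟨l, hl⟩ := (Ideal.mem_span_range_iff_exists_fun).mp hr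
      choose c hc using fun j => hres (l j)
      have hr' : r ∈ maximalIdeal O := hx ▸ hr
      have hxm : ∀ j, x j ∈ maximalIdeal O := fun j => hx ▸ Ideal.subset_span ⟨j, rfl⟩
      have hlin : r - aeval x (∑ j, C (c j) * X j : MvPolynomial (Fin n) K) ∈
          maximalIdeal O ^ 2 := by
        rw [← hl, map_sum, ← Finset.sum_sub_distrib]
        refine sum_mem fun j _ => ?_
        rw [map_mul, aeval_X, aeval_C, ← sub_mul, pow_two]
        exact Ideal.mul_mem_mul (hc j) (hxm j)
      refine ⟨(∑ j, C (c j) * X j) * G, ?_, ?_⟩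
      · rw [add_comm]
        exact (IsHomogeneous.sum _ _ _ fun j _ => (isHomogeneous_X _ _).C_mul _).mul hG
      · rw [map_mul, show r * s - aeval x (∑ j, C (c j) * X j) * aeval x G =
          (r - aeval x (∑ j, C (c j) * X j)) * aeval x G + r * (s - aeval x G) by ring]
        have hGm : aeval x G ∈ maximalIdeal O ^ i := by
          have := sub_mem hs (Ideal.pow_le_pow_right (Nat.le_succ i) hGs)
          simpa using this
        refine add_mem ?_ ?_
        · have := Ideal.mul_mem_mul hlin hGm
          rwa [← pow_add, add_comm 2 i] at this
        · have := Ideal.mul_mem_mul hr' hGs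
          rwa [← pow_succ'] at this
    | add r _ s _ hr hs =>
      obtain ⟨F, hF, hFr⟩ := hr
      obtain ⟨G, hG, hGs⟩ := hs
      refine ⟨F + G, hF.add hG, ?_⟩
      rw [map_add, add_sub_add_comm]
      exact add_mem hFr hGs

/-- Generators `x` of the maximal ideal such that the initial forms of a local `K`-algebra with
residue field `K` are polynomials in `x`. -/
def IsQuasiRegular (K : Type*) {O : Type*} [Field K] [CommRing O] [IsLocalRing O] [Algebra K O]
    {n : ℕ} (x : Fin n → O) : Prop :=
  Ideal.span (Set.range x) = IsLocalRing.maximalIdeal O ∧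
    ∀ (i : ℕ) (F : MvPolynomial (Fin n) K), F.IsHomogeneous i →
      aeval x F ∈ IsLocalRing.maximalIdeal O ^ (i + 1) → F = 0

section

open IsLocalRing

variable {K O : Type*} [Field K] [CommRing O] [IsLocalRing O] [Algebra K O]
  {n : ℕ} {x : Fin n → O}

theorem IsQuasiRegular.aeval_mem (hx : IsQuasiRegular K x) {i : ℕ} {F : MvPolynomial (Fin n) K}
    (hF : F.IsHomogeneous i) : aeval x F ∈ maximalIdeal O ^ i := by
  rw [aeval_def, eval₂_eq']
  refine sum_mem fun d hd => Ideal.mul_mem_left _ _ ?_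
  have hd' : ∑ j, d j = i := by
    rw [← hF (mem_support_iff.mp hd), Finsupp.weight_apply, Finsupp.sum_fintype _ _ (by simp)]
    simp
  rw [← hd', ← Finset.prod_pow_eq_pow_sum]
  exact Ideal.prod_mem_prod fun j _ => Ideal.pow_mem_pow (hx.1 ▸ Ideal.subset_span ⟨j, rfl⟩) _

/-- A nonzero element has a nonzero leading form. -/
theorem IsQuasiRegular.exists_order [IsNoetherianRing O] (hx : IsQuasiRegular K x)
    (hres : ∀ a : O, ∃ c : K, a - algebraMap K O c ∈ maximalIdeal O) {a : O} (ha : a ≠ 0) :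
    ∃ (i : ℕ) (F : MvPolynomial (Fin n) K), F.IsHomogeneous i ∧ F ≠ 0 ∧
      a - aeval x F ∈ maximalIdeal O ^ (i + 1) := by
  -- If every leading form were zero, `a` would lie in all powers of the maximal ideal, against
  -- Krull's intersection theorem.
  by_contra! h
  have key : ∀ i, a ∈ maximalIdeal O ^ i := by
    intro i
    induction i with
    | zero => simp
    | succ i ih =>
      obtain ⟨F, hF, hFa⟩ := exists_leadingForm hres hx.1 i ih
      by_cases hF0 : F = 0
      · simpa [hF0] using hFa
      · exact absurd hFa (h i F hF hF0)
  apply ha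
  have h0 := Ideal.iInf_pow_eq_bot_of_isLocalRing (maximalIdeal O) (Ideal.IsPrime.ne_top')
  have : a ∈ ⨅ i, maximalIdeal O ^ i := by simpa [Ideal.mem_iInf] using key
  rwa [h0] at this

/-- Leading forms multiply as in the polynomial ring; since that ring is a domain, so is `O`, and
orders add. -/
theorem IsQuasiRegular.mul_leadingForm (hx : IsQuasiRegular K x)
    {i j : ℕ} {F G : MvPolynomial (Fin n) K} (hF : F.IsHomogeneous i) (hG : G.IsHomogeneous j)
    {a b : O} (ha : a - aeval x F ∈ maximalIdeal O ^ (i + 1))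
    (hb : b - aeval x G ∈ maximalIdeal O ^ (j + 1)) :
    a * b - aeval x (F * G) ∈ maximalIdeal O ^ (i + j + 1) := by
  have hb' : b ∈ maximalIdeal O ^ j := by
    have := add_mem (Ideal.pow_le_pow_right (Nat.le_succ j) hb) (hx.aeval_mem hG)
    simpa using this
  rw [map_mul, show a * b - aeval x F * aeval x G =
    (a - aeval x F) * b + aeval x F * (b - aeval x G) by ring]
  refine add_mem ?_ ?_
  · have := Ideal.mul_mem_mul ha hb'
    rwa [← pow_add, add_right_comm] at this
  · have := Ideal.mul_mem_mul (hx.aeval_mem hF) hb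
    rwa [← pow_add, ← add_assoc] at this

theorem IsQuasiRegular.isDomain [IsNoetherianRing O] (hx : IsQuasiRegular K x)
    (hres : ∀ a : O, ∃ c : K, a - algebraMap K O c ∈ maximalIdeal O) : IsDomain O := by
  have : NoZeroDivisors O := by
    refine ⟨fun {a b} hab => ?_⟩
    by_contra! h
    obtain ⟨i, F, hF, hF0, hFa⟩ := hx.exists_order hres h.1
    obtain ⟨j, G, hG, hG0, hGb⟩ := hx.exists_order hres h.2
    have := hx.mul_leadingForm hF hG hFa hGb
    rw [hab, zero_sub, neg_mem_iff] at this
    exact mul_ne_zero hF0 hG0 (hx.2 _ _ (hF.mul hG) this)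
  exact NoZeroDivisors.to_isDomain O

end

-- This is the inductive step for quasi-regularity: the classes of the remaining generators stay
-- quasi-regular modulo `x 0`. A relation modulo `x 0` has a leading form divisible by `X 0`, which
-- a nonzero form in the other variables cannot be.
open IsLocalRing in
theorem IsQuasiRegular.eq_zero_of_quotient {K O : Type*} [Field K] [CommRing O] [IsLocalRing O]
    [IsNoetherianRing O] [Algebra K O] {n : ℕ} {x : Fin (n + 1) → O} (hx : IsQuasiRegular K x)
    (hres : ∀ a : O, ∃ c : K, a - algebraMap K O c ∈ maximalIdeal O)
    {i : ℕ} {F : MvPolynomial (Fin n) K} (hF : F.IsHomogeneous i)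
    (h : ∃ a, aeval (fun j : Fin n => x j.succ) F - x 0 * a ∈ maximalIdeal O ^ (i + 1)) :
    F = 0 := by
  obtain ⟨a, ha⟩ := h
  have hdom := hx.isDomain hres
  have hren : aeval (fun j : Fin n => x j.succ) F = aeval x (rename Fin.succ F) := by
    rw [aeval_rename]; rfl
  have hFr : (rename Fin.succ F : MvPolynomial (Fin (n + 1)) K).IsHomogeneous i :=
    hF.rename_isHomogeneous
  rw [hren] at ha
  have hinj : Function.Injective (rename Fin.succ : MvPolynomial (Fin n) K → _) :=
    rename_injective _ (Fin.succ_injective n)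
  -- a form in the remaining variables is not divisible by the first variable
  have hdiv : ∀ G : MvPolynomial (Fin (n + 1)) K, rename Fin.succ F = X 0 * G → F = 0 := by
    intro G hG
    have := congrArg (aeval (Fin.cons 0 X : Fin (n + 1) → MvPolynomial (Fin n) K)) hG
    rw [aeval_rename, map_mul, aeval_X, Fin.cons_zero, zero_mul] at this
    rw [← this]
    exact (MvPolynomial.aeval_X_left_apply F).symm
  by_cases ha0 : a = 0
  · rw [ha0, mul_zero, sub_zero] at ha
    exact hdiv 0 (by rw [hx.2 i _ hFr ha, mul_zero])
  obtain ⟨j, G, hG, hG0, hGa⟩ := hx.exists_order hres ha0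
  have hX := hx.mul_leadingForm (isHomogeneous_X K 0) hG (a := x 0) (by simp) hGa
  have hne : X 0 * G ≠ 0 := mul_ne_zero (X_ne_zero 0) hG0
  -- The order of `x 0 * a` is `1 + j`. If it is below `i` then the leading form of `x 0 * a` would
  -- vanish. If it equals `i` then `F` is a multiple of `X 0`. If it exceeds `i` then `F` itself has
  -- value of too high order.
  rcases lt_trichotomy (1 + j) i with hij | hij | hij
  · refine absurd (hx.2 _ _ ((isHomogeneous_X K 0).mul hG) ?_) hne
    have h1 : x 0 * a ∈ maximalIdeal O ^ (1 + j + 1) := by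
      have h2 := Ideal.pow_le_pow_right (show 1 + j + 1 ≤ i + 1 by omega) ha
      have h3 := Ideal.pow_le_pow_right (show 1 + j + 1 ≤ i by omega) (hx.aeval_mem hFr)
      simpa using sub_mem h3 h2
    simpa using sub_mem h1 hX
  · refine hdiv G (sub_eq_zero.mp (hx.2 i _ (hFr.sub ?_) ?_))
    · rw [← hij]
      exact (isHomogeneous_X K 0).mul hG
    · rw [hij] at hX
      rw [map_sub]
      simpa using add_mem ha hX
  · refine hdiv 0 ?_
    rw [mul_zero]
    refine hx.2 i _ hFr ?_
    have h1 := Ideal.pow_le_pow_right (show i + 1 ≤ 1 + j by omega)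
      (hx.aeval_mem ((isHomogeneous_X K 0).mul hG))
    have h2 := Ideal.pow_le_pow_right (show i + 1 ≤ 1 + j + 1 by omega) hX
    have h3 := add_mem h1 h2
    simpa using add_mem ha h3

open IsLocalRing in
/-- A local ring with a quasi-regular system of `n` generators of its maximal ideal has dimension at
least `n`. -/
theorem IsQuasiRegular.le_ringKrullDim {K : Type*} [Field K] {n : ℕ} :
    ∀ {O : Type*} [CommRing O] [IsLocalRing O] [IsNoetherianRing O] [Algebra K O]
      {x : Fin n → O}, IsQuasiRegular K x →
      (∀ a : O, ∃ c : K, a - algebraMap K O c ∈ maximalIdeal O) → (n : WithBot ℕ∞) ≤ ringKrullDim O := by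
  induction n with
  | zero =>
    intro O _ _ _ _ x _ _
    exact ringKrullDim_nonneg_of_nontrivial
  | succ n ih =>
    intro O _ _ _ _ x hx hres
    have hdom := hx.isDomain hres
    have hx0m : ∀ i, x i ∈ maximalIdeal O := fun i => hx.1 ▸ Ideal.subset_span ⟨i, rfl⟩
    have hx0 : x 0 ≠ 0 := by
      intro h
      have := hx.2 1 (X 0) (isHomogeneous_X _ _) (by simp [h])
      exact X_ne_zero _ this
    set I : Ideal O := Ideal.span {x 0} with hI
    have hIle : I ≤ maximalIdeal O := by
      rw [hI, Ideal.span_singleton_le_iff_mem]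
      exact hx0m 0
    have hnt : Nontrivial (O ⧸ I) :=
      Ideal.Quotient.nontrivial_iff.mpr fun h => by
        rw [h, top_le_iff] at hIle
        exact Ideal.IsPrime.ne_top' hIle
    have hloc : IsLocalRing (O ⧸ I) :=
      IsLocalRing.of_surjective' (Ideal.Quotient.mk I) Ideal.Quotient.mk_surjective
    have hmax : (maximalIdeal O).map (Ideal.Quotient.mk I) = maximalIdeal (O ⧸ I) := by
      exact IsLocalRing.map_maximalIdeal_of_surjective (Ideal.Quotient.mk I) Ideal.Quotient.mk_surjective
    have hq : IsQuasiRegular K (fun j : Fin n => Ideal.Quotient.mk I (x j.succ)) := by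
      refine ⟨?_, fun i F hF hFm => ?_⟩
      · rw [← hmax, ← hx.1, Ideal.map_span, ← Set.range_comp]
        refine le_antisymm (Ideal.span_mono ?_) (Ideal.span_le.mpr ?_)
        · rintro _ ⟨j, rfl⟩
          exact ⟨j.succ, rfl⟩
        · rintro _ ⟨j, rfl⟩
          refine Fin.cases ?_ (fun j => Ideal.subset_span ⟨j, rfl⟩) j
          have : Ideal.Quotient.mk I (x 0) = 0 :=
            Ideal.Quotient.eq_zero_iff_mem.mpr (Ideal.subset_span rfl)
          simp [this]
      · exact hx.eq_zero_of_quotient hres hF (by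
          rw [← hmax, ← Ideal.map_pow, Ideal.mem_map_iff_of_surjective _
            Ideal.Quotient.mk_surjective] at hFm
          obtain ⟨g, hg, hgF⟩ := hFm
          have h1 : Ideal.Quotient.mk I (aeval (fun j : Fin n => x j.succ) F) =
              Ideal.Quotient.mk I g := by
            rw [hgF]
            exact (MvPolynomial.map_aeval _ _ _).trans (by rw [coe_eval₂Hom, aeval_def]; rfl)
          obtain ⟨a, ha⟩ := Ideal.mem_span_singleton'.mp (Ideal.Quotient.eq.mp h1)
          exact ⟨a, by rwa [mul_comm, ha, sub_sub_cancel]⟩)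
    have h1 := ih hq (fun a => by
      obtain ⟨a, rfl⟩ := Ideal.Quotient.mk_surjective a
      obtain ⟨c, hc⟩ := hres a
      refine ⟨c, ?_⟩
      rw [← hmax]
      exact Ideal.mem_map_of_mem _ hc)
    have h2 := ringKrullDim_quotient_succ_le_of_nonZeroDivisor
      (mem_nonZeroDivisors_of_ne_zero hx0)
    calc ((n + 1 : ℕ) : WithBot ℕ∞) = n + 1 := by push_cast; rfl
      _ ≤ ringKrullDim (O ⧸ I) + 1 := by gcongr
      _ ≤ _ := h2

/-! ### Arcs, tangent vectors and regularity -/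

section Arcs

open IsLocalRing

variable {K O : Type*} [Field K] [CommRing O] [IsLocalRing O] [Algebra K O]

theorem aeval_mul_of_isHomogeneous {K R σ : Type*} [Field K] [CommRing R] [Algebra K R] {i : ℕ}
    {F : MvPolynomial σ K} (hF : F.IsHomogeneous i) (t : R) (u : σ → R) :
    aeval (fun j => t * u j) F = t ^ i * aeval u F := by
  rw [aeval_def, aeval_def, eval₂_eq, eval₂_eq, Finset.mul_sum]
  refine Finset.sum_congr rfl fun d hd => ?_
  have hd' : ∑ j ∈ d.support, d j = i := by
    rw [← hF (mem_support_iff.mp hd), Finsupp.weight_apply, Finsupp.sum]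
    simp
  simp_rw [mul_pow]
  rw [Finset.prod_mul_distrib, Finset.prod_pow_eq_pow_sum, hd']
  ring

/-- If the constant term `c` were nonzero, `a - c` would be a unit of `O` sent to a power series
without constant term. -/
theorem constantCoeff_eq_zero_of_mem_maximalIdeal (θ : O →ₐ[K] PowerSeries K) {a : O}
    (ha : a ∈ maximalIdeal O) : PowerSeries.constantCoeff (θ a) = 0 := by
  by_contra h
  have h1 : IsUnit (a - algebraMap K O (PowerSeries.constantCoeff (θ a))) := by
    by_contra h2
    have h3 := sub_mem ha ((mem_maximalIdeal _).mpr h2)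
    rw [sub_sub_cancel] at h3
    exact (mem_maximalIdeal _).mp h3 ((IsUnit.mk0 _ h).map _)
  have h2 := (h1.map θ).map (PowerSeries.constantCoeff (R := K))
  rw [map_sub, map_sub, AlgHom.commutes] at h2
  simp at h2

theorem X_pow_dvd_of_mem_maximalIdeal_pow (θ : O →ₐ[K] PowerSeries K) {a : O} {i : ℕ}
    (ha : a ∈ maximalIdeal O ^ i) : (PowerSeries.X : PowerSeries K) ^ i ∣ θ a := by
  have h : (maximalIdeal O).map θ ≤ Ideal.span {PowerSeries.X} := by
    rw [Ideal.map_le_iff_le_comap]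
    intro b hb
    rw [Ideal.mem_comap, Ideal.mem_span_singleton, PowerSeries.X_dvd_iff]
    exact constantCoeff_eq_zero_of_mem_maximalIdeal θ hb
  have h1 := Ideal.mem_map_of_mem θ ha
  rw [Ideal.map_pow] at h1
  have h2 := Ideal.pow_right_mono h i h1
  rwa [Ideal.span_singleton_pow, Ideal.mem_span_singleton] at h2

/-- The residue map of a local `K`-algebra with residue field `K`. -/
theorem exists_residueMap
    (hres : ∀ a : O, ∃ c : K, a - algebraMap K O c ∈ maximalIdeal O) :
    ∃ e : ResidueField O →+* K, ∀ c, e (residue O (algebraMap K O c)) = c := by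
  have hbij : Function.Bijective ((residue O).comp (algebraMap K O)) := by
    refine ⟨RingHom.injective _, fun z => ?_⟩
    obtain ⟨a, rfl⟩ := residue_surjective z
    obtain ⟨c, hc⟩ := hres a
    refine ⟨c, ?_⟩
    rw [RingHom.comp_apply, ← sub_eq_zero, ← map_sub, residue_eq_zero_iff, ← neg_mem_iff, neg_sub]
    exact hc
  exact ⟨(RingEquiv.ofBijective _ hbij).symm.toRingHom,
    fun c => (RingEquiv.ofBijective _ hbij).symm_apply_apply c⟩

/-- Linear functionals on the cotangent space extend to homomorphisms to the dual numbers. -/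
theorem exists_dualNumber_hom
    (hres : ∀ a : O, ∃ c : K, a - algebraMap K O c ∈ maximalIdeal O)
    (e : ResidueField O →+* K) (he : ∀ c, e (residue O (algebraMap K O c)) = c)
    (φ : CotangentSpace O →ₗ[ResidueField O] ResidueField O) :
    ∃ δ : O →ₐ[K] DualNumber K, ∀ a (ha : a ∈ maximalIdeal O),
      (δ a).snd = e (φ ((maximalIdeal O).toCotangent ⟨a, ha⟩)) := by
  set r : O →+* K := e.comp (residue O) with hr
  have hmem : ∀ a, a - algebraMap K O (r a) ∈ maximalIdeal O := by
    intro a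
    obtain ⟨c, hc⟩ := hres a
    have : r a = c := by
      rw [← he c, hr, RingHom.comp_apply, ← sub_eq_zero, ← map_sub, ← map_sub]
      rw [(residue_eq_zero_iff _).mpr hc, map_zero]
    rwa [this]
  have hrc : ∀ c, r (algebraMap K O c) = c := he
  let T : maximalIdeal O →+ K :=
    (e.toAddMonoidHom.comp φ.toAddMonoidHom).comp (maximalIdeal O).toCotangent.toAddMonoidHom
  have hTs : ∀ (a : O) (v : maximalIdeal O), T (a • v) = r a * T v := by
    intro a v
    change e (φ ((maximalIdeal O).toCotangent (a • v))) = _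
    rw [map_smul]
    have : a • ((maximalIdeal O).toCotangent v : CotangentSpace O) =
      residue O a • ((maximalIdeal O).toCotangent v : CotangentSpace O) := rfl
    erw [this]
    rw [map_smul, smul_eq_mul, map_mul]
    rfl
  -- `T` kills products of two elements of the maximal ideal, which is what makes `D` below a
  -- derivation.
  have hT2 : ∀ (u v : maximalIdeal O), T ((u : O) • v) = 0 := by
    intro u v
    rw [hTs]
    have : r u = 0 := by
      rw [hr, RingHom.comp_apply, (residue_eq_zero_iff _).mpr u.2, map_zero]
    rw [this, zero_mul]
  -- The derivation at the closed point attached to `T`: subtract the value, then apply the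
  -- functional.
  let D : O → K := fun a => T ⟨a - algebraMap K O (r a), hmem a⟩
  have hDadd : ∀ a b, D (a + b) = D a + D b := by
    intro a b
    change T _ = T _ + T _
    rw [← map_add]
    refine congrArg T (Subtype.ext ?_)
    simp only [Submodule.coe_add, map_add]
    ring
  have hDmul : ∀ a b, D (a * b) = r a * D b + r b * D a := by
    intro a b
    change T _ = r a * T _ + r b * T _
    have h1 : (⟨a * b - algebraMap K O (r (a * b)), hmem _⟩ : maximalIdeal O) =
        algebraMap K O (r a) • ⟨b - algebraMap K O (r b), hmem b⟩ +
        algebraMap K O (r b) • ⟨a - algebraMap K O (r a), hmem a⟩ +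
        (a - algebraMap K O (r a)) • ⟨b - algebraMap K O (r b), hmem b⟩ := by
      ext
      simp only [Submodule.coe_add, Submodule.coe_smul, smul_eq_mul, map_mul]
      ring
    rw [h1, map_add, map_add, hTs, hTs, hrc, hrc]
    have := hT2 ⟨a - algebraMap K O (r a), hmem a⟩ ⟨b - algebraMap K O (r b), hmem b⟩
    rw [this, add_zero]
  have hDc : ∀ c, D (algebraMap K O c) = 0 := by
    intro c
    rw [← map_zero T]
    change T _ = T _
    congr 1
    ext
    simp [hrc]
  let δ : O →ₐ[K] DualNumber K :=
    { toFun := fun a => TrivSqZeroExt.inl (r a) + TrivSqZeroExt.inr (D a)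
      map_one' := by
        have := hDc 1
        rw [map_one] at this
        rw [this, map_one]
        ext <;> simp
      map_mul' := fun a b => by
        ext
        · simp
        · simp [hDmul, mul_comm]
      map_zero' := by
        have := hDc 0
        rw [map_zero] at this
        rw [this, map_zero]
        ext <;> simp
      map_add' := fun a b => by
        ext
        · simp
        · simp [hDadd]
      commutes' := fun c => by
        rw [hDc, hrc, TrivSqZeroExt.algebraMap_eq_inl]
        ext <;> simp }
  refine ⟨δ, fun a ha => ?_⟩
  have hra : r a = 0 := by
    rw [hr, RingHom.comp_apply, (residue_eq_zero_iff _).mpr ha, map_zero]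
  change (TrivSqZeroExt.inl (r a) + TrivSqZeroExt.inr (D a) : DualNumber K).snd = T ⟨a, ha⟩
  rw [TrivSqZeroExt.snd_add, TrivSqZeroExt.snd_inl, TrivSqZeroExt.snd_inr, zero_add]
  change T _ = T _
  congr 1
  ext
  simp [hra]

theorem coeff_one_mul_of_constantCoeff_eq_zero (p q : PowerSeries K)
    (hq : PowerSeries.constantCoeff q = 0) :
    PowerSeries.coeff 1 (p * q) = PowerSeries.constantCoeff p * PowerSeries.coeff 1 q := by
  rw [PowerSeries.coeff_mul, Finset.Nat.antidiagonal_succ]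
  simp [hq]

/-- If every tangent vector is the tangent vector of an arc from a given set of arcs, then an
element on which these arcs vanish is zero, and the local ring is regular and a domain. -/
theorem isRegularLocalRing_of_arcs [Infinite K] [IsNoetherianRing O]
    (hres : ∀ a : O, ∃ c : K, a - algebraMap K O c ∈ maximalIdeal O)
    {σ : Type*} {y : σ → O} (hy : Ideal.span (Set.range y) = maximalIdeal O)
    {Θ : Set (O →ₐ[K] PowerSeries K)}
    (hΘ : ∀ δ : O →ₐ[K] DualNumber K, ∃ θ ∈ Θ, ∀ s,
      PowerSeries.coeff 1 (θ (y s)) = (δ (y s)).snd) :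
    (∀ a : O, (∀ θ ∈ Θ, θ a = 0) → a = 0) ∧ IsDomain O ∧ IsRegularLocalRing O := by
  obtain ⟨e, he⟩ := exists_residueMap hres
  set n := Module.finrank (ResidueField O) (CotangentSpace O) with hn
  let b := Module.finBasis (ResidueField O) (CotangentSpace O)
  choose x' hx' using fun i => (maximalIdeal O).toCotangent_surjective (b i)
  let x : Fin n → O := fun i => x' i
  have hx : Ideal.span (Set.range x) = maximalIdeal O := by
    have h1 : Set.range x = Subtype.val '' Set.range x' := by
      rw [← Set.range_comp]; rfl
    have h2 : Submodule.span (ResidueField O) ((maximalIdeal O).toCotangent '' Set.range x') = ⊤ := by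
      rw [← Set.range_comp]
      convert! b.span_eq
      exact funext hx'
    rw [IsLocalRing.CotangentSpace.span_image_eq_top_iff] at h2
    have h3 := congrArg (Submodule.map (maximalIdeal O).subtype) h2
    rw [Submodule.map_span, Submodule.map_top, Submodule.range_subtype] at h3
    rw [h1]
    exact h3
  have hleading : ∀ (i : ℕ) (F : MvPolynomial (Fin n) K), F.IsHomogeneous i →
      (∀ θ ∈ Θ, PowerSeries.X ^ (i + 1) ∣ θ (aeval x F)) → F = 0 := by
    intro i F hF hdvd
    -- Over an infinite field it is enough that `F` vanishes at every `c`. The vector `c` is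
    -- realized as the tangent vector sending the generator `x i` to `c i`, and then as the velocity
    -- of an arc.
    refine MvPolynomial.funext fun c => ?_
    rw [map_zero]
    obtain ⟨δ, hδ⟩ := exists_dualNumber_hom hres e he
      (b.constr (ResidueField O) fun i => residue O (algebraMap K O (c i)))
    obtain ⟨θ, hθ, hθδ⟩ := hΘ δ
    -- The arc and the tangent vector are only assumed to agree on the generators `y`. Both are
    -- derivations to first order, so they agree on the whole maximal ideal.
    have hone : ∀ a ∈ maximalIdeal O, PowerSeries.coeff 1 (θ a) = (δ a).snd := by
      intro a ha
      rw [← hy] at ha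
      induction ha using Submodule.span_induction with
      | mem a ha =>
        obtain ⟨s, rfl⟩ := ha
        exact hθδ s
      | zero => simp
      | add a b _ _ ha hb => rw [map_add, map_add, map_add, ha, hb, TrivSqZeroExt.snd_add]
      | smul r a ha' ha =>
        rw [← Ideal.span, hy] at ha'
        obtain ⟨d, hd⟩ := hres r
        have h0 := constantCoeff_eq_zero_of_mem_maximalIdeal θ ha'
        have hr := constantCoeff_eq_zero_of_mem_maximalIdeal θ hd
        have hr' : PowerSeries.constantCoeff (θ r) = d := by
          rw [map_sub, map_sub, AlgHom.commutes] at hr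
          simpa [PowerSeries.algebraMap_apply, sub_eq_zero] using hr
        have hsnd : (δ ((r - algebraMap K O d) * a)).snd = 0 := by
          rw [hδ _ (Ideal.mul_mem_left _ _ ha')]
          have : (maximalIdeal O).toCotangent ⟨(r - algebraMap K O d) * a,
              Ideal.mul_mem_left _ _ ha'⟩ = 0 := by
            rw [Ideal.toCotangent_eq_zero]
            rw [pow_two]
            exact Ideal.mul_mem_mul hd ha'
          erw [this]
          rw [map_zero, map_zero]
        rw [smul_eq_mul, map_mul, coeff_one_mul_of_constantCoeff_eq_zero _ _ h0, ha, hr']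
        have h3 : r * a = algebraMap K O d * a + (r - algebraMap K O d) * a := by ring
        rw [h3, map_add, TrivSqZeroExt.snd_add, hsnd, map_mul, AlgHom.commutes, add_zero]
        simp [TrivSqZeroExt.algebraMap_eq_inl]
    have hxm : ∀ j, x j ∈ maximalIdeal O := fun j => (x' j).2
    have hu : ∀ j, ∃ u : PowerSeries K, θ (x j) = PowerSeries.X * u :=
      fun j => (PowerSeries.X_dvd_iff.mpr (constantCoeff_eq_zero_of_mem_maximalIdeal θ (hxm j)))
    choose u hu using hu
    have huc : ∀ j, PowerSeries.constantCoeff (u j) = c j := by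
      intro j
      have h1 := hone _ (hxm j)
      rw [hu, hδ _ (hxm j)] at h1
      have h2 : (maximalIdeal O).toCotangent ⟨x j, hxm j⟩ = b j := hx' j
      erw [h2] at h1
      rw [Module.Basis.constr_basis, he] at h1
      rw [← h1, ← PowerSeries.coeff_zero_eq_constantCoeff_apply]
      exact (PowerSeries.coeff_succ_X_mul 0 _).symm
    have h1 := hdvd θ hθ
    rw [MvPolynomial.comp_aeval_apply] at h1
    have h2 : (fun j => θ (x j)) = fun j => PowerSeries.X * u j := funext hu
    change _ ∣ aeval (fun j => θ (x j)) F at h1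
    -- Homogeneity gives `θ (F(x)) = X ^ i * F(u)`, so divisibility by `X ^ (i + 1)` kills the
    -- constant term `F(c)` of `F(u)`.
    rw [h2, aeval_mul_of_isHomogeneous hF, pow_succ, mul_dvd_mul_iff_left
      (pow_ne_zero _ PowerSeries.X_ne_zero), PowerSeries.X_dvd_iff] at h1
    rw [← h1, show c = fun j => PowerSeries.constantCoeff (u j) from (funext huc).symm]
    have h4 := MvPolynomial.eval₂_comp_left (PowerSeries.constantCoeff (R := K))
      (algebraMap K (PowerSeries K)) u F
    rw [aeval_def, h4, eval]
    rw [coe_eval₂Hom]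
    congr 1
  have hQR : IsQuasiRegular K x := ⟨hx, fun i F hF hm => hleading i F hF fun θ _ =>
    X_pow_dvd_of_mem_maximalIdeal_pow θ hm⟩
  refine ⟨fun a ha => ?_, hQR.isDomain hres, ?_⟩
  · by_contra h0
    obtain ⟨i, F, hF, hF0, hFa⟩ := hQR.exists_order hres h0
    refine hF0 (hleading i F hF fun θ hθ => ?_)
    have := X_pow_dvd_of_mem_maximalIdeal_pow θ hFa
    rwa [map_sub, ha θ hθ, zero_sub, dvd_neg] at this
  · refine IsRegularLocalRing.of_spanFinrank_maximalIdeal_le _ ?_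
    rw [spanFinrank_maximalIdeal_eq_finrank_cotangentSpace]
    exact hQR.le_ringKrullDim hres

end Arcs

/-! ### Homogeneous localization at a prime -/

section HomogeneousLocalization

open HomogeneousLocalization

variable {K A : Type*} [Field K] [CommRing A] [Algebra K A] {𝒜 : ℕ → Submodule K A}
  [GradedAlgebra 𝒜]

instance HomogeneousLocalization.algebraOfGradedAlgebra (x : Submonoid A) :
    Algebra K (HomogeneousLocalization 𝒜 x) where
  -- The scalar action already present is reused, so that no second one appears.
  smul := (· • ·)
  algebraMap := (fromZeroRingHom 𝒜 x).comp (algebraMap K (𝒜 0))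
  commutes' _ _ := mul_comm _ _
  smul_def' c a := by
    apply val_injective
    refine (val_smul x c a).trans ?_
    rw [val_mul, Algebra.smul_def]
    rfl

/-- Some homogeneous component of `b` lies outside `𝔭`. As `a` is homogeneous, the components of `b
* a` are the products of `a` with the components of `b`, so each of these is zero. -/
theorem exists_homogeneous_mul_eq_zero {𝔭 : Ideal A} {a b : A} {n : ℕ} (ha : a ∈ 𝒜 n)
    (hb : b ∉ 𝔭) (hab : b * a = 0) : ∃ d, ∃ c ∈ 𝒜 d, c ∉ 𝔭 ∧ c * a = 0 := by
  classical
  obtain ⟨d, hd⟩ : ∃ d, (DirectSum.decompose 𝒜 b d : A) ∉ 𝔭 := by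
    by_contra! h
    apply hb
    rw [← DirectSum.sum_support_decompose 𝒜 b]
    exact sum_mem fun d _ => h d
  refine ⟨d, _, SetLike.coe_mem _, hd, ?_⟩
  rw [← DirectSum.coe_decompose_mul_add_of_right_mem 𝒜 ha, hab]
  simp

variable (𝔭 : Ideal A) [𝔭.IsPrime]

theorem HomogeneousLocalization.AtPrime.mk_eq_zero_iff (c : NumDenSameDeg 𝒜 𝔭.primeCompl) :
    (HomogeneousLocalization.mk c : AtPrime 𝒜 𝔭) = 0 ↔
      ∃ d, ∃ b ∈ 𝒜 d, b ∉ 𝔭 ∧ b * c.num = 0 := by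
  rw [ext_iff_val, val_mk, val_zero, Localization.mk_eq_mk', IsLocalization.mk'_eq_zero_iff]
  constructor
  · rintro ⟨⟨b, hb⟩, hbc⟩
    exact exists_homogeneous_mul_eq_zero c.num.2 hb hbc
  · rintro ⟨d, b, -, hb, hbc⟩
    exact ⟨⟨b, hb⟩, hbc⟩

theorem HomogeneousLocalization.AtPrime.mk_eq_mk_iff (c c' : NumDenSameDeg 𝒜 𝔭.primeCompl) :
    (HomogeneousLocalization.mk c : AtPrime 𝒜 𝔭) = HomogeneousLocalization.mk c' ↔
      ∃ d, ∃ b ∈ 𝒜 d, b ∉ 𝔭 ∧ b * (c'.den * c.num - c.den * c'.num : A) = 0 := by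
  rw [ext_iff_val, val_mk, val_mk, Localization.mk_eq_mk',
    IsLocalization.mk'_eq_iff_eq, IsLocalization.eq_iff_exists 𝔭.primeCompl]
  constructor
  · rintro ⟨⟨b, hb⟩, hbc⟩
    refine exists_homogeneous_mul_eq_zero (n := c'.deg + c.deg) ?_ hb (b := b) ?_
    · refine sub_mem (SetLike.mul_mem_graded c'.den.2 c.num.2) ?_
      rw [add_comm]
      exact SetLike.mul_mem_graded c.den.2 c'.num.2
    · rw [mul_sub, sub_eq_zero]
      exact hbc
  · rintro ⟨d, b, -, hb, hbc⟩
    refine ⟨⟨b, hb⟩, ?_⟩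
    rw [mul_sub, sub_eq_zero] at hbc
    exact hbc

/-- The universal property of the homogeneous localization at a prime ideal. -/
theorem HomogeneousLocalization.AtPrime.exists_lift {R : Type*} [CommRing R] [Algebra K R]
    (g : A →ₐ[K] R) (hg : ∀ d, ∀ b ∈ 𝒜 d, b ∉ 𝔭 → IsUnit (g b)) :
    ∃ θ : AtPrime 𝒜 𝔭 →ₐ[K] R, ∀ c : NumDenSameDeg 𝒜 𝔭.primeCompl,
      θ (HomogeneousLocalization.mk c) * g c.den = g c.num := by
  have hu : ∀ c : NumDenSameDeg 𝒜 𝔭.primeCompl, IsUnit (g c.den) :=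
    fun c => hg _ _ c.den.2 c.den_mem
  let φ : AtPrime 𝒜 𝔭 → R := fun a => Quotient.liftOn' a
    (fun c => g c.num * Ring.inverse (g c.den)) (by
      intro c c' h
      have h1 : (HomogeneousLocalization.mk c : AtPrime 𝒜 𝔭) = HomogeneousLocalization.mk c' :=
        Quotient.sound' h
      obtain ⟨d, b, hb, hbp, hbc⟩ := (mk_eq_mk_iff 𝔭 c c').mp h1
      have h2 := congrArg g hbc
      rw [map_mul, map_zero, (hg d b hb hbp).mul_right_eq_zero, map_sub, map_mul, map_mul,
        sub_eq_zero] at h2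
      rw [← (hu c).mul_left_inj, ← (hu c').mul_left_inj, mul_assoc (g c.num),
        Ring.inverse_mul_cancel _ (hu c), mul_one]
      have h3 := Ring.inverse_mul_cancel _ (hu c')
      linear_combination h2 - g c'.num * g c.den * h3)
  have hφ : ∀ c : NumDenSameDeg 𝒜 𝔭.primeCompl,
      φ (HomogeneousLocalization.mk c) * g c.den = g c.num := fun c => by
    change g c.num * Ring.inverse (g c.den) * g c.den = g c.num
    rw [mul_assoc, Ring.inverse_mul_cancel _ (hu c), mul_one]
  refine ⟨{ toFun := φ, map_one' := ?_, map_mul' := ?_, map_zero' := ?_, map_add' := ?_,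
            commutes' := ?_ }, hφ⟩
  · change g (1 : A) * Ring.inverse (g (1 : A)) = 1
    rw [map_one, Ring.inverse_one, mul_one]
  · intro a b
    obtain ⟨c, rfl⟩ := mk_surjective a
    obtain ⟨c', rfl⟩ := mk_surjective b
    rw [← mk_mul, ← (hu (c * c')).mul_left_inj, hφ, NumDenSameDeg.num_mul, NumDenSameDeg.den_mul,
      map_mul, map_mul, ← hφ c, ← hφ c']
    ring
  · change g (0 : A) * Ring.inverse (g (1 : A)) = 0
    rw [map_zero, zero_mul]
  · intro a b
    obtain ⟨c, rfl⟩ := mk_surjective a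
    obtain ⟨c', rfl⟩ := mk_surjective b
    rw [← mk_add, ← (hu (c + c')).mul_left_inj, hφ, NumDenSameDeg.num_add, NumDenSameDeg.den_add,
      map_add, map_mul, map_mul, map_mul, ← hφ c, ← hφ c']
    ring
  · intro c
    change g (algebraMap K A c) * Ring.inverse (g (1 : A)) = _
    rw [map_one, Ring.inverse_one, mul_one, AlgHom.commutes]

end HomogeneousLocalization

/-- It is applied with `a` the map to the ordinary localization and `b` the dehomogenization with
respect to `X s₀`. -/
theorem algHom_apply_of_isHomogeneous {σ K B : Type*} [Field K] [CommRing B] [Algebra K B]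
    (a b : MvPolynomial σ K →ₐ[K] B) {s₀ : σ} (h : ∀ s, b (X s) * a (X s₀) = a (X s)) {d : ℕ}
    {F : MvPolynomial σ K} (hF : F.IsHomogeneous d) : a F = b F * a (X s₀) ^ d := by
  have h2 := aeval_mul_of_isHomogeneous hF (a (X s₀)) (fun s => b (X s))
  have h3 : (fun s => a (X s₀) * b (X s)) = fun s => a (X s) :=
    funext fun s => by rw [mul_comm, h]
  have h4 : (aeval fun s => a (X s)) = a := by
    ext s; simp
  have h5 : (aeval fun s => b (X s)) = b := by
    ext s; simp
  rw [h3, h4, h5] at h2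
  rw [h2, mul_comm]

/-! ### The local ring of a closed subscheme of projective space at a rational point -/

section LocalRing

open HomogeneousLocalization

universe v

variable {σ : Type} {K : Type v} [Field K] (J : HomogeneousIdeal (homogeneousSubmodule σ K))
  (p : Ideal (MvPolynomial σ K ⧸ J.toIdeal)) [p.IsPrime]

/-- The local ring of `Proj (K[X] ⧸ J)` at a homogeneous prime. -/
abbrev ProjLocalRing : Type v :=
  HomogeneousLocalization.AtPrime (quotientGrading (homogeneousSubmodule σ K) J) p

variable {p}

/-- The fraction of two forms of the same degree. -/
noncomputable def ProjLocalRing.frac {d : ℕ} {F G : MvPolynomial σ K} (hF : F.IsHomogeneous d)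
    (hG : G.IsHomogeneous d) (hGp : Ideal.Quotient.mk J.toIdeal G ∉ p) : ProjLocalRing J p :=
  HomogeneousLocalization.mk ⟨d, ⟨_, quotientGrading_mk_mem _ J hF⟩,
    ⟨_, quotientGrading_mk_mem _ J hG⟩, hGp⟩

theorem ProjLocalRing.exists_eq_frac (a : ProjLocalRing J p) :
    ∃ (d : ℕ) (F G : MvPolynomial σ K) (hF : F.IsHomogeneous d) (hG : G.IsHomogeneous d)
      (hGp : Ideal.Quotient.mk J.toIdeal G ∉ p), a = ProjLocalRing.frac J hF hG hGp := by
  obtain ⟨⟨d, ⟨_, F, hF, rfl⟩, ⟨_, G, hG, rfl⟩, h⟩, rfl⟩ := mk_surjective a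
  exact ⟨d, F, G, hF, hG, h, rfl⟩

theorem ProjLocalRing.frac_eq_zero_iff {d : ℕ} {F G : MvPolynomial σ K} (hF : F.IsHomogeneous d)
    (hG : G.IsHomogeneous d) (hGp : Ideal.Quotient.mk J.toIdeal G ∉ p) :
    ProjLocalRing.frac J hF hG hGp = 0 ↔ ∃ (n : ℕ) (B : MvPolynomial σ K), B.IsHomogeneous n ∧
      Ideal.Quotient.mk J.toIdeal B ∉ p ∧ B * F ∈ J.toIdeal := by
  rw [ProjLocalRing.frac, AtPrime.mk_eq_zero_iff]
  constructor
  · rintro ⟨n, _, ⟨B, hB, rfl⟩, hBp, hBF⟩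
    refine ⟨n, B, hB, hBp, ?_⟩
    rw [← Ideal.Quotient.eq_zero_iff_mem, map_mul]
    exact hBF
  · rintro ⟨n, B, hB, hBp, hBF⟩
    refine ⟨n, _, quotientGrading_mk_mem _ J hB, hBp, ?_⟩
    rw [← Ideal.Quotient.eq_zero_iff_mem, map_mul] at hBF
    exact hBF

variable (p) in
/-- Dehomogenization with respect to the variable `X s₀`, as a map to the local ring. -/
noncomputable def ProjLocalRing.ev (s₀ : σ) (h₀ : Ideal.Quotient.mk J.toIdeal (X s₀) ∉ p) :
    MvPolynomial σ K →ₐ[K] ProjLocalRing J p :=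
  aeval fun s => ProjLocalRing.frac J (isHomogeneous_X K s) (isHomogeneous_X K s₀) h₀

theorem ProjLocalRing.mk_pow_notMem {s₀ : σ} (h₀ : Ideal.Quotient.mk J.toIdeal (X s₀) ∉ p)
    (d : ℕ) : Ideal.Quotient.mk J.toIdeal (X s₀ ^ d) ∉ p := by
  rw [map_pow]
  exact fun h => h₀ (Ideal.IsPrime.mem_of_pow_mem ‹_› d h)

variable {s₀ : σ} (h₀ : Ideal.Quotient.mk J.toIdeal (X s₀) ∉ p)

theorem ProjLocalRing.ev_of_isHomogeneous {d : ℕ} {F : MvPolynomial σ K} (hF : F.IsHomogeneous d) :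
    ProjLocalRing.ev J p s₀ h₀ F =
      ProjLocalRing.frac J hF (isHomogeneous_X_pow s₀ d) (ProjLocalRing.mk_pow_notMem J h₀ d) := by
  apply val_injective
  let V : ProjLocalRing J p →ₐ[K] Localization p.primeCompl :=
    { algebraMap (ProjLocalRing J p) (Localization p.primeCompl) with
      commutes' := fun c => rfl }
  let a : MvPolynomial σ K →ₐ[K] Localization p.primeCompl :=
    (IsScalarTower.toAlgHom K (MvPolynomial σ K ⧸ J.toIdeal) (Localization p.primeCompl)).comp
      (Ideal.Quotient.mkₐ K J.toIdeal)
  have hVev : ∀ s, V (ProjLocalRing.ev J p s₀ h₀ (X s)) * a (X s₀) = a (X s) := by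
    intro s
    rw [ProjLocalRing.ev, aeval_X]
    change (Localization.mk _ _ : Localization p.primeCompl) *
      algebraMap _ _ (Ideal.Quotient.mk J.toIdeal (X s₀)) = algebraMap _ _ (Ideal.Quotient.mk J.toIdeal (X s))
    rw [Localization.mk_eq_mk']
    exact IsLocalization.mk'_spec _ _ _
  have h1 : a F = V (ProjLocalRing.ev J p s₀ h₀ F) * a (X s₀) ^ d := by
    have h : ∀ s, (V.comp (ProjLocalRing.ev J p s₀ h₀)) (X s) * a (X s₀) = a (X s) := hVev
    exact algHom_apply_of_isHomogeneous (K := K) (B := Localization p.primeCompl) (s₀ := s₀) a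
      (V.comp (ProjLocalRing.ev J p s₀ h₀)) h hF
  change V (ProjLocalRing.ev J p s₀ h₀ F) = Localization.mk (Ideal.Quotient.mk J.toIdeal F)
    ⟨Ideal.Quotient.mk J.toIdeal (X s₀ ^ d), _⟩
  rw [Localization.mk_eq_mk', eq_comm, IsLocalization.mk'_eq_iff_eq_mul]
  change a F = _ * a (X s₀ ^ d)
  rw [h1, map_pow]

theorem ProjLocalRing.frac_mul_ev {d : ℕ} {F G : MvPolynomial σ K} (hF : F.IsHomogeneous d)
    (hG : G.IsHomogeneous d) (hGp : Ideal.Quotient.mk J.toIdeal G ∉ p) :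
    ProjLocalRing.frac J hF hG hGp * ProjLocalRing.ev J p s₀ h₀ G = ProjLocalRing.ev J p s₀ h₀ F := by
  rw [ProjLocalRing.ev_of_isHomogeneous J h₀ hF, ProjLocalRing.ev_of_isHomogeneous J h₀ hG]
  apply val_injective
  simp only [ProjLocalRing.frac, val_mul, val_mk, Localization.mk_mul]
  rw [Localization.mk_eq_mk_iff, Localization.r_iff_exists]
  refine ⟨1, ?_⟩
  simp only [Submonoid.coe_one, one_mul, Submonoid.coe_mul]
  ring

theorem ProjLocalRing.isUnit_ev_of_isHomogeneous {d : ℕ} {G : MvPolynomial σ K}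
    (hG : G.IsHomogeneous d) (hGp : Ideal.Quotient.mk J.toIdeal G ∉ p) :
    IsUnit (ProjLocalRing.ev J p s₀ h₀ G) := by
  refine .of_mul_eq_one_right (ProjLocalRing.frac J (isHomogeneous_X_pow s₀ d) hG hGp) ?_
  rw [ProjLocalRing.frac_mul_ev J h₀, map_pow]
  have : ProjLocalRing.ev J p s₀ h₀ (X s₀) = 1 := by
    rw [ProjLocalRing.ev, aeval_X, ProjLocalRing.frac]
    exact Quotient.sound' (by simp [NumDenSameDeg.embedding])
  rw [this, one_pow]

end LocalRing

/-! ### The local ring at a rational point with normalized homogeneous coordinates -/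

section RationalPoint

open HomogeneousLocalization IsLocalRing

universe v

variable {σ : Type} {K : Type v} [Field K] (J : HomogeneousIdeal (homogeneousSubmodule σ K))
  {p : Ideal (MvPolynomial σ K ⧸ J.toIdeal)} [p.IsPrime] {f : σ → K}
  (hp : ∀ (d : ℕ) (F : MvPolynomial σ K), F.IsHomogeneous d →
    (Ideal.Quotient.mk J.toIdeal F ∈ p ↔ eval f F = 0))
  {s₀ : σ} (h₀ : Ideal.Quotient.mk J.toIdeal (X s₀) ∉ p) (hf : f s₀ = 1)

theorem ProjLocalRing.frac_mul_frac {d : ℕ} {F G : MvPolynomial σ K} (hF : F.IsHomogeneous d)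
    (hG : G.IsHomogeneous d) (hGp : Ideal.Quotient.mk J.toIdeal G ∉ p)
    (hFp : Ideal.Quotient.mk J.toIdeal F ∉ p) :
    ProjLocalRing.frac J hF hG hGp * ProjLocalRing.frac J hG hF hFp = 1 := by
  apply val_injective
  simp only [ProjLocalRing.frac, val_mul, val_mk, Localization.mk_mul, val_one]
  rw [← Localization.mk_one, Localization.mk_eq_mk_iff, Localization.r_iff_exists]
  refine ⟨1, ?_⟩
  simp only [Submonoid.coe_one, one_mul, Submonoid.coe_mul, mul_one]
  ring

include hp in
theorem ProjLocalRing.isUnit_frac_iff {d : ℕ} {F G : MvPolynomial σ K} (hF : F.IsHomogeneous d)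
    (hG : G.IsHomogeneous d) (hGp : Ideal.Quotient.mk J.toIdeal G ∉ p) :
    IsUnit (ProjLocalRing.frac J hF hG hGp) ↔ eval f F ≠ 0 := by
  rw [ne_eq, ← hp d F hF]
  constructor
  · intro h hFp
    obtain ⟨d', F', G', hF', hG', hG'p, h1⟩ := ProjLocalRing.exists_eq_frac J (h.unit⁻¹ : (ProjLocalRing J p)ˣ).1
    have h2 : ProjLocalRing.frac J hF hG hGp * ProjLocalRing.frac J hF' hG' hG'p = 1 := by
      rw [← h1]; exact h.mul_val_inv
    have h3 := congrArg HomogeneousLocalization.val h2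
    simp only [ProjLocalRing.frac, val_mul, val_mk, Localization.mk_mul, val_one] at h3
    rw [← Localization.mk_one, Localization.mk_eq_mk_iff, Localization.r_iff_exists] at h3
    obtain ⟨c, hc⟩ := h3
    simp only [Submonoid.coe_one, one_mul, Submonoid.coe_mul, mul_one] at hc
    have h4 : (c : MvPolynomial σ K ⧸ J.toIdeal) * (Ideal.Quotient.mk J.toIdeal G *
        Ideal.Quotient.mk J.toIdeal G') ∈ p := by
      rw [← hc]
      exact Ideal.mul_mem_left _ _ (Ideal.mul_mem_right _ _ hFp)
    rcases Ideal.IsPrime.mem_or_mem ‹_› h4 with h5 | h5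
    · exact c.2 h5
    · rcases Ideal.IsPrime.mem_or_mem ‹_› h5 with h6 | h6
      exacts [hGp h6, hG'p h6]
  · intro h
    exact .of_mul_eq_one _ (ProjLocalRing.frac_mul_frac J hF hG hGp h)

/-- The images of `X s - f s` in the local ring at the point `f`. -/
noncomputable def ProjLocalRing.param (f : σ → K) {s₀ : σ}
    (h₀ : Ideal.Quotient.mk J.toIdeal (X s₀) ∉ p) (s : σ) : ProjLocalRing J p :=
  ProjLocalRing.ev J p s₀ h₀ (X s) - algebraMap K _ (f s)

/-- Modulo the differences `e (X s) - f s` the map `e` agrees with evaluation at `f` on the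
variables, hence everywhere. -/
theorem aeval_sub_eval_mem_span {σ K B : Type*} [Field K] [CommRing B] [Algebra K B]
    (e : MvPolynomial σ K →ₐ[K] B) (f : σ → K) (F : MvPolynomial σ K) :
    e F - algebraMap K B (eval f F) ∈
      Ideal.span (Set.range fun s => e (X s) - algebraMap K B (f s)) := by
  rw [← Ideal.Quotient.eq]
  set I := Ideal.span (Set.range fun s => e (X s) - algebraMap K B (f s))
  have h : (Ideal.Quotient.mkₐ K I).comp e =
      (IsScalarTower.toAlgHom K B (B ⧸ I)).comp ((Algebra.ofId K B).comp (aeval f)) := by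
    ext s
    simp only [AlgHom.comp_apply, aeval_X]
    exact Ideal.Quotient.eq.mpr (Ideal.subset_span ⟨s, rfl⟩)
  have h1 := DFunLike.congr_fun h F
  simp only [AlgHom.comp_apply] at h1
  exact h1

-- The normalization `f s₀ = 1` makes `X s - f s` the dehomogenization of the linear form `X s - f s
-- * X s₀`, which vanishes at `f`. Conversely, up to a unit, an element of the maximal ideal is the
-- dehomogenization of a form vanishing at `f`.
include hp hf in
theorem ProjLocalRing.span_param :
    Ideal.span (Set.range (ProjLocalRing.param J f h₀)) = maximalIdeal (ProjLocalRing J p) := by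
  refine le_antisymm (Ideal.span_le.mpr ?_) fun a ha => ?_
  · rintro _ ⟨s, rfl⟩
    have h1 : ProjLocalRing.param J f h₀ s = ProjLocalRing.ev J p s₀ h₀ (X s - C (f s) * X s₀) := by
      have h2 : ProjLocalRing.ev J p s₀ h₀ (X s₀) = 1 := by
        rw [ProjLocalRing.ev, aeval_X]
        exact Quotient.sound' (by simp [NumDenSameDeg.embedding])
      rw [map_sub, map_mul, h2, mul_one, ← algebraMap_eq, AlgHom.commutes]
      rfl
    have h2 : (X s - C (f s) * X s₀ : MvPolynomial σ K).IsHomogeneous 1 :=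
      (isHomogeneous_X _ _).sub ((isHomogeneous_X _ _).C_mul _)
    rw [SetLike.mem_coe, mem_maximalIdeal, mem_nonunits_iff, h1, ev_of_isHomogeneous J h₀ h2,
      isUnit_frac_iff J hp]
    simp [hf]
  · obtain ⟨d, F, G, hF, hG, hGp, rfl⟩ := ProjLocalRing.exists_eq_frac J a
    rw [mem_maximalIdeal, mem_nonunits_iff, isUnit_frac_iff J hp, not_not] at ha
    have h1 := aeval_sub_eval_mem_span (ProjLocalRing.ev J p s₀ h₀) f F
    rw [ha, map_zero, sub_zero, ← frac_mul_ev J h₀ hF hG hGp] at h1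
    exact (Ideal.mul_unit_mem_iff_mem _ (isUnit_ev_of_isHomogeneous J h₀ hG hGp)).mp h1

include hp h₀ hf in
theorem ProjLocalRing.exists_residue (a : ProjLocalRing J p) :
    ∃ c : K, a - algebraMap K _ c ∈ maximalIdeal (ProjLocalRing J p) := by
  obtain ⟨d, F, G, hF, hG, hGp, rfl⟩ := ProjLocalRing.exists_eq_frac J a
  have hG0 : eval f G ≠ 0 := fun h => hGp ((hp d G hG).mpr h)
  refine ⟨eval f F / eval f G, ?_⟩
  rw [← span_param J hp h₀ hf]
  have h1 := aeval_sub_eval_mem_span (ProjLocalRing.ev J p s₀ h₀) f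
    (F - C (eval f F / eval f G) * G)
  have h2 : eval f (F - C (eval f F / eval f G) * G) = 0 := by
    rw [map_sub, map_mul, eval_C, div_mul_cancel₀ _ hG0, sub_self]
  rw [h2, map_zero, sub_zero, map_sub, map_mul, ← algebraMap_eq, AlgHom.commutes,
    ← frac_mul_ev J h₀ hF hG hGp, ← sub_mul] at h1
  exact (Ideal.mul_unit_mem_iff_mem _ (isUnit_ev_of_isHomogeneous J h₀ hG hGp)).mp h1

-- Every fraction is, up to a unit, in the image of `ev`, so every ideal is the extension of its
-- contraction to a polynomial ring in finitely many variables.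
include h₀ in
theorem ProjLocalRing.isNoetherianRing [Finite σ] : IsNoetherianRing (ProjLocalRing J p) := by
  refine ⟨fun I => ?_⟩
  let e : MvPolynomial σ K →+* ProjLocalRing J p := ProjLocalRing.ev J p s₀ h₀
  have h : I = Ideal.map e (Ideal.comap e I) := by
    refine le_antisymm (fun a ha => ?_) Ideal.map_comap_le
    obtain ⟨d, F, G, hF, hG, hGp, rfl⟩ := ProjLocalRing.exists_eq_frac J a
    refine (Ideal.mul_unit_mem_iff_mem _ (isUnit_ev_of_isHomogeneous J h₀ hG hGp)).mp ?_
    rw [frac_mul_ev J h₀ hF hG hGp]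
    refine Ideal.mem_map_of_mem e ?_
    change ProjLocalRing.ev J p s₀ h₀ F ∈ I
    rw [← frac_mul_ev J h₀ hF hG hGp]
    exact Ideal.mul_mem_right _ _ ha
  rw [h]
  exact Ideal.FG.map (IsNoetherian.noetherian _) _

/-- Arcs in the cone over a closed subscheme of projective space define arcs in the scheme. -/
theorem ProjLocalRing.exists_arc
    (hp : ∀ (d : ℕ) (F : MvPolynomial σ K), F.IsHomogeneous d →
      (Ideal.Quotient.mk J.toIdeal F ∈ p ↔ eval f F = 0))
    {c : σ → PowerSeries K} (hc : ∀ s, PowerSeries.constantCoeff (c s) = f s)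
    (hJ : ∀ F ∈ J.toIdeal, aeval c F = 0) :
    ∃ θ : ProjLocalRing J p →ₐ[K] PowerSeries K,
      ∀ (d : ℕ) (F G : MvPolynomial σ K) (hF : F.IsHomogeneous d) (hG : G.IsHomogeneous d)
        (hGp : Ideal.Quotient.mk J.toIdeal G ∉ p),
        θ (ProjLocalRing.frac J hF hG hGp) * aeval c G = aeval c F := by
  have hcc : ∀ F, PowerSeries.constantCoeff (aeval c F) = eval f F := by
    intro F
    have h4 := MvPolynomial.eval₂_comp_left (PowerSeries.constantCoeff (R := K))
      (algebraMap K (PowerSeries K)) c F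
    rw [aeval_def, h4, eval, coe_eval₂Hom]
    congr 1
    exact funext hc
  obtain ⟨θ, hθ⟩ := AtPrime.exists_lift (𝒜 := quotientGrading (homogeneousSubmodule σ K) J) p
    (Ideal.Quotient.liftₐ J.toIdeal (aeval c) hJ) (by
      rintro d _ ⟨F, hF, rfl⟩ hFp
      change IsUnit (aeval c F)
      rw [PowerSeries.isUnit_iff_constantCoeff, hcc]
      exact IsUnit.mk0 _ fun h => hFp ((hp d F hF).mpr h))
  exact ⟨θ, fun d F G hF hG hGp => hθ _⟩

include hp h₀ hf in
/-- If the tangent vectors at a rational point of a closed subscheme of projective space extend to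
arcs, then the local ring is regular, and forms that vanish on the arcs vanish near the point. -/
theorem ProjLocalRing.isRegularLocalRing_of_arcs [Finite σ] [Infinite K]
    (𝒞 : Set (σ → PowerSeries K)) (hc : ∀ c ∈ 𝒞, ∀ s, PowerSeries.constantCoeff (c s) = f s)
    (hJ : ∀ c ∈ 𝒞, ∀ F ∈ J.toIdeal, aeval c F = 0)
    (htan : ∀ τ : σ → K, (∀ d, ∀ F ∈ J.toIdeal, F.IsHomogeneous d →
      aeval (fun s => (TrivSqZeroExt.inl (f s) + TrivSqZeroExt.inr (τ s) : DualNumber K)) F = 0) →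
      ∃ c ∈ 𝒞, ∀ s, PowerSeries.coeff 1 (c s) = τ s) :
    IsRegularLocalRing (ProjLocalRing J p) ∧
      ∀ (d : ℕ) (F : MvPolynomial σ K), F.IsHomogeneous d → (∀ c ∈ 𝒞, aeval c F = 0) →
        ∃ (n : ℕ) (B : MvPolynomial σ K), B.IsHomogeneous n ∧ eval f B ≠ 0 ∧
          B * F ∈ J.toIdeal := by
  have hN := ProjLocalRing.isNoetherianRing J h₀
  have hres := ProjLocalRing.exists_residue J hp h₀ hf
  have hpar := ProjLocalRing.span_param J hp h₀ hf
  have hev : ∀ s, ProjLocalRing.ev J p s₀ h₀ (X s) = ProjLocalRing.param J f h₀ s + algebraMap K _ (f s) :=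
    fun s => (sub_add_cancel _ _).symm
  have hev0 : ProjLocalRing.ev J p s₀ h₀ (X s₀) = 1 := by
    rw [ProjLocalRing.ev, aeval_X]
    exact Quotient.sound' (by simp [NumDenSameDeg.embedding])
  obtain ⟨h1, -, h2⟩ := _root_.isRegularLocalRing_of_arcs hres hpar
    (Θ := {θ | ∃ c ∈ 𝒞, ∀ (d : ℕ) (F G : MvPolynomial σ K) (hF : F.IsHomogeneous d)
      (hG : G.IsHomogeneous d) (hGp : Ideal.Quotient.mk J.toIdeal G ∉ p),
        θ (ProjLocalRing.frac J hF hG hGp) * aeval c G = aeval c F}) (by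
    intro δ
    have hfst : ∀ s, (δ (ProjLocalRing.param J f h₀ s)).fst = 0 := by
      intro s
      by_contra hne
      set a := ProjLocalRing.param J f h₀ s with ha
      have ham : a ∈ maximalIdeal (ProjLocalRing J p) := by
        rw [← hpar]; exact Ideal.subset_span ⟨s, rfl⟩
      have hu : IsUnit (a - algebraMap K _ ((δ a).fst)) := by
        by_contra h3
        have h4 := sub_mem ham ((mem_maximalIdeal _).mpr h3)
        rw [sub_sub_cancel] at h4
        exact (mem_maximalIdeal _).mp h4 ((IsUnit.mk0 _ hne).map _)
      have h5 := (hu.map δ).map (TrivSqZeroExt.fstHom K K K)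
      rw [map_sub, map_sub, AlgHom.commutes, AlgHom.commutes] at h5
      simp at h5
    set τ : σ → K := fun s => (δ (ProjLocalRing.param J f h₀ s)).snd with hτ
    have hδ : ∀ s, δ (ProjLocalRing.ev J p s₀ h₀ (X s)) =
        TrivSqZeroExt.inl (f s) + TrivSqZeroExt.inr (τ s) := by
      intro s
      rw [hev, map_add, AlgHom.commutes, TrivSqZeroExt.algebraMap_eq_inl]
      ext
      · simp [hfst]
      · simp [hτ]
    have hδF : ∀ F, aeval (fun s => (TrivSqZeroExt.inl (f s) + TrivSqZeroExt.inr (τ s) :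
        DualNumber K)) F = δ (ProjLocalRing.ev J p s₀ h₀ F) := by
      intro F
      have : aeval (fun s => (TrivSqZeroExt.inl (f s) + TrivSqZeroExt.inr (τ s) :
        DualNumber K)) = δ.comp (ProjLocalRing.ev J p s₀ h₀) := by
        ext s : 1
        simp only [aeval_X, AlgHom.comp_apply]
        exact (hδ s).symm
      rw [this]; rfl
    obtain ⟨c, hcC, hcτ⟩ := htan τ fun d F hFJ hF => by
      rw [hδF, ev_of_isHomogeneous J h₀ hF, (ProjLocalRing.frac_eq_zero_iff J _ _ _).mpr, map_zero]
      exact ⟨0, 1, isHomogeneous_one _ _, fun h => (‹p.IsPrime›.ne_top)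
        ((Ideal.eq_top_iff_one p).mpr h), by rwa [one_mul]⟩
    obtain ⟨θ, hθ⟩ := ProjLocalRing.exists_arc J hp (hc c hcC) (hJ c hcC)
    refine ⟨θ, ⟨c, hcC, hθ⟩, fun s => ?_⟩
    have h3 := hθ 1 _ _ (isHomogeneous_X K s) (isHomogeneous_X K s₀) h₀
    have h4 : ProjLocalRing.frac J (isHomogeneous_X K s) (isHomogeneous_X K s₀) h₀ =
        ProjLocalRing.ev J p s₀ h₀ (X s) := by rw [ProjLocalRing.ev, aeval_X]
    rw [h4, hev, map_add, AlgHom.commutes, aeval_X, aeval_X] at h3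
    have hm : PowerSeries.constantCoeff (θ (ProjLocalRing.param J f h₀ s)) = 0 :=
      constantCoeff_eq_zero_of_mem_maximalIdeal θ (hpar ▸ Ideal.subset_span ⟨s, rfl⟩)
    have h5 := congrArg (PowerSeries.coeff 1) h3
    rw [add_mul, map_add, mul_comm (θ _), coeff_one_mul_of_constantCoeff_eq_zero _ _ hm, hc c hcC,
      hf, one_mul, PowerSeries.algebraMap_apply, PowerSeries.coeff_C_mul, hcτ, hcτ] at h5
    -- An arc in the cone gives the arc `c s / c s₀` in the affine chart. Its velocity is `τ s - f s
    -- * τ s₀`, which is `τ s` because the coordinate `s₀` is constantly `1` in the chart.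
    have hτ0 : τ s₀ = 0 := by
      have h6 : ProjLocalRing.param J f h₀ s₀ = 0 := by
        rw [ProjLocalRing.param, hev0, hf, map_one, sub_self]
      rw [hτ]
      simp only [h6, map_zero, TrivSqZeroExt.snd_zero]
    rw [hτ0, mul_zero, add_zero] at h5
    exact h5)
  refine ⟨h2, fun d F hF hFc => ?_⟩
  have h3 := h1 (ProjLocalRing.frac J hF (isHomogeneous_X_pow s₀ d)
    (ProjLocalRing.mk_pow_notMem J h₀ d)) (by
    rintro θ ⟨c, hcC, hθ⟩
    have h4 := hθ d F (X s₀ ^ d) hF (isHomogeneous_X_pow s₀ d) (ProjLocalRing.mk_pow_notMem J h₀ d)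
    rw [hFc c hcC] at h4
    have h5 : IsUnit (aeval c (X s₀ ^ d : MvPolynomial σ K)) := by
      rw [PowerSeries.isUnit_iff_constantCoeff, map_pow, map_pow, aeval_X, hc c hcC, hf, one_pow]
      exact isUnit_one
    exact (h5.mul_left_eq_zero).mp h4)
  rw [ProjLocalRing.frac_eq_zero_iff] at h3
  obtain ⟨n, B, hB, hBp, hBF⟩ := h3
  exact ⟨n, B, hB, fun h => hBp ((hp n B hB).mpr h), hBF⟩

end RationalPoint

/-! ### Products with one factor omitted -/

section CoProd

/-- The product of all coordinates but one. -/
def coProd {ι R : Type*} [Fintype ι] [DecidableEq ι] [CommRing R] (t : ι → R) (l : ι) : R :=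
  ∏ j ∈ Finset.univ.erase l, t j

variable {ι R : Type*} [Fintype ι] [DecidableEq ι] [CommRing R]

theorem mul_coProd (t : ι → R) (l : ι) : t l * coProd t l = ∏ j, t j :=
  Finset.mul_prod_erase _ _ (Finset.mem_univ l)

theorem map_coProd {S : Type*} [CommRing S] (φ : R →+* S) (t : ι → R) (l : ι) :
    φ (coProd t l) = coProd (fun j => φ (t j)) l :=
  map_prod φ _ _

theorem coProd_update_self (t : ι → R) (i : ι) (c : R) :
    coProd (Function.update t i c) i = coProd t i :=
  Finset.prod_congr rfl fun j hj => by
    rw [Function.update_of_ne (Finset.ne_of_mem_erase hj)]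

theorem coProd_eq_zero {t : ι → R} {i l : ι} (h : l ≠ i) (ht : t i = 0) : coProd t l = 0 :=
  Finset.prod_eq_zero (Finset.mem_erase.mpr ⟨h.symm, Finset.mem_univ i⟩) ht

theorem sum_coProd {t : ι → R} {i : ι} (ht : t i = 0) (c : ι → R) :
    ∑ l, coProd t l * c l = coProd t i * c i :=
  Finset.sum_eq_single i (fun l _ hl => by rw [coProd_eq_zero hl ht, zero_mul])
    fun h => absurd (Finset.mem_univ i) h

theorem sum_coProd' {t : ι → R} {i : ι} (ht : t i = 0) : ∑ l, coProd t l = coProd t i := by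
  simpa using sum_coProd ht (fun _ => 1)

theorem coProd_X_ne_zero {K : Type*} [Field K] (l : ι) :
    coProd (X : ι → MvPolynomial ι K) l ≠ 0 :=
  Finset.prod_ne_zero_iff.mpr fun j _ => X_ne_zero j

theorem eval_coProd_X {K : Type*} [Field K] (t : ι → K) (l : ι) :
    eval t (coProd X l) = coProd t l := by
  rw [map_coProd]; simp

end CoProd

/-! ### Polynomial identities compared on the hyperplanes `t i = 0` -/

section PointwiseIdentities

variable {ι K : Type*} [Field K]

/-- This allows cancelling a nonzero polynomial factor from an identity known at all points,
including points where the factor vanishes. -/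
theorem eval_eq_zero_of_mul [Infinite K] {F G : MvPolynomial ι K} (hF : F ≠ 0)
    (h : ∀ t, eval t F * eval t G = 0) (t : ι → K) : eval t G = 0 := by
  have h1 : F * G = 0 := MvPolynomial.funext fun t => by rw [map_mul, h, map_zero]
  rw [(mul_eq_zero.mp h1).resolve_left hF, map_zero]

variable [Fintype ι] [DecidableEq ι]

theorem eq_zero_of_linear {n : ι → K} (h : ∀ t : ι → K, ∑ j, n j * t j = 0) (j : ι) : n j = 0 := by
  simpa [Pi.single_apply] using h (Pi.single j 1)

theorem eq_zero_of_quadratic [CharZero K] {q : ι → ι → K} (hq : ∀ i j, q i j = q j i)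
    (h : ∀ t : ι → K, ∑ i, ∑ j, q i j * t i * t j = 0) (i j : ι) : q i j = 0 := by
  have hd : ∀ i, q i i = 0 := fun i => by simpa [Pi.single_apply] using h (Pi.single i 1)
  have h1 := h (Pi.single i 1 + Pi.single j 1)
  simp only [Pi.add_apply, Pi.single_apply, mul_add, mul_ite, mul_one, mul_zero,
    Finset.sum_add_distrib, Finset.sum_ite_eq', Finset.mem_univ, if_true] at h1
  rw [hd, hd, hq j i] at h1
  have : (2 : K) * q i j = 0 := by linear_combination h1
  simpa using this

variable [CharZero K]

/-- The factor `coProd t i` does not involve `t i`. So on the hyperplane `t i = 0` it remains a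
nonzero polynomial in the other variables and can be cancelled. -/
theorem eq_zero_of_linear_of_ne {i : ι} {n : ι → K} {e : ℕ}
    (h : ∀ t : ι → K, t i = 0 → coProd t i ^ e * ∑ j, n j * t j = 0) {j : ι} (hj : j ≠ i) :
    n j = 0 := by
  have h1 := eval_eq_zero_of_mul (K := K) (F := coProd X i ^ e)
    (G := ∑ j, C (if j = i then 0 else n j) * X j) (pow_ne_zero _ (coProd_X_ne_zero i)) fun t => by
      have h2 := h (Function.update t i 0) (by simp)
      rw [coProd_update_self] at h2
      rw [map_pow, eval_coProd_X, map_sum]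
      refine Eq.trans ?_ h2
      congr 1
      refine Finset.sum_congr rfl fun j _ => ?_
      by_cases hj : j = i
      · simp [hj]
      · simp [hj]
  have h3 := eq_zero_of_linear (n := fun j => if j = i then 0 else n j)
    (fun t => by simpa using h1 t) j
  simpa [hj] using h3

theorem eq_zero_of_quadratic_of_ne {i : ι} {q : ι → ι → K} (hq : ∀ i j, q i j = q j i) {e : ℕ}
    (h : ∀ t : ι → K, t i = 0 → coProd t i ^ e * ∑ j, ∑ l, q j l * t j * t l = 0)
    {j l : ι} (hj : j ≠ i) (hl : l ≠ i) : q j l = 0 := by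
  let q' : ι → ι → K := fun j l => if j = i ∨ l = i then 0 else q j l
  have h1 := eval_eq_zero_of_mul (K := K) (F := coProd X i ^ e)
    (G := ∑ j, ∑ l, C (q' j l) * X j * X l) (pow_ne_zero _ (coProd_X_ne_zero i)) fun t => by
      have h2 := h (Function.update t i 0) (by simp)
      rw [coProd_update_self] at h2
      rw [map_pow, eval_coProd_X, map_sum, ← h2]
      congr 1
      refine Finset.sum_congr rfl fun j _ => ?_
      rw [map_sum]
      refine Finset.sum_congr rfl fun l _ => ?_
      by_cases hj : j = i
      · simp [q', hj]
      · by_cases hl : l = i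
        · simp [q', hl]
        · simp [q', hj, hl]
  have h3 := eq_zero_of_quadratic (q := q') (fun a b => by simp only [q', or_comm, hq a b])
    (fun t => by simpa using h1 t) j l
  simpa [q', hj, hl] using h3

/-- A quadratic form that vanishes on the hypersurface parametrized by
`t ↦ (E t, - ∏ t)`, `E = ∑ l, ∏_{j ≠ l} t j`, and does not involve products of two of the first
variables is zero. -/
theorem eq_zero_of_vanishing_on_reciprocal [Nontrivial ι] {β : ι → K} {γ : K}
    (h : ∀ t : ι → K, γ * (∏ j, t j) ^ 2 -
      2 * (∑ l, coProd t l) * (∏ j, t j) * ∑ i, β i * t i = 0) :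
    (∀ i, β i = 0) ∧ γ = 0 := by
  have hprod : (∏ j, X j : MvPolynomial ι K) ≠ 0 := Finset.prod_ne_zero_iff.mpr fun j _ => X_ne_zero j
  have h1 : ∀ t : ι → K, γ * (∏ j, t j) - 2 * (∑ l, coProd t l) * ∑ i, β i * t i = 0 := by
    intro t
    have h2 := eval_eq_zero_of_mul (K := K) (F := ∏ j, X j)
      (G := C γ * (∏ j, X j) - 2 * (∑ l, coProd X l) * ∑ i, C (β i) * X i) hprod (fun t => by
        have h3 := h t
        simp only [map_sub, map_mul, map_sum, map_prod, eval_X, eval_C, eval_coProd_X, map_ofNat]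
        linear_combination h3) t
    simpa only [map_sub, map_mul, map_sum, map_prod, eval_X, eval_C, eval_coProd_X, map_ofNat] using h2
  have hβ : ∀ j, β j = 0 := by
    intro j
    obtain ⟨i, hi⟩ := exists_ne j
    refine eq_zero_of_linear_of_ne (i := i) (e := 1) (fun t ht => ?_) hi.symm
    have h2 := h1 t
    rw [Finset.prod_eq_zero (Finset.mem_univ i) ht, sum_coProd' ht] at h2
    have h3 : (2 : K) * (coProd t i * ∑ j, β j * t j) = 0 := by linear_combination -h2
    simpa using h3
  refine ⟨hβ, ?_⟩
  have h2 := h1 1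
  simpa [hβ] using h2

/-- Here `α`, `β`, `γ` are the coefficients of the `x x`-derivatives of a tangent vector, and the
conclusion says that they are those of `∑ M_l(x) ∂f/∂y_l` with `M_l = (ℓ_l, m_l)`. Restricting to `t
l = 0` determines the three families in turn, after each previous one has been substituted and a
factor `∏ t` cancelled. -/
theorem exists_of_vanishing_on_reciprocal [Nontrivial ι] {α : ι → ι → ι → K} {β : ι → ι → K}
    {γ : ι → K} (hα : ∀ l i j, α l i j = α l j i)
    (h : ∀ t : ι → K, ∑ l, coProd t l * ((∑ l, coProd t l) ^ 2 * (∑ i, ∑ j, α l i j * t i * t j) -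
      2 * (∑ l, coProd t l) * (∏ j, t j) * (∑ i, β l i * t i) + γ l * (∏ j, t j) ^ 2) = 0) :
    ∃ (ℓ : ι → ι → K) (m : ι → K),
      (∀ l i j, α l i j = (if i = l then 2 * ℓ l j else 0) + (if j = l then 2 * ℓ l i else 0)) ∧
      (∀ l i, β l i = 2 * ∑ l', ℓ l' i + if i = l then 2 * m l else 0) ∧
      ∀ l, γ l = 4 * ∑ l', m l' := by
  have hprod : (∏ j, X j : MvPolynomial ι K) ≠ 0 := Finset.prod_ne_zero_iff.mpr fun j _ => X_ne_zero j
  have hα0 : ∀ l i j, i ≠ l → j ≠ l → α l i j = 0 := by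
    intro l i j hi hj
    refine eq_zero_of_quadratic_of_ne (i := l) (e := 3) (hα l) (fun t ht => ?_) hi hj
    have h2 := h t
    rw [sum_coProd ht, sum_coProd' ht, Finset.prod_eq_zero (Finset.mem_univ l) ht] at h2
    linear_combination h2
  -- The diagonal entry is halved once more because for `i = j = l` both summands of the formula
  -- contribute.
  let ℓ : ι → ι → K := fun l j => if j = l then α l l l / 4 else α l l j / 2
  have hℓ : ∀ l i j, α l i j =
      (if i = l then 2 * ℓ l j else 0) + (if j = l then 2 * ℓ l i else 0) := by
    intro l i j
    by_cases hi : i = l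
    · subst hi
      by_cases hj : j = i
      · subst hj
        simp only [ℓ, if_true]; ring
      · simp only [ℓ, if_true, if_neg hj]; ring
    · by_cases hj : j = l
      · subst hj
        simp only [ℓ, if_true, if_neg hi]
        rw [hα j i j]; ring
      · rw [if_neg hi, if_neg hj, hα0 l i j hi hj, add_zero]
  have hQ : ∀ l (t : ι → K), ∑ i, ∑ j, α l i j * t i * t j = 4 * t l * ∑ j, ℓ l j * t j := by
    intro l t
    simp only [hℓ, add_mul, ite_mul, zero_mul, Finset.sum_add_distrib, Finset.sum_ite_eq',
      Finset.sum_ite_irrel, Finset.sum_const_zero, Finset.mem_univ, if_true, Finset.mul_sum]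
    rw [← Finset.sum_add_distrib]
    exact Finset.sum_congr rfl fun j _ => by ring
  -- Each quadratic form is now `4 t_l ℓ_l(t)`, and `coProd t l * t l = ∏ t`, so the whole identity
  -- is divisible by `∏ t`.
  have h1 : ∀ t : ι → K, 4 * (∑ l, coProd t l) ^ 2 * (∑ l, ∑ j, ℓ l j * t j) -
      2 * (∑ l, coProd t l) * (∑ l, coProd t l * ∑ i, β l i * t i) +
      (∏ j, t j) * (∑ l, coProd t l * γ l) = 0 := by
    intro t
    have h2 := eval_eq_zero_of_mul (K := K) (F := ∏ j, X j)
      (G := 4 * (∑ l, coProd X l) ^ 2 * (∑ l, ∑ j, C (ℓ l j) * X j) -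
        2 * (∑ l, coProd X l) * (∑ l, coProd X l * ∑ i, C (β l i) * X i) +
        (∏ j, X j) * (∑ l, coProd X l * C (γ l))) hprod (fun t => by
        have h3 := h t
        simp only [map_sub, map_add, map_mul, map_sum, map_prod, map_pow, eval_X, eval_C,
          eval_coProd_X, map_ofNat]
        rw [← h3]
        have h4 : ∀ l, coProd t l * ((∑ l, coProd t l) ^ 2 * (∑ i, ∑ j, α l i j * t i * t j) -
            2 * (∑ l, coProd t l) * (∏ j, t j) * (∑ i, β l i * t i) + γ l * (∏ j, t j) ^ 2) =
            (∏ j, t j) * (4 * (∑ l, coProd t l) ^ 2 * (∑ j, ℓ l j * t j)) -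
            (∏ j, t j) * (2 * (∑ l, coProd t l) * (coProd t l * ∑ i, β l i * t i)) +
            (∏ j, t j) * ((∏ j, t j) * (coProd t l * γ l)) := by
          intro l
          rw [hQ, ← mul_coProd t l]
          ring
        simp only [h4]
        rw [Finset.sum_add_distrib, Finset.sum_sub_distrib]
        simp only [← Finset.mul_sum]
        ring) t
    simpa only [map_sub, map_add, map_mul, map_sum, map_prod, map_pow, eval_X, eval_C,
          eval_coProd_X, map_ofNat] using h2
  have hβ : ∀ i j, j ≠ i → β i j = 2 * ∑ l, ℓ l j := by
    intro i j hj
    have h2 := eq_zero_of_linear_of_ne (i := i) (e := 2)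
      (n := fun j => 4 * (∑ l, ℓ l j) - 2 * β i j) (fun t ht => by
        have h3 := h1 t
        rw [Finset.prod_eq_zero (Finset.mem_univ i) ht, sum_coProd' ht, sum_coProd ht,
          Finset.sum_comm] at h3
        simp only [sub_mul, Finset.sum_sub_distrib, mul_assoc, ← Finset.mul_sum, Finset.sum_mul]
        linear_combination h3) hj
    have h3 : (2 : K) ≠ 0 := two_ne_zero
    apply mul_left_cancel₀ h3
    linear_combination -h2
  let m : ι → K := fun l => (β l l - 2 * ∑ l', ℓ l' l) / 2
  have hβm : ∀ l i, β l i = 2 * ∑ l', ℓ l' i + if i = l then 2 * m l else 0 := by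
    intro l i
    by_cases hi : i = l
    · subst hi
      simp only [m, if_true]; ring
    · rw [if_neg hi, hβ l i hi, add_zero]
  refine ⟨ℓ, m, hℓ, hβm, ?_⟩
  have hβt : ∀ l (t : ι → K), ∑ i, β l i * t i = 2 * (∑ l, ∑ j, ℓ l j * t j) + 2 * m l * t l := by
    intro l t
    simp only [hβm, add_mul, ite_mul, zero_mul, Finset.sum_add_distrib, Finset.sum_ite_eq',
      Finset.mem_univ, if_true]
    rw [Finset.sum_comm (f := fun l j => ℓ l j * t j), Finset.mul_sum]
    simp only [mul_assoc, Finset.sum_mul]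
  -- With `β` substituted, the terms in `E²` cancel and another factor `∏ t` comes out.
  have h2 : ∀ t : ι → K, (∑ l, coProd t l * (γ l - 4 * ∑ l', m l')) = 0 := by
    intro t
    have h3 := eval_eq_zero_of_mul (K := K) (F := ∏ j, X j)
      (G := ∑ l, coProd X l * C (γ l - 4 * ∑ l', m l')) hprod (fun t => by
        have h4 := h1 t
        simp only [map_mul, map_sum, map_prod, eval_X, eval_C, eval_coProd_X]
        have h5 : ∑ l, coProd t l * ∑ i, β l i * t i =
            2 * (∑ l, coProd t l) * (∑ l, ∑ j, ℓ l j * t j) + 2 * (∏ j, t j) * ∑ l, m l := by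
          have h6 : ∀ l, coProd t l * ∑ i, β l i * t i =
              2 * (coProd t l * (∑ l, ∑ j, ℓ l j * t j)) + 2 * (∏ j, t j) * m l := by
            intro l
            rw [hβt, ← mul_coProd t l]
            ring
          simp only [h6]
          rw [Finset.sum_add_distrib, ← Finset.mul_sum, ← Finset.mul_sum, ← Finset.sum_mul]
          ring
        rw [h5] at h4
        rw [← h4]
        simp only [mul_sub, Finset.sum_sub_distrib]
        rw [← Finset.sum_mul]
        ring) t
    simpa only [map_mul, map_sum, map_prod, eval_X, eval_C, eval_coProd_X] using h3
  intro i
  -- At the point with all coordinates `1` except `t i = 0` only the `i`-th omitted product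
  -- survives, with value `1`.
  have h3 := h2 (Function.update 1 i 0)
  rw [sum_coProd (i := i) (by simp), coProd_update_self] at h3
  simp only [coProd, Pi.one_apply, Finset.prod_const_one, one_mul] at h3
  exact sub_eq_zero.mp h3

end PointwiseIdentities

/-! ### Determinants over the dual numbers -/

section DualNumberDeterminant

variable {n A : Type*} [Fintype n] [DecidableEq n] [CommRing A]

/-- A kernel vector of the special fibre of a family of singular matrices is, to first order,
mapped to the kernel of the adjugate. -/
theorem Matrix.adjugate_mulVec_eq_zero_of_det_dual {H H' : Matrix n n A} {w : n → A}
    (hw : H.mulVec w = 0)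
    (hdet : (Matrix.of fun i j =>
      (TrivSqZeroExt.inl (H i j) + TrivSqZeroExt.inr (H' i j) : DualNumber A)).det = 0) :
    H.adjugate.mulVec (H'.mulVec w) = 0 := by
  set N : Matrix n n (DualNumber A) := Matrix.of fun i j =>
      (TrivSqZeroExt.inl (H i j) + TrivSqZeroExt.inr (H' i j) : DualNumber A) with hN
  have h1 : N.mulVec (fun j => TrivSqZeroExt.inl (w j)) =
      fun i => TrivSqZeroExt.inr (H'.mulVec w i) := by
    funext i
    have h2 := congrFun hw i
    simp only [Matrix.mulVec, dotProduct, Pi.zero_apply] at h2 ⊢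
    ext
    · simp [hN, TrivSqZeroExt.fst_sum, h2]
    · simp [hN, TrivSqZeroExt.snd_sum, mul_comm]
  have h2 : N.adjugate.mulVec (fun i => TrivSqZeroExt.inr (H'.mulVec w i)) = 0 := by
    rw [← h1, Matrix.mulVec_mulVec, Matrix.adjugate_mul, hdet, zero_smul, Matrix.zero_mulVec]
  have h3 : (TrivSqZeroExt.fstHom A A A).toRingHom.mapMatrix N.adjugate = H.adjugate := by
    rw [RingHom.map_adjugate]
    congr 1
    ext i j
    simp [hN]
  funext i
  have h4 := congrArg TrivSqZeroExt.snd (congrFun h2 i)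
  have h5 : ∀ j, H.adjugate i j = (N.adjugate i j).fst := fun j => by
    rw [← h3]; rfl
  simp only [Matrix.mulVec, dotProduct, Pi.zero_apply, TrivSqZeroExt.snd_sum,
    TrivSqZeroExt.snd_mul, TrivSqZeroExt.snd_inr, TrivSqZeroExt.fst_inr, smul_eq_mul,
    MulOpposite.op_zero, zero_smul, add_zero, TrivSqZeroExt.snd_zero] at h4 ⊢
  simpa only [h5] using h4

theorem Matrix.det_of_map_dual {B : Type*} [CommRing B] (φ : B →+* DualNumber A)
    {M : Matrix n n B} (h : M.det = 0) : (Matrix.of fun i j => φ (M i j)).det = 0 := by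
  have := φ.map_det M
  rw [h, map_zero] at this
  exact this.symm

end DualNumberDeterminant

/-! ### Derivatives and forms linear in a block of variables -/

section PartialDerivatives

namespace MvPolynomial

theorem pderiv_comm {σ R : Type*} [CommRing R] (i j : σ) (f : MvPolynomial σ R) :
    pderiv i (pderiv j f) = pderiv j (pderiv i f) := by
  classical
  have h : ⁅pderiv (R := R) i, pderiv (R := R) j⁆ = 0 := by
    refine derivation_ext fun l => ?_
    rw [Derivation.commutator_apply, pderiv_X, pderiv_X]
    simp only [Pi.single_apply]
    split_ifs <;> simp
  have h1 := congrArg (fun D => D f) h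
  rw [Derivation.commutator_apply] at h1
  exact sub_eq_zero.mp h1

theorem IsHomogeneous.eq_C {σ R : Type*} [CommRing R] {p : MvPolynomial σ R}
    (hp : p.IsHomogeneous 0) : p = C (constantCoeff p) := by
  rw [← totalDegree_zero_iff_isHomogeneous] at hp
  exact totalDegree_eq_zero_iff_eq_C.mp hp

theorem IsHomogeneous.eq_sum_C_mul_X {σ R : Type*} [Fintype σ] [CommRing R] {p : MvPolynomial σ R}
    (hp : p.IsHomogeneous 1) : p = ∑ i, C (constantCoeff (pderiv i p)) * X i := by
  have h := hp.sum_X_mul_pderiv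
  rw [one_smul] at h
  conv_lhs => rw [← h]
  refine Finset.sum_congr rfl fun i _ => ?_
  rw [mul_comm, ← (hp.pderiv (i := i)).eq_C]

/-- In characteristic zero a monomial containing a variable leaves a nonzero term in the derivative
along it. -/
theorem exists_rename_of_pderiv_eq_zero {σ τ K : Type*} [Field K] [CharZero K]
    {p : MvPolynomial (σ ⊕ τ) K} (h : ∀ i, pderiv (Sum.inl i) p = 0) :
    ∃ q : MvPolynomial τ K, rename Sum.inr q = p := by
  refine exists_rename_eq_of_vars_subset_range p Sum.inr Sum.inr_injective ?_
  rintro (i | j) hi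
  · exfalso
    obtain ⟨d, hd, hid⟩ := mem_vars_iff_mem_support _ |>.mp hi
    have h1 := congrArg (coeff (d - Finsupp.single (Sum.inl i) 1)) (h i)
    have h2 : Finsupp.single (Sum.inl i) 1 ≤ d := by
      rw [Finsupp.single_le_iff]
      exact Nat.one_le_iff_ne_zero.mpr (Finsupp.mem_support_iff.mp hid)
    rw [coeff_pderiv, tsub_add_cancel_of_le h2, coeff_zero] at h1
    exact mul_ne_zero (mem_support_iff.mp hd) (Nat.cast_add_one_ne_zero _) h1
  · exact ⟨j, rfl⟩

end MvPolynomial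

end PartialDerivatives

section CanonicalForm

variable {K : Type*} [Field K] {σ τ : Type*} [Fintype σ]

/-- The polynomial `∑ x_i g_i + h`. -/
noncomputable def canonicalForm (g : σ → MvPolynomial τ K) (h : MvPolynomial τ K) :
    MvPolynomial (σ ⊕ τ) K :=
  ∑ i, X (Sum.inl i) * rename Sum.inr (g i) + rename Sum.inr h

omit [Fintype σ] in
theorem pderiv_inl_rename_inr (i : σ) (q : MvPolynomial τ K) :
    pderiv (Sum.inl i) (rename Sum.inr q : MvPolynomial (σ ⊕ τ) K) = 0 := by
  classical
  refine pderiv_eq_zero_of_notMem_vars fun h => ?_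
  have h1 := vars_rename Sum.inr q h
  simp at h1

theorem pderiv_inl_canonicalForm (g : σ → MvPolynomial τ K) (h : MvPolynomial τ K) (i : σ) :
    pderiv (Sum.inl i) (canonicalForm g h) = rename Sum.inr (g i) := by
  classical
  simp only [canonicalForm, map_add, map_sum, pderiv_mul, pderiv_inl_rename_inr, pderiv_X,
    mul_zero, add_zero]
  simp [Pi.single_apply]

theorem pderiv_pderiv_canonicalForm (g : σ → MvPolynomial τ K) (h : MvPolynomial τ K) (i j : σ) :
    pderiv (Sum.inl i) (pderiv (Sum.inl j) (canonicalForm g h)) = 0 := by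
  rw [pderiv_inl_canonicalForm, pderiv_inl_rename_inr]

theorem canonicalForm_isHomogeneous {g : σ → MvPolynomial τ K} {h : MvPolynomial τ K} {n : ℕ}
    (hg : ∀ i, (g i).IsHomogeneous n) (hh : h.IsHomogeneous (n + 1)) :
    (canonicalForm g h).IsHomogeneous (n + 1) := by
  refine (IsHomogeneous.sum _ _ _ fun i _ => ?_).add hh.rename_isHomogeneous
  rw [add_comm]
  exact (isHomogeneous_X _ _).mul (hg i).rename_isHomogeneous

/-- The `g i` are the first derivatives of `v` along the first block, which no longer involve that
block. After subtracting `∑ x_i g_i`, all these derivatives vanish and the rest is `h`. -/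
theorem exists_eq_canonicalForm [CharZero K] {v : MvPolynomial (σ ⊕ τ) K} {n : ℕ}
    (hv : v.IsHomogeneous (n + 1))
    (hd : ∀ i j, pderiv (Sum.inl i) (pderiv (Sum.inl j) v) = 0) :
    ∃ (g : σ → MvPolynomial τ K) (h : MvPolynomial τ K), (∀ i, (g i).IsHomogeneous n) ∧
      h.IsHomogeneous (n + 1) ∧ v = canonicalForm g h := by
  choose g hg using fun i => exists_rename_of_pderiv_eq_zero fun j => hd j i
  have hg' : ∀ i, (g i).IsHomogeneous n := fun i => by
    rw [← IsHomogeneous.rename_isHomogeneous_iff (f := Sum.inr (α := σ)) Sum.inr_injective, hg]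
    exact hv.pderiv
  obtain ⟨h, hh⟩ := exists_rename_of_pderiv_eq_zero (p := v - canonicalForm g 0) fun i => by
    rw [map_sub, pderiv_inl_canonicalForm, hg, sub_self]
  refine ⟨g, h, hg', ?_, ?_⟩
  · rw [← IsHomogeneous.rename_isHomogeneous_iff (f := Sum.inr (α := σ)) Sum.inr_injective, hh]
    exact hv.sub (canonicalForm_isHomogeneous hg' (isHomogeneous_zero _ _ _))
  · have h1 : canonicalForm g h = canonicalForm g 0 + rename Sum.inr h := by
      simp [canonicalForm]
    rw [h1, hh, add_sub_cancel]

end CanonicalForm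

/-! ### Derivatives of the special cubic -/

section SpecialCubic

variable {K : Type*} [Field K] {k : ℕ}

/-- The quadratic forms `x_{k+1}², …, x_{2k}², L²`. -/
noncomputable def specialQuadric (K : Type*) [Field K] (k : ℕ) :
    Fin (k + 1) → MvPolynomial (Fin k) K :=
  Fin.snoc (fun i => X i ^ 2) ((∑ j, X j) ^ 2)

theorem specialQuadric_castSucc (i : Fin k) : specialQuadric K k i.castSucc = X i ^ 2 :=
  Fin.snoc_castSucc (α := fun _ => MvPolynomial (Fin k) K) _ _ _

theorem specialQuadric_last : specialQuadric K k (Fin.last k) = (∑ j, X j) ^ 2 :=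
  Fin.snoc_last (α := fun _ => MvPolynomial (Fin k) K) _ _

theorem specialCubic_eq_canonicalForm :
    specialCubic K k = canonicalForm (specialQuadric K k) 0 := by
  rw [specialCubic, canonicalForm, Fin.sum_univ_castSucc]
  simp [specialQuadric_castSucc, specialQuadric_last]

theorem specialQuadric_isHomogeneous (i : Fin (k + 1)) : (specialQuadric K k i).IsHomogeneous 2 := by
  refine Fin.lastCases ?_ (fun i => ?_) i
  · rw [specialQuadric_last]
    exact (IsHomogeneous.sum _ _ 1 fun j _ => isHomogeneous_X _ j).pow 2
  · rw [specialQuadric_castSucc]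
    exact (isHomogeneous_X _ i).pow 2

theorem specialCubic_isHomogeneous : (specialCubic K k).IsHomogeneous 3 := by
  rw [specialCubic_eq_canonicalForm]
  exact canonicalForm_isHomogeneous specialQuadric_isHomogeneous (isHomogeneous_zero _ _ _)

theorem pderiv_pderiv_specialCubic (i j : Fin (k + 1)) :
    pderiv (Sum.inl i) (pderiv (Sum.inl j) (specialCubic K k)) = 0 := by
  rw [specialCubic_eq_canonicalForm, pderiv_pderiv_canonicalForm]

theorem pderiv_inr_pderiv_inl_specialCubic_castSucc (j i : Fin k) :
    pderiv (Sum.inr j) (pderiv (Sum.inl i.castSucc) (specialCubic K k)) =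
      if i = j then 2 * X (Sum.inr j) else 0 := by
  rw [specialCubic_eq_canonicalForm, pderiv_inl_canonicalForm, specialQuadric_castSucc]
  simp only [map_pow, rename_X, pderiv_pow, pderiv_X, Pi.single_apply, Sum.inr.injEq]
  split_ifs with h
  · subst h; simp
  · simp

theorem pderiv_inr_pderiv_inl_specialCubic_last (j : Fin k) :
    pderiv (Sum.inr j) (pderiv (Sum.inl (Fin.last k)) (specialCubic K k)) =
      2 * ∑ l, X (Sum.inr l) := by
  rw [specialCubic_eq_canonicalForm, pderiv_inl_canonicalForm, specialQuadric_last]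
  simp [pderiv_X, Pi.single_apply]

theorem pderiv_inr_specialCubic (j : Fin k) :
    pderiv (Sum.inr j) (specialCubic K k) = 2 * X (Sum.inl j.castSucc) * X (Sum.inr j) +
      2 * X (Sum.inl (Fin.last k)) * ∑ l, X (Sum.inr l) := by
  rw [specialCubic]
  simp [pderiv_X, Pi.single_apply]
  ring

end SpecialCubic

/-! ### The first-order condition for a vanishing Hessian -/

section TangentVectors

variable {K : Type*} [Field K] {k : ℕ}

/-- The substitution `x_i ↦ x_i`, `y_j ↦ ∏_{l ≠ j} y_l`. -/
noncomputable def reciprocalSubst (K : Type*) [Field K] (k : ℕ) :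
    MvPolynomial (MaxVar k) K →ₐ[K] MvPolynomial (MaxVar k) K :=
  aeval (Sum.elim (fun i => X (Sum.inl i)) fun j => coProd (fun l => X (Sum.inr l)) j)

/-- The components in the `x`-directions of the kernel of the Hessian matrix of the special cubic
along the image of `reciprocalSubst`. -/
noncomputable def kernelVector (K : Type*) [Field K] (k : ℕ) :
    Fin (k + 1) → MvPolynomial (MaxVar k) K :=
  Fin.snoc (fun i => (∑ l, coProd (fun l => X (Sum.inr l)) l) * X (Sum.inr i))
    (-∏ l, X (Sum.inr l))

theorem kernelVector_castSucc (i : Fin k) : kernelVector K k i.castSucc =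
    (∑ l, coProd (fun l => X (Sum.inr l)) l) * X (Sum.inr i) :=
  Fin.snoc_castSucc (α := fun _ => MvPolynomial (MaxVar k) K) _ _ _

theorem kernelVector_last : kernelVector K k (Fin.last k) = -∏ l, X (Sum.inr l) :=
  Fin.snoc_last (α := fun _ => MvPolynomial (MaxVar k) K) _ _

/-- The Hessian matrix of a polynomial along the image of `reciprocalSubst`. -/
noncomputable def reciprocalHessian (f : MvPolynomial (MaxVar k) K) :
    Matrix (MaxVar k) (MaxVar k) (MvPolynomial (MaxVar k) K) :=
  Matrix.of fun i j => reciprocalSubst K k (pderiv i (pderiv j f))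

theorem reciprocalHessian_comm (f : MvPolynomial (MaxVar k) K) (i j : MaxVar k) :
    reciprocalHessian f i j = reciprocalHessian f j i := by
  rw [reciprocalHessian, Matrix.of_apply, Matrix.of_apply, pderiv_comm]

theorem reciprocalHessian_inl_inl (i j : Fin (k + 1)) :
    reciprocalHessian (specialCubic K k) (Sum.inl i) (Sum.inl j) = 0 := by
  rw [reciprocalHessian, Matrix.of_apply, pderiv_pderiv_specialCubic, map_zero]

theorem reciprocalHessian_inr_inl_castSucc (j i : Fin k) :
    reciprocalHessian (specialCubic K k) (Sum.inr j) (Sum.inl i.castSucc) =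
      if i = j then 2 * coProd (fun l => X (Sum.inr l)) j else 0 := by
  rw [reciprocalHessian, Matrix.of_apply, pderiv_inr_pderiv_inl_specialCubic_castSucc]
  split_ifs
  · rw [map_mul, map_ofNat]; simp [reciprocalSubst]
  · simp

theorem reciprocalHessian_inr_inl_last (j : Fin k) :
    reciprocalHessian (specialCubic K k) (Sum.inr j) (Sum.inl (Fin.last k)) =
      2 * ∑ l, coProd (fun l => X (Sum.inr l)) l := by
  rw [reciprocalHessian, Matrix.of_apply, pderiv_inr_pderiv_inl_specialCubic_last]
  rw [map_mul, map_ofNat, map_sum]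
  simp [reciprocalSubst]

/-- The kernel equations are `y_j a_j + L a_k = 0`, with solution `a_j = -L a_k / y_j`. The
reciprocal substitution turns `1 / y_j` into `t_j / ∏ t` and so clears all denominators. -/
theorem reciprocalHessian_mulVec_kernelVector :
    (reciprocalHessian (specialCubic K k)).mulVec (Sum.elim (kernelVector K k) 0) = 0 := by
  funext i
  simp only [Matrix.mulVec, dotProduct, Fintype.sum_sum_type, Sum.elim_inl, Sum.elim_inr,
    Pi.zero_apply, mul_zero, Finset.sum_const_zero, add_zero]
  rcases i with i | j
  · simp [reciprocalHessian_inl_inl]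
  · rw [Fin.sum_univ_castSucc, kernelVector_last, reciprocalHessian_inr_inl_last]
    simp only [reciprocalHessian_inr_inl_castSucc, kernelVector_castSucc, ite_mul, zero_mul,
      Finset.sum_ite_eq', Finset.mem_univ, if_true]
    rw [← mul_coProd _ j]
    ring

theorem coProd_X_inr_ne_zero (j : Fin k) :
    coProd (fun l => (X (Sum.inr l) : MvPolynomial (MaxVar k) K)) j ≠ 0 :=
  Finset.prod_ne_zero_iff.mpr fun _ _ => X_ne_zero _

variable [CharZero K]

/-- The entry is the determinant of the Hessian with its last `x`-row replaced by a unit vector.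
That row kills the last `x`-coordinate of a kernel vector, and the diagonal entries `2 ∏_{l ≠ j}
t_l` kill the others. -/
theorem reciprocalHessian_adjugate_ne_zero :
    (reciprocalHessian (specialCubic K k)).adjugate (Sum.inl (Fin.last k)) (Sum.inl (Fin.last k)) ≠
      0 := by
  rw [Matrix.adjugate_apply]
  intro h
  obtain ⟨v, hv, hv0⟩ := Matrix.exists_mulVec_eq_zero_iff.mpr h
  apply hv
  have h2 : (2 : MvPolynomial (MaxVar k) K) ≠ 0 := two_ne_zero
  have hlast : v (Sum.inl (Fin.last k)) = 0 := by
    have := congrFun hv0 (Sum.inl (Fin.last k))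
    simpa [Matrix.mulVec] using this
  have hy : ∀ j, v (Sum.inr j) = 0 := by
    intro j
    have h1 := congrFun hv0 (Sum.inl j.castSucc)
    rw [Matrix.mulVec, Matrix.updateRow_ne (by simp [Fin.castSucc_ne_last])] at h1
    simp only [dotProduct, Fintype.sum_sum_type, reciprocalHessian_inl_inl, zero_mul,
      Finset.sum_const_zero, zero_add, reciprocalHessian_comm _ (Sum.inl j.castSucc) (Sum.inr _),
      reciprocalHessian_inr_inl_castSucc, ite_mul, Finset.sum_ite_eq, Finset.mem_univ, if_true,
      Pi.zero_apply] at h1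
    exact (mul_eq_zero.mp h1).resolve_left (mul_ne_zero h2 (coProd_X_inr_ne_zero j))
  have hx : ∀ j : Fin k, v (Sum.inl j.castSucc) = 0 := by
    intro j
    have h1 := congrFun hv0 (Sum.inr j)
    rw [Matrix.mulVec, Matrix.updateRow_ne (by simp)] at h1
    simp only [dotProduct, Fintype.sum_sum_type, hy, mul_zero, Finset.sum_const_zero, add_zero,
      Fin.sum_univ_castSucc, hlast, reciprocalHessian_inr_inl_castSucc, ite_mul, zero_mul,
      Finset.sum_ite_eq', Finset.mem_univ, if_true, Pi.zero_apply] at h1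
    exact (mul_eq_zero.mp h1).resolve_left (mul_ne_zero h2 (coProd_X_inr_ne_zero j))
  funext i
  rcases i with i | j
  · exact Fin.lastCases hlast hx i
  · exact hy j

/-- A row vector in the left kernel of the Hessian is proportional to the kernel vector. -/
theorem eq_of_vecMul_reciprocalHessian_eq_zero {u : MaxVar k → MvPolynomial (MaxVar k) K}
    (hu : Matrix.vecMul u (reciprocalHessian (specialCubic K k)) = 0) :
    (∀ j, u (Sum.inr j) = 0) ∧ ∀ i, kernelVector K k (Fin.last k) * u (Sum.inl i) =
      u (Sum.inl (Fin.last k)) * kernelVector K k i := by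
  have h2 : (2 : MvPolynomial (MaxVar k) K) ≠ 0 := two_ne_zero
  have hy : ∀ j, u (Sum.inr j) = 0 := by
    intro j
    have h1 := congrFun hu (Sum.inl j.castSucc)
    simp only [Matrix.vecMul, dotProduct, Fintype.sum_sum_type, reciprocalHessian_inl_inl, mul_zero,
      Finset.sum_const_zero, zero_add, reciprocalHessian_inr_inl_castSucc, mul_ite,
      Finset.sum_ite_eq, Finset.mem_univ, if_true, Pi.zero_apply] at h1
    exact (mul_eq_zero.mp h1).resolve_right (mul_ne_zero h2 (coProd_X_inr_ne_zero j))
  refine ⟨hy, fun i => ?_⟩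
  refine Fin.lastCases (mul_comm _ _) (fun j => ?_) i
  have h1 := congrFun hu (Sum.inr j)
  simp only [Matrix.vecMul, dotProduct, Fintype.sum_sum_type, hy, zero_mul, Finset.sum_const_zero,
    add_zero, Fin.sum_univ_castSucc, reciprocalHessian_comm _ (Sum.inl _) (Sum.inr j),
    reciprocalHessian_inr_inl_castSucc, reciprocalHessian_inr_inl_last, mul_ite, mul_zero,
    Finset.sum_ite_eq', Finset.mem_univ, if_true, Pi.zero_apply] at h1
  rw [kernelVector_last, kernelVector_castSucc, ← mul_coProd _ j]
  apply mul_left_cancel₀ h2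
  linear_combination -X (Sum.inr j) * h1

/-- The polynomials over the dual numbers, with the substitution `reciprocalSubst`. -/
noncomputable def dualReciprocalSubst (K : Type*) [Field K] (k : ℕ) :
    MvPolynomial (MaxVar k) (DualNumber K) →+* DualNumber (MvPolynomial (MaxVar k) K) :=
  eval₂Hom (DualNumber.lift (R := K) ⟨(Algebra.ofId K _, DualNumber.eps),
    DualNumber.eps_mul_eps, fun _ => DualNumber.commute_eps_left _⟩ :
    DualNumber K →ₐ[K] DualNumber (MvPolynomial (MaxVar k) K)).toRingHom
    fun i => TrivSqZeroExt.inl (reciprocalSubst K k (X i))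

omit [CharZero K] in
theorem dualReciprocalSubst_map (p : MvPolynomial (MaxVar k) K) :
    dualReciprocalSubst K k (map (algebraMap K (DualNumber K)) p) =
      TrivSqZeroExt.inl (reciprocalSubst K k p) := by
  have h : ((dualReciprocalSubst K k).comp (map (algebraMap K (DualNumber K)))) =
      (TrivSqZeroExt.inlHom (MvPolynomial (MaxVar k) K) (MvPolynomial (MaxVar k) K)).comp
        (reciprocalSubst K k).toRingHom := by
    refine ringHom_ext (fun a => ?_) fun i => ?_
    · simp [dualReciprocalSubst, algebraMap_eq, TrivSqZeroExt.algebraMap_eq_inl]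
      rfl
    · simp [dualReciprocalSubst]
  exact congrArg (fun φ => φ p) h

omit [CharZero K] in
theorem dualReciprocalSubst_eps :
    dualReciprocalSubst K k (C DualNumber.eps) = DualNumber.eps := by
  simp [dualReciprocalSubst]

/-- This is the condition `wᵀ H' w = 0`. A nonzero row `u` of the adjugate is a left kernel vector
of `H`, hence proportional to `w` in the `x`-directions and zero in the `y`-directions, and `u H' w
= 0` by the dual number computation. -/
theorem sum_kernelVector_mul_eq_zero {τ : MvPolynomial (MaxVar k) K}
    (h : hessianDet (map (algebraMap K (DualNumber K)) (specialCubic K k) +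
      C DualNumber.eps * map (algebraMap K (DualNumber K)) τ) = 0) :
    ∑ i, ∑ j, kernelVector K k i * kernelVector K k j *
      reciprocalSubst K k (pderiv (Sum.inl i) (pderiv (Sum.inl j) τ)) = 0 := by
  have h1 := Matrix.det_of_map_dual (dualReciprocalSubst K k) h
  have h2 := Matrix.adjugate_mulVec_eq_zero_of_det_dual
    (H := reciprocalHessian (specialCubic K k)) (H' := reciprocalHessian τ)
    reciprocalHessian_mulVec_kernelVector (by
      refine Eq.trans ?_ h1
      congr 1
      ext1 i j
      simp only [Matrix.of_apply, map_add, pderiv_C_mul, pderiv_map, map_mul,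
        dualReciprocalSubst_map, dualReciprocalSubst_eps, reciprocalHessian]
      refine TrivSqZeroExt.ext ?_ ?_ <;> simp)
  have hk : kernelVector K k (Fin.last k) ≠ 0 := by
    rw [kernelVector_last]
    exact neg_ne_zero.mpr (Finset.prod_ne_zero_iff.mpr fun _ _ => X_ne_zero _)
  have hdet : (reciprocalHessian (specialCubic K k)).det = 0 := by
    refine Matrix.exists_mulVec_eq_zero_iff.mp ⟨_, fun h => hk ?_,
      reciprocalHessian_mulVec_kernelVector⟩
    exact congrFun h (Sum.inl (Fin.last k))
  set u := (reciprocalHessian (specialCubic K k)).adjugate (Sum.inl (Fin.last k)) with hu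
  have hu0 : Matrix.vecMul u (reciprocalHessian (specialCubic K k)) = 0 := by
    have := Matrix.adjugate_mul (reciprocalHessian (specialCubic K k))
    rw [hdet, zero_smul] at this
    exact congrFun this _
  obtain ⟨huy, hux⟩ := eq_of_vecMul_reciprocalHessian_eq_zero hu0
  have h3 := congrFun h2 (Sum.inl (Fin.last k))
  rw [Matrix.mulVec, ← hu] at h3
  simp only [dotProduct, Fintype.sum_sum_type, huy, zero_mul, Finset.sum_const_zero, add_zero,
    Matrix.mulVec, Sum.elim_inl, Sum.elim_inr, Pi.zero_apply, mul_zero] at h3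
  have h4 : u (Sum.inl (Fin.last k)) * ∑ i, ∑ j, kernelVector K k i * kernelVector K k j *
      reciprocalSubst K k (pderiv (Sum.inl i) (pderiv (Sum.inl j) τ)) =
      kernelVector K k (Fin.last k) * ∑ i, u (Sum.inl i) *
        ∑ j, reciprocalHessian τ (Sum.inl i) (Sum.inl j) * kernelVector K k j := by
    rw [Finset.mul_sum, Finset.mul_sum]
    refine Finset.sum_congr rfl fun i _ => ?_
    rw [← mul_assoc (kernelVector K k (Fin.last k)), hux, Finset.mul_sum, Finset.mul_sum]
    refine Finset.sum_congr rfl fun j _ => ?_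
    rw [reciprocalHessian, Matrix.of_apply]
    ring
  rw [h3, mul_zero] at h4
  exact (mul_eq_zero.mp h4).resolve_left reciprocalHessian_adjugate_ne_zero

end TangentVectors

/-! ### The tangent vectors of the Hessian locus -/

section TangentDecomposition

variable {K : Type*} [Field K] [CharZero K] {k : ℕ}

omit [CharZero K] in
theorem Fin.sum_sum_castSucc_symm {a : Fin (k + 1) → Fin (k + 1) → K} (ha : ∀ i j, a i j = a j i)
    (w : Fin (k + 1) → K) :
    ∑ i, ∑ j, w i * w j * a i j =
      ∑ i : Fin k, ∑ j : Fin k, w i.castSucc * w j.castSucc * a i.castSucc j.castSucc +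
      2 * w (Fin.last k) * ∑ i : Fin k, w i.castSucc * a i.castSucc (Fin.last k) +
      w (Fin.last k) ^ 2 * a (Fin.last k) (Fin.last k) := by
  simp only [Fin.sum_univ_castSucc, Finset.sum_add_distrib]
  have h : ∑ i : Fin k, w (Fin.last k) * w i.castSucc * a (Fin.last k) i.castSucc =
      w (Fin.last k) * ∑ i : Fin k, w i.castSucc * a i.castSucc (Fin.last k) := by
    rw [Finset.mul_sum]
    exact Finset.sum_congr rfl fun i _ => by rw [ha (Fin.last k)]; ring
  have h' : ∑ i : Fin k, w i.castSucc * w (Fin.last k) * a i.castSucc (Fin.last k) =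
      w (Fin.last k) * ∑ i : Fin k, w i.castSucc * a i.castSucc (Fin.last k) := by
    rw [Finset.mul_sum]
    exact Finset.sum_congr rfl fun i _ => by ring
  rw [h, h']
  ring

/-- The values of the kernel vector at a point. -/
def kernelValue (t : Fin k → K) : Fin (k + 1) → K :=
  Fin.snoc (fun i => (∑ l, coProd t l) * t i) (-∏ l, t l)

omit [CharZero K] in
theorem kernelValue_castSucc (t : Fin k → K) (i : Fin k) :
    kernelValue t i.castSucc = (∑ l, coProd t l) * t i :=
  Fin.snoc_castSucc (α := fun _ => K) _ _ _

omit [CharZero K] in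
theorem kernelValue_last (t : Fin k → K) : kernelValue t (Fin.last k) = -∏ l, t l :=
  Fin.snoc_last (α := fun _ => K) _ _

omit [CharZero K] in
theorem sum_kernelValue {a : Fin (k + 1) → Fin (k + 1) → K} (ha : ∀ i j, a i j = a j i)
    (t : Fin k → K) : ∑ i, ∑ j, kernelValue t i * kernelValue t j * a i j =
      (∑ l, coProd t l) ^ 2 * (∑ i, ∑ j, a i.castSucc j.castSucc * t i * t j) -
      2 * (∑ l, coProd t l) * (∏ j, t j) * (∑ i, a i.castSucc (Fin.last k) * t i) +
      a (Fin.last k) (Fin.last k) * (∏ j, t j) ^ 2 := by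
  rw [Fin.sum_sum_castSucc_symm ha]
  simp only [kernelValue_castSucc, kernelValue_last]
  have h1 : ∑ i : Fin k, ∑ j : Fin k, (∑ l, coProd t l) * t i * ((∑ l, coProd t l) * t j) *
      a i.castSucc j.castSucc =
      (∑ l, coProd t l) ^ 2 * (∑ i, ∑ j, a i.castSucc j.castSucc * t i * t j) := by
    simp only [Finset.mul_sum]
    exact Finset.sum_congr rfl fun i _ => Finset.sum_congr rfl fun j _ => by ring
  have h2 : ∑ i : Fin k, (∑ l, coProd t l) * t i * a i.castSucc (Fin.last k) =
      (∑ l, coProd t l) * (∑ i, a i.castSucc (Fin.last k) * t i) := by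
    simp only [Finset.mul_sum]
    exact Finset.sum_congr rfl fun i _ => by ring
  rw [h1, h2]
  ring

/-- A cubic form is zero if all its polars along the last argument vanish on the kernel vectors. -/
theorem trilinear_eq_zero_of_kernelValue [Nontrivial (Fin k)]
    {a : Fin (k + 1) → Fin (k + 1) → Fin (k + 1) → K}
    (ha : ∀ i j l, a i j l = a j i l) (ha' : ∀ i j l, a i j l = a i l j)
    (h : ∀ l (t : Fin k → K), ∑ i, ∑ j, kernelValue t i * kernelValue t j * a i j l = 0)
    (i j l : Fin (k + 1)) : a i j l = 0 := by
  have hne : ∀ l (m i j : Fin k), i ≠ m → j ≠ m → a i.castSucc j.castSucc l = 0 := by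
    intro l m i j hi hj
    refine eq_zero_of_quadratic_of_ne (i := m) (e := 2)
      (q := fun i j => a i.castSucc j.castSucc l) (fun i j => ha _ _ _) (fun t ht => ?_) hi hj
    have h1 := h l t
    rw [sum_kernelValue (a := fun i j => a i j l) (fun i j => ha _ _ _),
      Finset.prod_eq_zero (Finset.mem_univ m) ht, sum_coProd' ht] at h1
    linear_combination h1
  have hxx : ∀ (i : Fin k) (j : Fin (k + 1)), a i.castSucc i.castSucc j = 0 := by
    intro i j
    obtain ⟨m, hm⟩ := exists_ne i
    exact hne j m i i hm.symm hm.symm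
  -- Two coinciding indices are moved to the front by symmetry. If all three are distinct, the third
  -- serves as the vanishing coordinate.
  have h0 : ∀ i j l : Fin k, a i.castSucc j.castSucc l.castSucc = 0 := by
    intro i j l
    by_cases hij : i = j
    · subst hij; exact hxx i _
    · by_cases hil : i = l
      · subst hil; rw [ha']; exact hxx i _
      · by_cases hjl : j = l
        · subst hjl; rw [ha, ha']; exact hxx j _
        · exact hne _ l i j hil hjl
  have hrec : ∀ l, (∀ i j : Fin k, a i.castSucc j.castSucc l = 0) →
      (∀ i : Fin k, a i.castSucc (Fin.last k) l = 0) ∧ a (Fin.last k) (Fin.last k) l = 0 := by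
    intro l hl
    refine eq_zero_of_vanishing_on_reciprocal (β := fun i : Fin k => a i.castSucc (Fin.last k) l)
      fun t => ?_
    have h1 := h l t
    rw [sum_kernelValue (a := fun i j => a i j l) (fun i j => ha _ _ _)] at h1
    simp only [hl, zero_mul, Finset.sum_const_zero] at h1
    linear_combination h1
  have h1 := fun l : Fin k => hrec l.castSucc fun i j => h0 i j l
  have h2 : ∀ i j : Fin k, a i.castSucc j.castSucc (Fin.last k) = 0 := fun i j => by
    rw [ha']; exact (h1 j).1 i
  have h3 := hrec (Fin.last k) h2
  rcases Fin.eq_castSucc_or_eq_last i with ⟨i, rfl⟩ | rfl <;>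
    rcases Fin.eq_castSucc_or_eq_last j with ⟨j, rfl⟩ | rfl <;>
    rcases Fin.eq_castSucc_or_eq_last l with ⟨l, rfl⟩ | rfl
  · exact h0 i j l
  · exact h2 i j
  · exact (h1 l).1 i
  · exact h3.1 i
  · rw [ha]; exact (h1 l).1 j
  · rw [ha]; exact h3.1 j
  · exact (h1 l).2
  · exact h3.2

omit [CharZero K] in
theorem eval_kernelVector (x : Fin (k + 1) → K) (t : Fin k → K) (i : Fin (k + 1)) :
    eval (Sum.elim x t) (kernelVector K k i) = kernelValue t i := by
  refine Fin.lastCases ?_ (fun i => ?_) i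
  · simp [kernelVector_last, kernelValue_last]
  · simp [kernelVector_castSucc, kernelValue_castSucc, map_coProd]

/-- The second derivatives of a cubic are linear forms. The kernel vector involves only the
`t`-variables, so the condition splits into a part linear in `x` and a part free of `x`. -/
theorem sum_kernelValue_mul_eq_zero {τ : MvPolynomial (MaxVar k) K} (hτ : τ.IsHomogeneous 3)
    (h : hessianDet (map (algebraMap K (DualNumber K)) (specialCubic K k) +
      C DualNumber.eps * map (algebraMap K (DualNumber K)) τ) = 0)
    (x : Fin (k + 1) → K) (t : Fin k → K) :
    ∑ l, x l * ∑ i, ∑ j, kernelValue t i * kernelValue t j * constantCoeff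
      (pderiv (Sum.inl l) (pderiv (Sum.inl i) (pderiv (Sum.inl j) τ))) +
    ∑ l, coProd t l * ∑ i, ∑ j, kernelValue t i * kernelValue t j * constantCoeff
      (pderiv (Sum.inr l) (pderiv (Sum.inl i) (pderiv (Sum.inl j) τ))) = 0 := by
  have h1 := congrArg (eval (Sum.elim x t)) (sum_kernelVector_mul_eq_zero h)
  simp only [map_sum, map_mul, eval_kernelVector, map_zero] at h1
  have h2 : ∀ i j, eval (Sum.elim x t) (reciprocalSubst K k
      (pderiv (Sum.inl i) (pderiv (Sum.inl j) τ))) =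
      ∑ l, x l * constantCoeff (pderiv (Sum.inl l) (pderiv (Sum.inl i) (pderiv (Sum.inl j) τ))) +
      ∑ l, coProd t l *
        constantCoeff (pderiv (Sum.inr l) (pderiv (Sum.inl i) (pderiv (Sum.inl j) τ))) := by
    intro i j
    have h3 : (pderiv (Sum.inl i) (pderiv (Sum.inl j) τ)).IsHomogeneous 1 := hτ.pderiv.pderiv
    conv_lhs => rw [h3.eq_sum_C_mul_X]
    simp [reciprocalSubst, Fintype.sum_sum_type, map_coProd, mul_comm, algebraMap_eq]
  rw [← h1]
  simp only [h2, mul_add, Finset.sum_add_distrib, Finset.mul_sum]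
  congr 1
  · rw [Finset.sum_comm]
    refine Finset.sum_congr rfl fun i _ => ?_
    rw [Finset.sum_comm]
    exact Finset.sum_congr rfl fun j _ => Finset.sum_congr rfl fun l _ => by ring
  · rw [Finset.sum_comm]
    refine Finset.sum_congr rfl fun i _ => ?_
    rw [Finset.sum_comm]
    exact Finset.sum_congr rfl fun j _ => Finset.sum_congr rfl fun l _ => by ring

omit [CharZero K] in
theorem pderiv_pderiv_infinitesimal_substitution (M : Fin k → Fin (k + 1) → K)
    (i j : Fin (k + 1)) : pderiv (Sum.inl i) (pderiv (Sum.inl j)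
      (∑ l, (∑ i, C (M l i) * X (Sum.inl i)) * pderiv (Sum.inr l) (specialCubic K k))) =
      ∑ l, (C (M l i) * pderiv (Sum.inr l) (pderiv (Sum.inl j) (specialCubic K k)) +
        C (M l j) * pderiv (Sum.inr l) (pderiv (Sum.inl i) (specialCubic K k))) := by
  have hq : ∀ l i, pderiv (Sum.inl i) (∑ i, C (M l i) * X (Sum.inl i) :
      MvPolynomial (MaxVar k) K) = C (M l i) := by
    intro l i
    simp [pderiv_X, Pi.single_apply]
  have hf : ∀ l i, pderiv (Sum.inl i) (pderiv (Sum.inr l) (specialCubic K k)) =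
      pderiv (Sum.inr l) (pderiv (Sum.inl i) (specialCubic K k)) :=
    fun l i => pderiv_comm _ _ _
  have hff : ∀ l i j, pderiv (Sum.inl i)
      (pderiv (Sum.inr l) (pderiv (Sum.inl j) (specialCubic K k))) = 0 := by
    intro l i j
    rw [pderiv_comm, pderiv_pderiv_specialCubic, map_zero]
  rw [map_sum, map_sum]
  refine Finset.sum_congr rfl fun l _ => ?_
  rw [pderiv_mul, map_add, pderiv_mul, pderiv_mul, hq, hf, hf, hff, hq, pderiv_C]
  ring

/-- The tangent vectors at the special cubic to the locus of vanishing Hessian: each is a sum of a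
form that is linear in the `x_i` and of a derivative of the special cubic along a substitution
`y_l ↦ y_l + M_l(x)`. -/
theorem exists_tangent_decomposition (hk : 2 ≤ k) {τ : MvPolynomial (MaxVar k) K}
    (hτ : τ.IsHomogeneous 3)
    (h : hessianDet (map (algebraMap K (DualNumber K)) (specialCubic K k) +
      C DualNumber.eps * map (algebraMap K (DualNumber K)) τ) = 0) :
    ∃ M : Fin k → Fin (k + 1) → K, ∀ i j, pderiv (Sum.inl i) (pderiv (Sum.inl j)
      (τ - ∑ l, (∑ i, C (M l i) * X (Sum.inl i)) * pderiv (Sum.inr l) (specialCubic K k))) = 0 := by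
  have : Nontrivial (Fin k) := Fin.nontrivial_iff_two_le.mpr hk
  have h0 := sum_kernelValue_mul_eq_zero hτ h
  have hy := fun t => h0 0 t
  simp only [Pi.zero_apply, zero_mul, Finset.sum_const_zero, zero_add] at hy
  have hx : ∀ l (t : Fin k → K), ∑ i, ∑ j, kernelValue t i * kernelValue t j * constantCoeff
      (pderiv (Sum.inl l) (pderiv (Sum.inl i) (pderiv (Sum.inl j) τ))) = 0 := by
    intro l t
    -- A unit vector for `x` isolates the coefficient of `x_l`. These coefficients form a symmetric
    -- trilinear form, which must vanish: `τ` has no terms of degree three in `x`.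
    have h1 := h0 (Pi.single l 1) t
    rw [hy, add_zero] at h1
    simpa [Pi.single_apply] using h1
  have ha : ∀ i j l : Fin (k + 1), constantCoeff
      (pderiv (Sum.inl l) (pderiv (Sum.inl i) (pderiv (Sum.inl j) τ))) = 0 :=
    trilinear_eq_zero_of_kernelValue
      (a := fun i j l => constantCoeff
        (pderiv (Sum.inl l) (pderiv (Sum.inl i) (pderiv (Sum.inl j) τ))))
      (fun i j l => by rw [pderiv_comm (Sum.inl i) (Sum.inl j)])
      (fun i j l => by
        rw [pderiv_comm (Sum.inl l) (Sum.inl i), pderiv_comm (Sum.inl l) (Sum.inl j),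
          pderiv_comm (Sum.inl i) (Sum.inl j)]) hx
  let b : Fin k → Fin (k + 1) → Fin (k + 1) → K := fun l i j => constantCoeff
    (pderiv (Sum.inr l) (pderiv (Sum.inl i) (pderiv (Sum.inl j) τ)))
  have hb : ∀ l i j, b l i j = b l j i := fun l i j => by
    simp only [b]; rw [pderiv_comm (Sum.inl i)]
  have hτb : ∀ i j, pderiv (Sum.inl i) (pderiv (Sum.inl j) τ) = ∑ l, C (b l i j) * X (Sum.inr l) := by
    intro i j
    have h3 : (pderiv (Sum.inl i) (pderiv (Sum.inl j) τ)).IsHomogeneous 1 := hτ.pderiv.pderiv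
    conv_lhs => rw [h3.eq_sum_C_mul_X]
    simp [Fintype.sum_sum_type, ha, b]
  obtain ⟨ℓ, m, h1, h2, h3⟩ := exists_of_vanishing_on_reciprocal
    (α := fun l i j => b l i.castSucc j.castSucc) (β := fun l i => b l i.castSucc (Fin.last k))
    (γ := fun l => b l (Fin.last k) (Fin.last k)) (fun l i j => hb _ _ _) fun t => by
      rw [← hy t]
      exact Finset.sum_congr rfl fun l _ => by rw [← sum_kernelValue (hb l)]
  let M : Fin k → Fin (k + 1) → K := fun l => Fin.snoc (ℓ l) (m l)
  have hMc : ∀ l (i : Fin k), M l i.castSucc = ℓ l i := fun l i =>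
    Fin.snoc_castSucc (α := fun _ => K) _ _ _
  have hMl : ∀ l, M l (Fin.last k) = m l := fun l => Fin.snoc_last (α := fun _ => K) _ _
  let H : Fin (k + 1) → Fin k → MvPolynomial (MaxVar k) K := fun i l =>
    pderiv (Sum.inr l) (pderiv (Sum.inl i) (specialCubic K k))
  have hHc : ∀ i l : Fin k, H i.castSucc l = if i = l then 2 * X (Sum.inr l) else 0 :=
    fun i l => pderiv_inr_pderiv_inl_specialCubic_castSucc l i
  have hHl : ∀ l, H (Fin.last k) l = 2 * ∑ l, X (Sum.inr l) :=
    fun l => pderiv_inr_pderiv_inl_specialCubic_last l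
  refine ⟨M, fun i j => ?_⟩
  rw [map_sub, map_sub, pderiv_pderiv_infinitesimal_substitution, hτb, sub_eq_zero]
  change _ = ∑ l, (C (M l i) * H j l + C (M l j) * H i l)
  revert i j
  have hsymm : ∀ i j, (∑ l, C (b l i j) * X (Sum.inr l) : MvPolynomial (MaxVar k) K) =
      ∑ l, (C (M l i) * H j l + C (M l j) * H i l) →
      (∑ l, C (b l j i) * X (Sum.inr l) : MvPolynomial (MaxVar k) K) =
      ∑ l, (C (M l j) * H i l + C (M l i) * H j l) := by
    intro i j h
    refine Eq.trans ?_ (h.trans ?_)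
    · exact Finset.sum_congr rfl fun l _ => by rw [hb]
    · exact Finset.sum_congr rfl fun l _ => add_comm _ _
  have hcl : ∀ i : Fin k, (∑ l, C (b l i.castSucc (Fin.last k)) * X (Sum.inr l) :
      MvPolynomial (MaxVar k) K) =
      ∑ l, (C (M l i.castSucc) * H (Fin.last k) l + C (M l (Fin.last k)) * H i.castSucc l) := by
    intro i
    simp only [h2, hMc, hMl, hHc, hHl, Finset.sum_add_distrib, map_add, add_mul, ← Finset.sum_mul,
      map_mul, map_sum, mul_ite, mul_zero, Finset.sum_ite_eq, Finset.mem_univ, if_true,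
      apply_ite C, map_zero, ite_mul, zero_mul, map_ofNat, ← Finset.mul_sum]
    ring
  intro i j
  rcases Fin.eq_castSucc_or_eq_last i with ⟨i, rfl⟩ | rfl <;>
    rcases Fin.eq_castSucc_or_eq_last j with ⟨j, rfl⟩ | rfl
  · simp only [h1, hMc, hHc, Finset.sum_add_distrib, map_add, add_mul, apply_ite C, map_zero,
      ite_mul, zero_mul, mul_ite, mul_zero, Finset.sum_ite_eq, Finset.mem_univ, if_true, map_mul,
      map_ofNat]
    ring
  · exact hcl i
  · exact hsymm _ _ (hcl j)
  · simp only [h3, hMl, hHl, map_mul, map_sum, map_ofNat, ← Finset.mul_sum, ← Finset.sum_mul,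
      Finset.sum_add_distrib]
    ring

end TangentDecomposition

/-! ### Linear substitutions and the Hessian -/

section LinearSubstitution

variable {ι R : Type*} [Fintype ι] [CommRing R]

/-- The substitution `x_i ↦ ∑ j, A i j x_j` for a matrix that need not be invertible. -/
noncomputable def matSubst (A : Matrix ι ι R) : MvPolynomial ι R →ₐ[R] MvPolynomial ι R :=
  bind₁ fun i => ∑ j, C (A i j) * X j

theorem matSubst_X (A : Matrix ι ι R) (i : ι) : matSubst A (X i) = ∑ j, C (A i j) * X j :=
  bind₁_X_right _ _

theorem map_matSubst {S : Type*} [CommRing S] (φ : R →+* S) (A : Matrix ι ι R)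
    (f : MvPolynomial ι R) : map φ (matSubst A f) = matSubst (A.map φ) (map φ f) := by
  rw [matSubst, map_bind₁, matSubst]
  simp

theorem matSubst_matSubst (A B : Matrix ι ι R) (f : MvPolynomial ι R) :
    matSubst B (matSubst A f) = matSubst (A * B) f := by
  have h : (matSubst B).comp (matSubst A) = matSubst (A * B) := by
    refine algHom_ext fun i => ?_
    simp only [AlgHom.comp_apply, matSubst_X, map_sum, map_mul, Matrix.mul_apply, Finset.sum_mul,
      Finset.mul_sum, algHom_C, algebraMap_eq]
    rw [Finset.sum_comm]
    exact Finset.sum_congr rfl fun j _ => Finset.sum_congr rfl fun l _ => by ring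
  exact congrArg (fun φ => φ f) h

theorem matSubst_one [DecidableEq ι] (f : MvPolynomial ι R) : matSubst 1 f = f := by
  have h : matSubst (1 : Matrix ι ι R) = AlgHom.id R _ := by
    refine algHom_ext fun i => ?_
    simp [matSubst_X, Matrix.one_apply]
  rw [h, AlgHom.id_apply]

theorem matSubst_isHomogeneous {n : ℕ} {f : MvPolynomial ι R} (hf : f.IsHomogeneous n)
    (A : Matrix ι ι R) : (matSubst A f).IsHomogeneous n := by
  rw [matSubst, bind₁]
  have := hf.aeval (fun i => ∑ j, C (A i j) * X j) (n := 1)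
    fun i => IsHomogeneous.sum _ _ _ fun j _ => (isHomogeneous_X R j).C_mul _
  rwa [one_mul] at this

theorem pderiv_matSubst (A : Matrix ι ι R) (f : MvPolynomial ι R) (i : ι) :
    pderiv i (matSubst A f) = ∑ j, C (A j i) * matSubst A (pderiv j f) := by
  classical
  induction f using MvPolynomial.induction_on with
  | C a => simp [algHom_C, algebraMap_eq]
  | add p q hp hq => simp only [map_add, hp, hq, mul_add, Finset.sum_add_distrib]
  | mul_X p j hp =>
    have h1 : pderiv i (matSubst A (X j)) = C (A j i) := by
      simp [matSubst_X, pderiv_X, Pi.single_apply]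
    rw [map_mul, pderiv_mul, hp, h1, Finset.sum_mul]
    simp only [pderiv_mul, map_add, map_mul, mul_add, Finset.sum_add_distrib]
    congr 1
    · exact Finset.sum_congr rfl fun l _ => by ring
    · simp [pderiv_X, Pi.single_apply, apply_ite (matSubst A), mul_comm]

/-- By the chain rule the Hessian matrix of `f ∘ A` is `Aᵀ (Hess f ∘ A) A`. In particular its
vanishing persists under non-invertible substitutions. -/
theorem hessianDet_matSubst [DecidableEq ι] (A : Matrix ι ι R) (f : MvPolynomial ι R) :
    hessianDet (matSubst A f) = C A.det ^ 2 * matSubst A (hessianDet f) := by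
  have h : (Matrix.of fun i j => pderiv i (pderiv j (matSubst A f))) =
      (A.map C).transpose * (Matrix.of fun i j => matSubst A (pderiv i (pderiv j f))) *
        A.map C := by
    ext1 i j
    simp only [Matrix.of_apply, Matrix.mul_apply, Matrix.transpose_apply, Matrix.map_apply,
      pderiv_matSubst, map_sum, pderiv_C_mul, Finset.mul_sum, Finset.sum_mul]
    refine Finset.sum_congr rfl fun l _ => Finset.sum_congr rfl fun m _ => ?_
    ring
  have h1 : (A.map (C (σ := ι))).det = C A.det := (RingHom.map_det C A).symm
  rw [hessianDet, h, Matrix.det_mul, Matrix.det_mul, Matrix.det_transpose, h1, hessianDet,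
    AlgHom.map_det]
  have h2 : (matSubst A).mapMatrix (Matrix.of fun i j => pderiv i (pderiv j f)) =
    Matrix.of fun i j => matSubst A (pderiv i (pderiv j f)) := rfl
  rw [h2]
  ring

/-- Modulo `T` the substitution fixes every variable. -/
theorem bind₁_add_mul_sub_dvd {σ : Type*} (T : MvPolynomial σ R) (q : σ → MvPolynomial σ R)
    (p : MvPolynomial σ R) : ∃ r, bind₁ (fun i => X i + T * q i) p = p + T * r := by
  have h : ((Ideal.Quotient.mkₐ R (Ideal.span {T})).comp (bind₁ fun i => X i + T * q i)) =
      Ideal.Quotient.mkₐ R (Ideal.span {T}) := by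
    refine algHom_ext fun i => ?_
    rw [AlgHom.comp_apply, bind₁_X_right]
    refine Ideal.Quotient.eq.mpr ?_
    rw [add_sub_cancel_left]
    exact Ideal.mul_mem_right _ _ (Ideal.mem_span_singleton_self T)
  have h1 := Ideal.Quotient.eq.mp (congrArg (fun φ => φ p) h)
  obtain ⟨r, hr⟩ := Ideal.mem_span_singleton.mp h1
  have h2 : bind₁ (fun i => X i + T * q i) p - p = T * r := hr
  exact ⟨r, by rw [← h2]; ring⟩

end LinearSubstitution

/-! ### Cubics linear in the first block of variables -/

section CanonicalCubics

variable (K : Type*) [Field K] (σ τ : Type*)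

/-- The cubic forms that are linear in the first set of variables. -/
noncomputable def canonicalCubics : Submodule K (MvPolynomial (σ ⊕ τ) K) :=
  homogeneousSubmodule (σ ⊕ τ) K 3 ⊓
    ⨅ (i : σ) (j : σ), LinearMap.ker ((pderiv (R := K) (Sum.inl i)).toLinearMap.comp
      (pderiv (R := K) (Sum.inl j : σ ⊕ τ)).toLinearMap)

variable {K σ τ}

theorem mem_canonicalCubics {v : MvPolynomial (σ ⊕ τ) K} : v ∈ canonicalCubics K σ τ ↔
    v.IsHomogeneous 3 ∧ ∀ i j, pderiv (Sum.inl i) (pderiv (Sum.inl j) v) = 0 := by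
  simp [canonicalCubics, Submodule.mem_iInf, mem_homogeneousSubmodule]

theorem specialCubic_mem_canonicalCubics {k : ℕ} :
    specialCubic K k ∈ canonicalCubics K (Fin (k + 1)) (Fin k) :=
  mem_canonicalCubics.mpr ⟨specialCubic_isHomogeneous, pderiv_pderiv_specialCubic⟩

/-- A matrix with a vanishing diagonal block of more than half the size is singular. -/
theorem Matrix.det_eq_zero_of_inl_inl {R : Type*} [CommRing R] [Fintype σ] [Fintype τ]
    [DecidableEq σ] [DecidableEq τ] (h : Fintype.card τ < Fintype.card σ)
    {M : Matrix (σ ⊕ τ) (σ ⊕ τ) R} (hM : ∀ i j, M (Sum.inl i) (Sum.inl j) = 0) : M.det = 0 := by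
  rw [Matrix.det_apply]
  refine Finset.sum_eq_zero fun e _ => ?_
  obtain ⟨i, j, hij⟩ : ∃ i j, e (Sum.inl j) = Sum.inl i := by
    -- A permutation avoiding the zero block would map the larger index set injectively into the
    -- smaller one.
    by_contra! hne
    have h1 : ∀ j : σ, ∃ l : τ, e (Sum.inl j) = Sum.inr l := fun j => by
      rcases he : e (Sum.inl j) with i | l
      · exact absurd he (hne i j)
      · exact ⟨l, rfl⟩
    choose g hg using h1
    refine absurd (Fintype.card_le_of_injective g fun a b hab => ?_) (not_le.mpr h)
    exact Sum.inl_injective (e.injective (by rw [hg, hg, hab]))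
  rw [Finset.prod_eq_zero (Finset.mem_univ (Sum.inl j)) (by rw [hij, hM]), smul_zero]

theorem hessianDet_eq_zero_of_mem_canonicalCubics [Fintype σ] [Fintype τ]
    [DecidableEq σ] [DecidableEq τ] (h : Fintype.card τ < Fintype.card σ)
    {v : MvPolynomial (σ ⊕ τ) K} (hv : v ∈ canonicalCubics K σ τ) : hessianDet v = 0 :=
  Matrix.det_eq_zero_of_inl_inl h (mem_canonicalCubics.mp hv).2

end CanonicalCubics

/-! ### Pencils with prescribed velocity -/

section Pencil

variable {ι K : Type*} [Fintype ι] [Field K]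

/-- The polynomial curve `s ↦ (v + s v') ∘ (A + s A')` in a space of forms. -/
noncomputable def pencil (v v' : MvPolynomial ι K) (A A' : Matrix ι ι K) :
    MvPolynomial ι (Polynomial K) :=
  matSubst (A.map Polynomial.C + (Polynomial.X : Polynomial K) • A'.map Polynomial.C)
    (map Polynomial.C v + C Polynomial.X * map Polynomial.C v')

omit [Fintype ι] in
theorem map_eval_map_C (s : K) (v : MvPolynomial ι K) :
    map (Polynomial.evalRingHom s) (map Polynomial.C v) = v := by
  rw [map_map]
  have : (Polynomial.evalRingHom s).comp Polynomial.C = RingHom.id K := by ext; simp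
  rw [this, map_id]

theorem map_eval_pencil (v v' : MvPolynomial ι K) (A A' : Matrix ι ι K) (s : K) :
    map (Polynomial.evalRingHom s) (pencil v v' A A') = matSubst (A + s • A') (v + s • v') := by
  rw [pencil, map_matSubst, map_add, map_mul, map_eval_map_C, map_eval_map_C, map_C,
    smul_eq_C_mul]
  congr 2
  · ext; simp; exact mul_comm _ _
  · simp

theorem matSubst_one_add_smul {R : Type*} [CommRing R] [DecidableEq ι] {S : Type*} [CommRing S]
    (φ : R →+* S) (t : S) (A : Matrix ι ι R) :
    matSubst ((1 : Matrix ι ι R).map φ + t • A.map φ) =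
      bind₁ fun i => X i + C t * ∑ j, C (φ (A i j)) * X j := by
  refine algHom_ext fun i => ?_
  rw [matSubst_X, bind₁_X_right]
  simp only [Matrix.add_apply, Matrix.map_apply, Matrix.smul_apply, smul_eq_mul, map_add, add_mul,
    Finset.sum_add_distrib, map_mul, mul_assoc, ← Finset.mul_sum, Matrix.one_apply]
  simp [apply_ite]

variable {k : ℕ}

/-- The special cubic is quadratic in `y`, so the expansion stops at `T ^ 2`; the coefficient of `T`
is `∑ q_l ∂f/∂y_l`. -/
theorem bind₁_specialCubic (T : MvPolynomial (MaxVar k) (Polynomial K))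
    (q : Fin k → MvPolynomial (MaxVar k) (Polynomial K)) :
    bind₁ (fun i => X i + T * Sum.elim (fun _ => 0) q i)
      (map Polynomial.C (specialCubic K k)) = map Polynomial.C (specialCubic K k) +
      T * ∑ l, q l * (2 * X (Sum.inl l.castSucc) * X (Sum.inr l) +
        2 * X (Sum.inl (Fin.last k)) * ∑ l, X (Sum.inr l)) +
      T ^ 2 * (∑ l, X (Sum.inl l.castSucc) * q l ^ 2 +
        X (Sum.inl (Fin.last k)) * (∑ l, q l) ^ 2) := by
  have h1 : map Polynomial.C (specialCubic K k) =
      ∑ i : Fin k, X (Sum.inl i.castSucc) * X (Sum.inr i) ^ 2 +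
        X (Sum.inl (Fin.last k)) * (∑ j : Fin k, X (Sum.inr j)) ^ 2 := by
    simp only [specialCubic, map_add, map_sum, map_mul, map_pow, map_X]
  have h2 : bind₁ (fun i => X i + T * Sum.elim (fun _ => 0) q i)
      (map Polynomial.C (specialCubic K k)) =
      ∑ i : Fin k, X (Sum.inl i.castSucc) * (X (Sum.inr i) + T * q i) ^ 2 +
        X (Sum.inl (Fin.last k)) * (∑ j : Fin k, (X (Sum.inr j) + T * q j)) ^ 2 := by
    rw [h1]
    simp only [map_add, map_sum, map_mul, map_pow, bind₁_X_right,
      Sum.elim_inl, Sum.elim_inr, mul_zero, add_zero]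
  have h3 : ∀ i : Fin k, X (Sum.inl i.castSucc) * (X (Sum.inr i) + T * q i) ^ 2 =
      X (Sum.inl i.castSucc) * X (Sum.inr i) ^ 2 +
      T * (q i * (2 * X (Sum.inl i.castSucc) * X (Sum.inr i))) +
      T ^ 2 * (X (Sum.inl i.castSucc) * q i ^ 2) := fun i => by ring
  rw [h2, h1]
  simp only [h3, Finset.sum_add_distrib, mul_add, ← Finset.mul_sum, ← Finset.sum_mul]
  ring

variable [CharZero K]

/-- Every tangent vector at the special cubic to the locus of vanishing Hessian is the velocity of a
curve in the family of cubics of canonical form. -/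
theorem exists_pencil_of_hessianDet_dual (hk : 2 ≤ k) {τ : MvPolynomial (MaxVar k) K}
    (hτ : τ.IsHomogeneous 3)
    (h : hessianDet (map (algebraMap K (DualNumber K)) (specialCubic K k) +
      C DualNumber.eps * map (algebraMap K (DualNumber K)) τ) = 0) :
    ∃ w ∈ canonicalCubics K (Fin (k + 1)) (Fin k), ∃ A' r,
      pencil (specialCubic K k) w 1 A' = map Polynomial.C (specialCubic K k) +
        C Polynomial.X * map Polynomial.C τ + C (Polynomial.X ^ 2) * r := by
  obtain ⟨M, hM⟩ := exists_tangent_decomposition hk hτ h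
  set w := τ - ∑ l, (∑ i, C (M l i) * X (Sum.inl i)) * pderiv (Sum.inr l) (specialCubic K k) with hw
  have hwc : w ∈ canonicalCubics K (Fin (k + 1)) (Fin k) := by
    refine mem_canonicalCubics.mpr ⟨hτ.sub (IsHomogeneous.sum _ _ _ fun l _ => ?_), hM⟩
    exact (IsHomogeneous.sum _ _ 1 fun i _ => (isHomogeneous_X K _).C_mul _).mul
      (specialCubic_isHomogeneous.pderiv)
  -- The infinitesimal substitution fixing `x` and moving `y_l` by the linear form `M_l(x)`.
  let A' : Matrix (MaxVar k) (MaxVar k) K := Matrix.of fun i j =>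
    Sum.elim (fun _ => 0) (fun l => Sum.elim (M l) (fun _ => 0) j) i
  let q : Fin k → MvPolynomial (MaxVar k) (Polynomial K) := fun l =>
    ∑ i, C (Polynomial.C (M l i)) * X (Sum.inl i)
  set T : MvPolynomial (MaxVar k) (Polynomial K) := C Polynomial.X with hT
  have hsub : matSubst ((1 : Matrix (MaxVar k) (MaxVar k) K).map Polynomial.C +
      (Polynomial.X : Polynomial K) • A'.map Polynomial.C) =
      bind₁ (fun i => X i + T * Sum.elim (fun _ => 0) q i) := by
    refine (matSubst_one_add_smul Polynomial.C (Polynomial.X : Polynomial K) A').trans ?_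
    refine congrArg bind₁ (funext fun i => ?_)
    rw [hT, Fintype.sum_sum_type]
    rcases i with i | l
    · simp only [A', Matrix.of_apply, Sum.elim_inl, map_zero, zero_mul, Finset.sum_const_zero,
        add_zero]
    · simp only [A', q, Matrix.of_apply, Sum.elim_inl, Sum.elim_inr, map_zero, zero_mul,
        Finset.sum_const_zero, add_zero]
  obtain ⟨r, hr⟩ := bind₁_add_mul_sub_dvd T (Sum.elim (fun _ => 0) q) (map Polynomial.C w)
  refine ⟨w, hwc, A', ∑ l, X (Sum.inl l.castSucc) * q l ^ 2 +
    X (Sum.inl (Fin.last k)) * (∑ l, q l) ^ 2 + r, ?_⟩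
  have hτw : map Polynomial.C τ = map Polynomial.C w + ∑ l, q l *
      (2 * X (Sum.inl l.castSucc) * X (Sum.inr l) +
        2 * X (Sum.inl (Fin.last k)) * ∑ l, X (Sum.inr l)) := by
    have h1 : τ = w + ∑ l, (∑ i, C (M l i) * X (Sum.inl i)) *
        pderiv (Sum.inr l) (specialCubic K k) := by rw [hw, sub_add_cancel]
    conv_lhs => rw [h1]
    simp only [pderiv_inr_specialCubic, map_add, map_sum, map_mul, map_C, map_X, map_ofNat, q]
  rw [pencil, hsub, map_add, map_mul, bind₁_specialCubic, hr, hτw, hT, bind₁_C_right, map_pow]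
  ring

end Pencil

/-! ### Linear independence, coprimality and irreducibility along a pencil -/

section OpenConditions

/-- Linear independence is an open condition along a line in a vector space. -/
theorem LinearIndependent.exists_polynomial_of_line {K V α : Type*} [Field K] [AddCommGroup V]
    [Module K V] [Finite α] {u : α → V} (hu : LinearIndependent K u) (u' : α → V) :
    ∃ D : Polynomial K, D ≠ 0 ∧
      ∀ s : K, D.eval s ≠ 0 → LinearIndependent K fun a => u a + s • u' a := by
  classical
  have := Fintype.ofFinite α
  obtain ⟨φ, hφ⟩ := LinearMap.exists_leftInverse_of_injective (Finsupp.linearCombination K u)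
    (LinearMap.ker_eq_bot.mpr hu)
  have hφu : ∀ a, φ (u a) = Finsupp.single a 1 := fun a => by
    have := congrArg (fun ψ => ψ (Finsupp.single a 1)) hφ
    simpa using this
  -- The coordinates of the moving vectors under a left inverse `φ` of the original system; at `s =
  -- 0` this is the identity matrix, so its determinant is a nonzero polynomial.
  let M : Matrix α α (Polynomial K) := Matrix.of fun a b =>
    Polynomial.C (φ (u a) b) + Polynomial.X * Polynomial.C (φ (u' a) b)
  have hM : ∀ s, M.det.eval s = (Matrix.of fun a b => φ (u a + s • u' a) b).det := by
    intro s
    rw [← Polynomial.coe_evalRingHom, RingHom.map_det]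
    congr 1
    ext1 a b
    simp [M, mul_comm s]
  refine ⟨M.det, fun h => ?_, fun s hs => ?_⟩
  · have h1 := hM 0
    rw [h, Polynomial.eval_zero] at h1
    have h2 : (Matrix.of fun a b => φ (u a + (0 : K) • u' a) b) = (1 : Matrix α α K) := by
      ext1 a b
      simp [hφu, Matrix.one_apply, Finsupp.single_apply]
    rw [h2, Matrix.det_one] at h1
    exact zero_ne_one h1
  · rw [hM] at hs
    rw [Fintype.linearIndependent_iff]
    intro c hc
    have h1 : Matrix.vecMul c (Matrix.of fun a b => φ (u a + s • u' a) b) = 0 := by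
      funext b
      have h2 := congrArg (fun x => φ x b) hc
      simpa [Matrix.vecMul, dotProduct, Finsupp.finsetSum_apply, mul_add] using h2
    exact congrFun (Matrix.eq_zero_of_vecMul_eq_zero hs h1)

end OpenConditions

section RelativelyPrime

variable {K τ : Type*} [Field K] [Fintype τ]

theorem MvPolynomial.exists_eq_C_add_linear {p : MvPolynomial τ K} (hp : p.totalDegree ≤ 1) :
    ∃ (c : K) (a : τ → K), p = C c + ∑ j, C (a j) * X j := by
  have h1 : p = homogeneousComponent 0 p + homogeneousComponent 1 p := by
    conv_lhs => rw [← sum_homogeneousComponent p]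
    rcases Nat.le_one_iff_eq_zero_or_eq_one.mp hp with h | h
    · rw [h]
      simp [homogeneousComponent_eq_zero 1 p (by omega)]
    · rw [h]
      simp [Finset.sum_range_succ]
  rw [homogeneousComponent_zero,
    (homogeneousComponent_isHomogeneous 1 p).eq_sum_C_mul_X] at h1
  exact ⟨_, _, h1⟩

/-- Two quadratic forms without linear syzygies are relatively prime. -/
theorem isRelPrime_of_linearIndependent [Nonempty τ] {p q : MvPolynomial τ K}
    (hp : p.IsHomogeneous 2) (hq : q.IsHomogeneous 2)
    (h : LinearIndependent K (Sum.elim (fun j => X j * p) fun j => X j * q)) : IsRelPrime p q := by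
  have hlin : ∀ a b : τ → K, ∑ j, C (a j) * X j * p + ∑ j, C (b j) * X j * q = 0 →
      a = 0 ∧ b = 0 := by
    intro a b hab
    have h1 := Fintype.linearIndependent_iff.mp h (Sum.elim a b) (by
      rw [Fintype.sum_sum_type]
      simpa [smul_eq_C_mul, mul_assoc] using hab)
    exact ⟨funext fun j => h1 (Sum.inl j), funext fun j => h1 (Sum.inr j)⟩
  have hp0 : p ≠ 0 := by
    rintro rfl
    have := (hlin 1 0 (by simp)).1
    exact one_ne_zero (congrFun this (Classical.arbitrary τ))
  have hq0 : q ≠ 0 := by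
    rintro rfl
    have := (hlin 0 1 (by simp)).2
    exact one_ne_zero (congrFun this (Classical.arbitrary τ))
  rintro d ⟨e, he⟩ ⟨e', he'⟩
  by_contra hd
  have hd0 : d ≠ 0 := by rintro rfl; exact hp0 (by rw [he, zero_mul])
  have he0 : e ≠ 0 := by rintro rfl; exact hp0 (by rw [he, mul_zero])
  have he0' : e' ≠ 0 := by rintro rfl; exact hq0 (by rw [he', mul_zero])
  -- A non-constant common factor of two quadratic forms leaves cofactors of degree at most one, and
  -- these give a syzygy `e' p = e q`.
  have hdeg : 1 ≤ d.totalDegree := by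
    rw [Nat.one_le_iff_ne_zero]
    intro h0
    rw [totalDegree_eq_zero_iff_eq_C] at h0
    refine hd (h0 ▸ IsUnit.map C (isUnit_iff_ne_zero.mpr fun h1 => hd0 ?_))
    rw [h0, h1, C_0]
  have h1 := hp.totalDegree hp0
  have h2 := hq.totalDegree hq0
  rw [he, totalDegree_mul_of_isDomain hd0 he0] at h1
  rw [he', totalDegree_mul_of_isDomain hd0 he0'] at h2
  obtain ⟨c, a, hea⟩ := exists_eq_C_add_linear (p := e) (by omega)
  obtain ⟨c', a', hea'⟩ := exists_eq_C_add_linear (p := e') (by omega)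
  have h3 : e' * p = e * q := by rw [he, he']; ring
  have hlinh : ∀ a : τ → K, (∑ j, C (a j) * X j).IsHomogeneous 1 := fun a =>
    IsHomogeneous.sum _ _ _ fun j _ => (isHomogeneous_X K j).C_mul _
  -- The part of the syzygy of degree three is a form of degree three that equals one of degree two,
  -- so it vanishes.
  have h4 : (∑ j, C (a' j) * X j) * p - (∑ j, C (a j) * X j) * q = 0 := by
    by_contra hne
    have h5 : (∑ j, C (a' j) * X j) * p - (∑ j, C (a j) * X j) * q = C c * q - C c' * p := by
      rw [hea, hea'] at h3
      linear_combination h3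
    have h6 : ((∑ j, C (a' j) * X j) * p - (∑ j, C (a j) * X j) * q).IsHomogeneous 3 :=
      ((hlinh a').mul hp).sub ((hlinh a).mul hq)
    have h7 : ((∑ j, C (a' j) * X j) * p - (∑ j, C (a j) * X j) * q).IsHomogeneous 2 := by
      rw [h5]; exact (hq.C_mul _).sub (hp.C_mul _)
    have := (h6.totalDegree hne).symm.trans (h7.totalDegree hne)
    omega
  have h5 := hlin a' (-a) (by
    rw [← h4]
    simp [Finset.sum_mul, sub_eq_add_neg])
  have ha : a = 0 := neg_eq_zero.mp h5.2
  rw [ha] at hea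
  rw [h5.1] at hea'
  simp only [Pi.zero_apply, C_0, zero_mul, Finset.sum_const_zero, add_zero] at hea hea'
  -- The remaining syzygy has constant coefficients; multiplying it by `∑ X j` turns it into a
  -- linear one.
  have h6 := hlin (fun _ => c') (fun _ => -c) (by
    rw [hea, hea'] at h3
    simp only [map_neg, neg_mul, Finset.sum_neg_distrib, ← Finset.sum_mul, ← Finset.mul_sum]
    linear_combination (∑ j, X j) * h3)
  have h7 := congrFun h6.1 (Classical.arbitrary τ)
  simp only [Pi.zero_apply] at h7
  exact he0' (by rw [hea', h7, C_0])

end RelativelyPrime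

section Irreducible

variable {K σ τ : Type*} [Field K] [Fintype σ]

omit [Fintype σ] in
theorem inl_notMem_vars_rename_inr [DecidableEq σ] [DecidableEq τ] (i : σ) (q : MvPolynomial τ K) :
    (Sum.inl i : σ ⊕ τ) ∉ (rename Sum.inr q).vars := by
  intro h
  have h1 := vars_rename Sum.inr q h
  simp at h1

/-- The polynomial has degree one in `x_i`, so it suffices that the coefficient `g i` and the rest
have no common factor. Such a factor divides `g i`, so it is free of all `x`. Differentiating the
rest along `x_j` shows that it divides `g j` too. -/
theorem irreducible_canonicalForm [CharZero K] {g : σ → MvPolynomial τ K} {h : MvPolynomial τ K}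
    {i j : σ} (hij : j ≠ i) (hi : g i ≠ 0) (hg : IsRelPrime (g i) (g j)) :
    Irreducible (canonicalForm g h) := by
  classical
  have hdecomp : canonicalForm g h = rename Sum.inr (g i) * X (Sum.inl i) +
      (∑ l ∈ Finset.univ.erase i, X (Sum.inl l) * rename Sum.inr (g l) + rename Sum.inr h) := by
    rw [canonicalForm, ← Finset.add_sum_erase _ _ (Finset.mem_univ i)]
    ring
  set rest : MvPolynomial (σ ⊕ τ) K :=
    ∑ l ∈ Finset.univ.erase i, X (Sum.inl l) * rename Sum.inr (g l) + rename Sum.inr h with hrest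
  have hi' : (rename Sum.inr (g i) : MvPolynomial (σ ⊕ τ) K) ≠ 0 := fun h0 =>
    hi (rename_injective Sum.inr Sum.inr_injective (h0.trans (map_zero _).symm))
  rw [hdecomp]
  refine irreducible_mul_X_add _ _ _ hi' (inl_notMem_vars_rename_inr i _) (fun hmem => ?_) ?_
  · rcases Finset.mem_union.mp (vars_add_subset _ _ hmem) with hmem | hmem
    · obtain ⟨l, hl, hl'⟩ := Finset.mem_biUnion.mp (vars_sum_subset _ _ hmem)
      rcases Finset.mem_union.mp (vars_mul _ _ hl') with h1 | h1
      · rw [vars_X, Finset.mem_singleton, Sum.inl.injEq] at h1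
        exact Finset.ne_of_mem_erase hl h1.symm
      · exact inl_notMem_vars_rename_inr i _ h1
    · exact inl_notMem_vars_rename_inr i _ hmem
  · rintro d ⟨e, he⟩ ⟨e', he'⟩
    have hd0 : d ≠ 0 := by rintro rfl; exact hi' (by rw [he, zero_mul])
    have he0 : e ≠ 0 := by rintro rfl; exact hi' (by rw [he, mul_zero])
    have hvars : ∀ l, degreeOf (Sum.inl l) d = 0 := by
      intro l
      have h1 : degreeOf (Sum.inl l) (rename Sum.inr (g i) : MvPolynomial (σ ⊕ τ) K) = 0 :=
        not_not.mp (mem_vars_iff_degreeOf_ne_zero.not.mp (inl_notMem_vars_rename_inr l _))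
      rw [he, degreeOf_mul_eq hd0 he0] at h1
      omega
    have hpd : ∀ l, pderiv (Sum.inl l) d = 0 := fun l =>
      pderiv_eq_zero_of_notMem_vars (mem_vars_iff_degreeOf_ne_zero.not.mpr (not_not.mpr (hvars l)))
    have hj : pderiv (Sum.inl j) rest = rename Sum.inr (g j) := by
      simp only [hrest, map_add, map_sum, pderiv_mul, pderiv_inl_rename_inr, mul_zero, add_zero,
        pderiv_X, Pi.single_apply, Sum.inl.injEq, ite_mul, one_mul, zero_mul]
      rw [Finset.sum_ite_eq', if_pos (Finset.mem_erase.mpr ⟨hij, Finset.mem_univ j⟩)]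
    obtain ⟨d', rfl⟩ := exists_rename_of_pderiv_eq_zero hpd
    have hdvd : ∀ {a : MvPolynomial τ K},
        rename Sum.inr d' ∣ (rename Sum.inr a : MvPolynomial (σ ⊕ τ) K) → d' ∣ a := by
      rintro a ⟨b, hb⟩
      have h1 := congrArg (aeval (Sum.elim (fun _ : σ => (0 : MvPolynomial τ K)) X)) hb
      rw [map_mul, aeval_rename, aeval_rename] at h1
      have h2 : (Sum.elim (fun _ : σ => (0 : MvPolynomial τ K)) X) ∘ Sum.inr = X := rfl
      rw [h2, aeval_X_left_apply, aeval_X_left_apply] at h1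
      exact ⟨_, h1⟩
    have h1 : IsUnit d' := hg (hdvd ⟨e, he⟩) (hdvd ⟨pderiv (Sum.inl j) e', by
      rw [← hj, he', pderiv_mul, hpd, zero_mul, zero_add]⟩)
    exact h1.map (rename Sum.inr)

end Irreducible

/-! ### General members of a pencil belong to the maximal family -/

section Family

variable {K : Type*} [Field K] {k : ℕ}

theorem linearSubst_eq_matSubst {ι : Type*} [Fintype ι] [DecidableEq ι] (A : GL ι K)
    (f : MvPolynomial ι K) : linearSubst A f = matSubst A.1 f :=
  rfl

/-- An invertible linear substitution as an automorphism of the polynomial ring. -/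
noncomputable def matSubstEquiv {ι : Type*} [Fintype ι] [DecidableEq ι] (A : GL ι K) :
    MvPolynomial ι K ≃ₐ[K] MvPolynomial ι K :=
  AlgEquiv.ofAlgHom (matSubst A.1) (matSubst (A⁻¹).1)
    (AlgHom.ext fun f => by
      rw [AlgHom.comp_apply, matSubst_matSubst, ← Units.val_mul, inv_mul_cancel, Units.val_one,
        matSubst_one, AlgHom.id_apply])
    (AlgHom.ext fun f => by
      rw [AlgHom.comp_apply, matSubst_matSubst, ← Units.val_mul, mul_inv_cancel, Units.val_one,
        matSubst_one, AlgHom.id_apply])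

/-- The transcendence degree of the polynomial ring is its number of variables. So algebraic
dependence is automatic for `k + 1` forms in `k` variables. -/
theorem not_algebraicIndependent_of_card_lt {σ τ : Type} [Fintype σ] [Fintype τ]
    (h : Fintype.card τ < Fintype.card σ) (g : σ → MvPolynomial τ K) :
    ¬ AlgebraicIndependent K g := by
  intro hg
  have h1 := hg.lift_cardinalMk_le_trdeg
  rw [MvPolynomial.trdeg_of_isDomain] at h1
  simp only [Cardinal.mk_fintype, Cardinal.lift_natCast, Nat.cast_le] at h1
  omega

theorem isMaximalPerazzo_matSubst [CharZero K] {g : Fin (k + 1) → MvPolynomial (Fin k) K}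
    {h : MvPolynomial (Fin k) K} (hg : ∀ i, (g i).IsHomogeneous 2) (hh : h.IsHomogeneous 3)
    (hgl : LinearIndependent K g) {i j : Fin (k + 1)} (hij : j ≠ i)
    (hgr : IsRelPrime (g i) (g j)) (A : GL (MaxVar k) K) :
    IsMaximalPerazzo k (matSubst A.1 (canonicalForm g h)) := by
  refine ⟨matSubst_isHomogeneous (canonicalForm_isHomogeneous hg hh) _, ?_, A⁻¹, g, h, hg, hh, hgl,
    not_algebraicIndependent_of_card_lt (by simp) g, ?_⟩
  · exact (MulEquiv.irreducible_iff (matSubstEquiv A)).mpr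
      (irreducible_canonicalForm hij (hgl.ne_zero i) hgr)
  · rw [linearSubst_eq_matSubst, matSubst_matSubst, ← Units.val_mul, mul_inv_cancel, Units.val_one,
      matSubst_one, canonicalForm]

theorem IsMaximalPerazzo.exists_canonicalCubics {f : MvPolynomial (MaxVar k) K}
    (hf : IsMaximalPerazzo k f) :
    ∃ v ∈ canonicalCubics K (Fin (k + 1)) (Fin k), ∃ A, f = matSubst A v := by
  obtain ⟨-, -, A, g, h, hg, hh, -, -, hfg⟩ := hf
  refine ⟨canonicalForm g h, mem_canonicalCubics.mpr ⟨canonicalForm_isHomogeneous hg hh,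
    pderiv_pderiv_canonicalForm g h⟩, (A⁻¹).1, ?_⟩
  rw [canonicalForm, ← hfg, linearSubst_eq_matSubst, matSubst_matSubst, ← Units.val_mul,
    mul_inv_cancel, Units.val_one, matSubst_one]

variable [CharZero K]

omit [CharZero K] in
theorem linearIndependent_monomial {τ α : Type*} {e : α → τ →₀ ℕ} (he : Function.Injective e) :
    LinearIndependent K fun a => (monomial (e a) (1 : K) : MvPolynomial τ K) :=
  (basisMonomials τ K).linearIndependent.comp e he

/-- The mixed derivative along two distinct variables kills all the squares `y_i²` but not `L²`. -/
theorem linearIndependent_specialQuadric (hk : 2 ≤ k) :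
    LinearIndependent K (specialQuadric K k) := by
  have hX : ∀ i : Fin k, (X i ^ 2 : MvPolynomial (Fin k) K) = monomial (Finsupp.single i 2) 1 :=
    fun i => X_pow_eq_monomial
  rw [specialQuadric, linearIndependent_finSnoc]
  constructor
  · simp only [hX]
    exact linearIndependent_monomial (Finsupp.single_left_injective two_ne_zero)
  · intro hmem
    let i₀ : Fin k := ⟨0, by omega⟩
    let i₁ : Fin k := ⟨1, by omega⟩
    have h01 : i₀ ≠ i₁ := by simp [i₀, i₁]
    let φ : MvPolynomial (Fin k) K →ₗ[K] MvPolynomial (Fin k) K :=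
      (pderiv (R := K) i₀).toLinearMap.comp (pderiv (R := K) i₁).toLinearMap
    have h1 : Submodule.span K (Set.range fun i : Fin k => (X i ^ 2 : MvPolynomial (Fin k) K)) ≤
        LinearMap.ker φ := by
      rw [Submodule.span_le]
      rintro _ ⟨i, rfl⟩
      rw [SetLike.mem_coe, LinearMap.mem_ker]
      change pderiv i₀ (pderiv i₁ (X i ^ 2)) = 0
      rw [pderiv_pow, pderiv_X, Pi.single_apply]
      split_ifs with h
      · rw [h, mul_one, Nat.cast_ofNat, ← map_ofNat (C (σ := Fin k) (R := K)) 2, pderiv_C_mul]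
        simp [pderiv_X, h01.symm]
      · simp
    have h2 : pderiv i₀ (pderiv i₁ ((∑ j : Fin k, X j : MvPolynomial (Fin k) K) ^ 2)) = 0 := h1 hmem
    have h3 : pderiv i₁ ((∑ j : Fin k, X j : MvPolynomial (Fin k) K) ^ 2) = C 2 * ∑ j, X j := by
      rw [pderiv_pow, map_ofNat]
      simp [pderiv_X, Pi.single_apply]
    rw [h3, pderiv_C_mul] at h2
    simp [pderiv_X, Pi.single_apply] at h2

omit [CharZero K] in
/-- Two of the squares among the quadrics of the special cubic have no linear syzygies. -/
theorem linearIndependent_specialQuadric_syzygies {i j : Fin k} (hij : i ≠ j) :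
    LinearIndependent K (Sum.elim (fun l => X l * specialQuadric K k i.castSucc)
      fun l => X l * specialQuadric K k j.castSucc) := by
  have h : Sum.elim (fun l => X l * specialQuadric K k i.castSucc)
      (fun l => X l * specialQuadric K k j.castSucc) = fun a : Fin k ⊕ Fin k =>
      (monomial (Sum.elim (fun l => Finsupp.single l 1 + Finsupp.single i 2)
        (fun l => Finsupp.single l 1 + Finsupp.single j 2) a) (1 : K)) := by
    funext a
    rcases a with l | l <;>
    · simp only [Sum.elim_inl, Sum.elim_inr, specialQuadric_castSucc, X_pow_eq_monomial]
      rw [X, monomial_mul, mul_one]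
  rw [h]
  refine linearIndependent_monomial ?_
  have h1 : ∀ l m : Fin k,
      (Finsupp.single l 1 + Finsupp.single i 2 : Fin k →₀ ℕ) ≠
        Finsupp.single m 1 + Finsupp.single j 2 := by
    intro l m h
    have hi := DFunLike.congr_fun h i
    have hj := DFunLike.congr_fun h j
    simp only [Finsupp.add_apply, Finsupp.single_apply, if_true, hij, hij.symm, if_false] at hi hj
    split_ifs at hi hj <;> omega
  rintro (l | l) (m | m) hlm
  · exact congrArg _ (Finsupp.single_left_injective one_ne_zero (add_right_cancel hlm))
  · exact absurd hlm (h1 l m)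
  · exact absurd hlm.symm (h1 m l)
  · exact congrArg _ (Finsupp.single_left_injective one_ne_zero (add_right_cancel hlm))

/-- Almost all members of a pencil of substituted cubics of canonical form through the special cubic
belong to the maximal family. -/
theorem exists_polynomial_isMaximalPerazzo (hk : 2 ≤ k) {v' : MvPolynomial (MaxVar k) K}
    (hv' : v' ∈ canonicalCubics K (Fin (k + 1)) (Fin k)) (A' : Matrix (MaxVar k) (MaxVar k) K) :
    ∃ D : Polynomial K, D ≠ 0 ∧ ∀ s : K, D.eval s ≠ 0 →
      IsMaximalPerazzo k (matSubst (1 + s • A') (specialCubic K k + s • v')) := by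
  let i₀ : Fin k := ⟨0, by omega⟩
  let i₁ : Fin k := ⟨1, by omega⟩
  have h01 : i₀ ≠ i₁ := by simp [i₀, i₁]
  have : Nonempty (Fin k) := ⟨i₀⟩
  obtain ⟨hv3, hvx⟩ := mem_canonicalCubics.mp hv'
  obtain ⟨g', h', hg', hh', rfl⟩ := exists_eq_canonicalForm hv3 hvx
  obtain ⟨D₁, hD₁, h₁⟩ := (linearIndependent_specialQuadric (K := K) hk).exists_polynomial_of_line g'
  -- Coprimality of the first two quadrics is controlled through the absence of linear syzygies,
  -- because linear independence is visibly open along the pencil.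
  obtain ⟨D₂, hD₂, h₂⟩ := (linearIndependent_specialQuadric_syzygies (K := K)
    h01).exists_polynomial_of_line
      (Sum.elim (fun l => X l * g' i₀.castSucc) fun l => X l * g' i₁.castSucc)
  let D₃ : Polynomial K := (1 + (Polynomial.X : Polynomial K) • A'.map Polynomial.C).det
  have hD₃ : ∀ s, D₃.eval s = (1 + s • A').det := by
    intro s
    rw [← Polynomial.coe_evalRingHom, RingHom.map_det]
    congr 1
    ext1 a b
    simp [Matrix.one_apply, apply_ite, mul_comm s]
  have hD₃0 : D₃ ≠ 0 := by
    intro h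
    have h1 := hD₃ 0
    rw [h] at h1
    simp at h1
  refine ⟨D₁ * D₂ * D₃, mul_ne_zero (mul_ne_zero hD₁ hD₂) hD₃0, fun s hs => ?_⟩
  simp only [Polynomial.eval_mul, mul_ne_zero_iff] at hs
  obtain ⟨⟨hs₁, hs₂⟩, hs₃⟩ := hs
  rw [hD₃] at hs₃
  have hsum : specialCubic K k + s • canonicalForm g' h' =
      canonicalForm (fun i => specialQuadric K k i + s • g' i) (s • h') := by
    rw [specialCubic_eq_canonicalForm]
    simp only [canonicalForm, map_add, map_smul, map_zero, add_zero, mul_add,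
      Finset.sum_add_distrib, smul_add, Finset.smul_sum, mul_smul_comm]
    ring
  have hg : ∀ i, (specialQuadric K k i + s • g' i).IsHomogeneous 2 := fun i => by
    rw [smul_eq_C_mul]
    exact (specialQuadric_isHomogeneous i).add ((hg' i).C_mul _)
  rw [hsum]
  refine isMaximalPerazzo_matSubst hg (by rw [smul_eq_C_mul]; exact hh'.C_mul _) (h₁ s hs₁)
    (i := i₀.castSucc) (j := i₁.castSucc)
    (fun h => h01 (Fin.castSucc_injective k h).symm)
    (isRelPrime_of_linearIndependent (hg _) (hg _) ?_)
    (Matrix.GeneralLinearGroup.mkOfDetNeZero (1 + s • A') hs₃)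
  have hsyz : Sum.elim (fun l => X l * (specialQuadric K k i₀.castSucc + s • g' i₀.castSucc))
      (fun l => X l * (specialQuadric K k i₁.castSucc + s • g' i₁.castSucc)) = fun a =>
      Sum.elim (fun l => X l * specialQuadric K k i₀.castSucc)
        (fun l => X l * specialQuadric K k i₁.castSucc) a +
      s • Sum.elim (fun l => X l * g' i₀.castSucc) (fun l => X l * g' i₁.castSucc) a := by
    funext a
    rcases a with l | l <;> simp [mul_add]
  rw [hsyz]
  exact h₂ s hs₂

end Family

/-! ### Coordinates on the space of cubics -/

section Coefficients

variable {ι : Type} [Fintype ι] [DecidableEq ι]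

/-- The coefficients of a cubic form. -/
noncomputable def cubicCoeffs {R : Type*} [CommSemiring R] (v : MvPolynomial ι R) (m : Sym ι 3) : R :=
  coeff (cubicExponent m) v

omit [Fintype ι] in
theorem cubicExponent_injective : Function.Injective (cubicExponent : Sym ι 3 → ι →₀ ℕ) :=
  fun _ _ h => Subtype.ext (Multiset.toFinsupp.injective h)

theorem exists_cubicExponent_eq {d : ι →₀ ℕ} (hd : d.degree = 3) :
    ∃ m : Sym ι 3, cubicExponent m = d :=
  ⟨⟨Finsupp.toMultiset d, by
    rw [Finsupp.card_toMultiset, ← hd, Finsupp.degree_eq_sum, Finsupp.sum_fintype _ _ fun _ => rfl]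
    rfl⟩, Finsupp.toMultiset_toFinsupp d⟩

omit [Fintype ι] in
theorem degree_cubicExponent (m : Sym ι 3) : (cubicExponent m).degree = 3 := by
  have h := Multiset.toFinsupp_sum_eq (m : Multiset ι)
  exact h.trans m.2

theorem sum_monomial_cubicCoeffs {R : Type*} [CommSemiring R] {v : MvPolynomial ι R}
    (hv : v.IsHomogeneous 3) : ∑ m, monomial (cubicExponent m) (cubicCoeffs v m) = v := by
  ext d
  simp only [coeff_sum, coeff_monomial]
  by_cases hd : d.degree = 3
  · obtain ⟨m, rfl⟩ := exists_cubicExponent_eq hd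
    rw [Finset.sum_eq_single m (fun m' _ hm' => if_neg fun h => hm' (cubicExponent_injective h))
      fun h => absurd (Finset.mem_univ m) h, if_pos rfl, cubicCoeffs]
  · rw [Finset.sum_eq_zero fun m _ => if_neg fun (h : cubicExponent m = d) =>
      hd (h ▸ degree_cubicExponent m)]
    by_contra hne
    exact hd (by
      have := hv (Ne.symm hne)
      rw [Finsupp.degree_eq_weight_one (R := ℕ)]
      exact this)

theorem sum_monomial_isHomogeneous {R : Type*} [CommSemiring R] (c : Sym ι 3 → R) :
    (∑ m, monomial (cubicExponent m) (c m)).IsHomogeneous 3 :=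
  IsHomogeneous.sum _ _ _ fun m _ => isHomogeneous_monomial _ (degree_cubicExponent m)

theorem cubicCoeffs_sum_monomial {R : Type*} [CommSemiring R] (c : Sym ι 3 → R) :
    cubicCoeffs (∑ m, monomial (cubicExponent m) (c m)) = c := by
  funext m
  rw [cubicCoeffs, coeff_sum, Finset.sum_eq_single m (fun m' _ hm' => ?_)
    fun h => absurd (Finset.mem_univ m) h, coeff_monomial, if_pos rfl]
  rw [coeff_monomial, if_neg fun h => hm' (cubicExponent_injective h)]

theorem map_genericCubic {K : Type u} [Field K] {R : Type*} [CommRing R]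
    (φ : CubicCoordRing ι K →+* R) :
    map φ (genericCubic ι K) = ∑ m, monomial (cubicExponent m) (φ (X m)) := by
  simp [genericCubic, map_monomial]

theorem map_hessianDet {ι R S : Type*} [Fintype ι] [DecidableEq ι] [CommRing R] [CommRing S]
    (φ : R →+* S) (f : MvPolynomial ι R) : map φ (hessianDet f) = hessianDet (map φ f) := by
  rw [hessianDet, RingHom.map_det, hessianDet]
  congr 1
  ext1 i j
  simp [pderiv_map]

/-- An `R`-valued point of the Hessian ideal is a cubic over `R` with vanishing Hessian. It is used
for `R = K` and for the dual numbers. -/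
theorem hessianIdeal_le_ker_iff {K : Type u} [Field K] {R : Type*} [CommRing R]
    (φ : CubicCoordRing ι K →+* R) : (∀ F ∈ hessianIdeal ι K, φ F = 0) ↔
      hessianDet (∑ m, monomial (cubicExponent m) (φ (X m))) = 0 := by
  have h : hessianIdeal ι K ≤ RingHom.ker φ ↔ _ := Ideal.span_le
  rw [← map_genericCubic, ← map_hessianDet]
  refine h.trans ⟨fun h1 => ?_, fun h1 => ?_⟩
  · ext d
    rw [coeff_map, coeff_zero]
    exact h1 ⟨d, rfl⟩
  · rintro _ ⟨d, rfl⟩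
    change φ _ = 0
    rw [← coeff_map, h1, coeff_zero]

end Coefficients

/-! ### The cone over the maximal family and its ideal -/

section Cone

variable (K : Type u) [Field K] (k : ℕ)

/-- The cone in the space of cubics that consists of all linear substitutions, not necessarily
invertible, of cubics of canonical form. -/
def perazzoCone : Set (Sym (MaxVar k) 3 → K) :=
  {c | ∃ v ∈ canonicalCubics K (Fin (k + 1)) (Fin k), ∃ A, c = cubicCoeffs (matSubst A v)}

/-- The coordinates of a pencil. -/
noncomputable def pencilCoeffs {K : Type*} [Field K] {ι : Type} [Fintype ι] [DecidableEq ι]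
    (v v' : MvPolynomial ι K) (A A' : Matrix ι ι K) : Sym ι 3 → Polynomial K :=
  cubicCoeffs (pencil v v' A A')

variable {K k}

theorem eval_pencilCoeffs {ι : Type} [Fintype ι] [DecidableEq ι]
    (v v' : MvPolynomial ι K) (A A' : Matrix ι ι K) (s : K) :
    (fun m => (pencilCoeffs v v' A A' m).eval s) =
      cubicCoeffs (matSubst (A + s • A') (v + s • v')) := by
  funext m
  rw [cubicCoeffs, ← map_eval_pencil, coeff_map]
  rfl

theorem eval_aeval_pencilCoeffs {ι : Type} [Fintype ι] [DecidableEq ι]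
    (v v' : MvPolynomial ι K) (A A' : Matrix ι ι K) (s : K) (F : CubicCoordRing ι K) :
    (aeval (pencilCoeffs v v' A A') F).eval s =
      aeval (cubicCoeffs (matSubst (A + s • A') (v + s • v'))) F := by
  rw [← eval_pencilCoeffs]
  have h : (Polynomial.aeval s).comp (aeval (pencilCoeffs v v' A A')) =
      aeval fun m => (pencilCoeffs v v' A A' m).eval s := by
    refine algHom_ext fun m => ?_
    simp [Polynomial.coe_aeval_eq_eval]
  exact congrArg (fun φ => φ F) h

theorem pencil_mem_perazzoCone {v v' : MvPolynomial (MaxVar k) K}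
    (hv : v ∈ canonicalCubics K (Fin (k + 1)) (Fin k))
    (hv' : v' ∈ canonicalCubics K (Fin (k + 1)) (Fin k)) (A A' : Matrix (MaxVar k) (MaxVar k) K)
    (s : K) : cubicCoeffs (matSubst (A + s • A') (v + s • v')) ∈ perazzoCone K k :=
  ⟨_, add_mem hv (Submodule.smul_mem _ s hv'), _, rfl⟩

theorem aeval_pencilCoeffs_eq_zero [Infinite K] {v v' : MvPolynomial (MaxVar k) K}
    (hv : v ∈ canonicalCubics K (Fin (k + 1)) (Fin k))
    (hv' : v' ∈ canonicalCubics K (Fin (k + 1)) (Fin k)) (A A' : Matrix (MaxVar k) (MaxVar k) K)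
    {F : CubicCoordRing (MaxVar k) K} (hF : ∀ c ∈ perazzoCone K k, aeval c F = 0) :
    aeval (pencilCoeffs v v' A A') F = 0 :=
  Polynomial.funext fun s => by
    rw [eval_aeval_pencilCoeffs, hF _ (pencil_mem_perazzoCone hv hv' A A' s), Polynomial.eval_zero]

theorem smul_mem_perazzoCone {c : Sym (MaxVar k) 3 → K} (hc : c ∈ perazzoCone K k) (t : K) :
    (fun m => t * c m) ∈ perazzoCone K k := by
  obtain ⟨v, hv, A, rfl⟩ := hc
  refine ⟨t • v, Submodule.smul_mem _ t hv, A, funext fun m => ?_⟩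
  rw [map_smul, cubicCoeffs, cubicCoeffs, coeff_smul, smul_eq_mul]

theorem specialCubic_mem_perazzoCone : cubicCoeffs (specialCubic K k) ∈ perazzoCone K k :=
  ⟨_, specialCubic_mem_canonicalCubics, 1, by rw [matSubst_one]⟩

theorem IsMaximalPerazzo.cubicCoeffs_mem [CharZero K] {f : MvPolynomial (MaxVar k) K}
    (hf : IsMaximalPerazzo k f) : cubicCoeffs f ∈ perazzoCone K k := by
  obtain ⟨v, hv, A, rfl⟩ := hf.exists_canonicalCubics
  exact ⟨v, hv, A, rfl⟩

theorem aeval_eq_zero_of_mem_hessianIdeal {c : Sym (MaxVar k) 3 → K} (hc : c ∈ perazzoCone K k)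
    {F : CubicCoordRing (MaxVar k) K} (hF : F ∈ hessianIdeal (MaxVar k) K) : aeval c F = 0 := by
  obtain ⟨v, hv, A, rfl⟩ := hc
  refine (hessianIdeal_le_ker_iff (aeval (cubicCoeffs (matSubst A v))).toRingHom).mpr ?_ F hF
  have h : ∀ m, (aeval (cubicCoeffs (matSubst A v))).toRingHom (X m : CubicCoordRing _ K) =
      cubicCoeffs (matSubst A v) m := fun m => aeval_X _ m
  simp only [h]
  rw [sum_monomial_cubicCoeffs (matSubst_isHomogeneous (mem_canonicalCubics.mp hv).1 A),
    hessianDet_matSubst, hessianDet_eq_zero_of_mem_canonicalCubics (by simp) hv, map_zero, mul_zero]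

/-- A form that vanishes on the maximal family vanishes on the whole cone. -/
theorem aeval_eq_zero_of_forall_isMaximalPerazzo [CharZero K] (hk : 2 ≤ k)
    {F : CubicCoordRing (MaxVar k) K}
    (hF : ∀ f : MvPolynomial (MaxVar k) K, IsMaximalPerazzo k f → aeval (cubicCoeffs f) F = 0)
    {c : Sym (MaxVar k) 3 → K} (hc : c ∈ perazzoCone K k) : aeval c F = 0 := by
  obtain ⟨v, hv, A, rfl⟩ := hc
  -- The pencil runs from the special cubic at `s = 0` to the given point of the cone at `s = 1`.
  -- Its members belong to the maximal family wherever `D` does not vanish, so `F` vanishes on the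
  -- whole pencil.
  have hv' := sub_mem hv (specialCubic_mem_canonicalCubics (K := K) (k := k))
  obtain ⟨D, hD, hDs⟩ := exists_polynomial_isMaximalPerazzo hk hv' (A - 1)
  have h1 : D * aeval (pencilCoeffs (specialCubic K k) (v - specialCubic K k) 1 (A - 1)) F = 0 := by
    refine Polynomial.funext fun s => ?_
    rw [Polynomial.eval_mul, eval_aeval_pencilCoeffs, Polynomial.eval_zero]
    by_cases hs : D.eval s = 0
    · rw [hs, zero_mul]
    · rw [hF _ (hDs s hs), mul_zero]
  have h2 := eval_aeval_pencilCoeffs (specialCubic K k) (v - specialCubic K k) 1 (A - 1) 1 F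
  rw [(mul_eq_zero.mp h1).resolve_left hD, Polynomial.eval_zero, one_smul, one_smul,
    add_sub_cancel, add_sub_cancel] at h2
  exact h2.symm

/-- The ideal of a cone over an infinite field is homogeneous. -/
theorem vanishingIdeal_isHomogeneous {σ K : Type*} [Field K] [Infinite K] {C : Set (σ → K)}
    (hC : ∀ c ∈ C, ∀ t : K, (fun m => t * c m) ∈ C) :
    (vanishingIdeal K C).IsHomogeneous (homogeneousSubmodule σ K) := by
  classical
  intro i F hF
  rw [mem_vanishingIdeal_iff] at hF ⊢
  intro c hc
  have h1 : ∀ t : K, ∑ j ∈ Finset.range (F.totalDegree + 1),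
      t ^ j * aeval c (homogeneousComponent j F) = 0 := by
    intro t
    rw [← hF _ (hC c hc t)]
    conv_rhs => rw [← sum_homogeneousComponent F, map_sum]
    exact Finset.sum_congr rfl fun j _ =>
      (aeval_mul_of_isHomogeneous (homogeneousComponent_isHomogeneous j F) t c).symm
  -- The values on the line through `c` form a polynomial in `t` whose coefficients are the values
  -- of the homogeneous components; vanishing for all `t` kills each of them.
  have h2 : ∑ j ∈ Finset.range (F.totalDegree + 1),
      Polynomial.monomial j (aeval c (homogeneousComponent j F)) = 0 := by
    refine Polynomial.funext fun t => ?_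
    rw [Polynomial.eval_finsetSum, Polynomial.eval_zero, ← h1 t]
    exact Finset.sum_congr rfl fun j _ => by rw [Polynomial.eval_monomial, mul_comm]
  have h3 := congrArg (fun p => Polynomial.coeff p i) h2
  simp only [Polynomial.finsetSum_coeff, Polynomial.coeff_monomial, Finset.sum_ite_eq',
    Finset.mem_range, Polynomial.coeff_zero] at h3
  have h4 : (DirectSum.decompose (homogeneousSubmodule σ K) F i : MvPolynomial σ K) =
      homogeneousComponent i F := decomposition.decompose'_apply F i
  rw [h4]
  split_ifs at h3 with h
  · exact h3
  · rw [homogeneousComponent_eq_zero i F (by omega), map_zero]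

variable (K k) in
/-- The homogeneous ideal of the cone over the maximal family. -/
noncomputable def perazzoIdeal [Infinite K] :
    HomogeneousIdeal (homogeneousSubmodule (Sym (MaxVar k) 3) K) where
  toSubmodule := vanishingIdeal K (perazzoCone K k)
  is_homogeneous' := vanishingIdeal_isHomogeneous fun _ hc t => smul_mem_perazzoCone hc t

variable [Infinite K]

theorem mem_perazzoIdeal {F : CubicCoordRing (MaxVar k) K} :
    F ∈ (perazzoIdeal K k).toIdeal ↔ ∀ c ∈ perazzoCone K k, aeval c F = 0 :=
  mem_vanishingIdeal_iff

/-- Any two points of the cone are joined by a pencil inside it. If neither `F` nor `G` vanished on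
the cone, then along a pencil joining a point where `F ≠ 0` to one where `G ≠ 0` the product would
be a nonzero polynomial in `s`. -/
instance perazzoIdeal_isPrime : (perazzoIdeal K k).toIdeal.IsPrime := by
  refine ⟨fun h => ?_, fun {F G} hFG => ?_⟩
  · have h1 := mem_perazzoIdeal.mp ((Ideal.eq_top_iff_one _).mp h) _ specialCubic_mem_perazzoCone
    rw [map_one] at h1
    exact one_ne_zero h1
  · by_contra! hne
    simp only [mem_perazzoIdeal, not_forall, exists_prop] at hne
    obtain ⟨⟨_, ⟨v, hv, A, rfl⟩, hF⟩, _, ⟨v', hv', A', rfl⟩, hG⟩ := hne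
    have h1 := aeval_pencilCoeffs_eq_zero hv (sub_mem hv' hv) A (A' - A) (mem_perazzoIdeal.mp hFG)
    rw [map_mul] at h1
    rcases mul_eq_zero.mp h1 with h2 | h2
    · have h3 := eval_aeval_pencilCoeffs v (v' - v) A (A' - A) 0 F
      rw [h2, Polynomial.eval_zero, zero_smul, zero_smul, add_zero, add_zero] at h3
      exact hF h3.symm
    · have h3 := eval_aeval_pencilCoeffs v (v' - v) A (A' - A) 1 G
      rw [h2, Polynomial.eval_zero, one_smul, one_smul, add_sub_cancel, add_sub_cancel] at h3
      exact hG h3.symm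

theorem hessianIdeal_le_perazzoIdeal :
    hessianIdeal (MaxVar k) K ≤ (perazzoIdeal K k).toIdeal := fun _ hF =>
  mem_perazzoIdeal.mpr fun _ hc => aeval_eq_zero_of_mem_hessianIdeal hc hF

end Cone

/-! ### Arcs in the cone through the special cubic -/

section LocalStructure

variable {K : Type u} [Field K] [CharZero K] {k : ℕ}

/-- The power series arcs in the cone through the special cubic. -/
def perazzoArcs (K : Type u) [Field K] (k : ℕ) : Set (Sym (MaxVar k) 3 → PowerSeries K) :=
  {c | ∃ w ∈ canonicalCubics K (Fin (k + 1)) (Fin k), ∃ A',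
    c = fun m => (pencilCoeffs (specialCubic K k) w 1 A' m : PowerSeries K)}

omit [CharZero K] in
theorem aeval_coe_powerSeries {σ : Type*} (c : σ → Polynomial K) (F : MvPolynomial σ K) :
    aeval (fun m => (c m : PowerSeries K)) F = ((aeval c F : Polynomial K) : PowerSeries K) := by
  have h : aeval (fun m => (c m : PowerSeries K)) =
      (Polynomial.coeToPowerSeries.algHom (R := K) (A := K)).comp (aeval c) := by
    refine algHom_ext fun m => ?_
    simp [Polynomial.coeToPowerSeries.algHom_apply]
  rw [h, AlgHom.comp_apply, Polynomial.coeToPowerSeries.algHom_apply]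
  simp

omit [CharZero K] in
theorem constantCoeff_of_mem_perazzoArcs {c : Sym (MaxVar k) 3 → PowerSeries K}
    (hc : c ∈ perazzoArcs K k) (m : Sym (MaxVar k) 3) :
    PowerSeries.constantCoeff (c m) = cubicCoeffs (specialCubic K k) m := by
  obtain ⟨w, hw, A', rfl⟩ := hc
  rw [Polynomial.constantCoeff_coe, Polynomial.coeff_zero_eq_eval_zero,
    congrFun (eval_pencilCoeffs (specialCubic K k) w 1 A' 0) m, zero_smul, zero_smul, add_zero,
    add_zero, matSubst_one]

theorem aeval_eq_zero_of_mem_perazzoArcs {c : Sym (MaxVar k) 3 → PowerSeries K}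
    (hc : c ∈ perazzoArcs K k) {F : CubicCoordRing (MaxVar k) K}
    (hF : ∀ c ∈ perazzoCone K k, aeval c F = 0) : aeval c F = 0 := by
  obtain ⟨w, hw, A', rfl⟩ := hc
  rw [aeval_coe_powerSeries, aeval_pencilCoeffs_eq_zero specialCubic_mem_canonicalCubics hw 1 A' hF,
    Polynomial.coe_zero]

/-- The hypothesis on `τ` means that the cubic `f + ε τ` over the dual numbers has vanishing
Hessian. The pencil with velocity `τ`, expanded as a power series in its parameter, is then the
required arc. -/
theorem exists_perazzoArc (hk : 2 ≤ k) (τ : Sym (MaxVar k) 3 → K)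
    (hτ : ∀ d, ∀ F ∈ hessianIdeal (MaxVar k) K, F.IsHomogeneous d →
      aeval (fun s => (TrivSqZeroExt.inl (cubicCoeffs (specialCubic K k) s) +
        TrivSqZeroExt.inr (τ s) : DualNumber K)) F = 0) :
    ∃ c ∈ perazzoArcs K k, ∀ s, PowerSeries.coeff 1 (c s) = τ s := by
  set φ : CubicCoordRing (MaxVar k) K →ₐ[K] DualNumber K :=
    aeval (fun s => (TrivSqZeroExt.inl (cubicCoeffs (specialCubic K k) s) +
        TrivSqZeroExt.inr (τ s) : DualNumber K)) with hφ
  have h1 : hessianIdeal (MaxVar k) K ≤ RingHom.ker φ.toRingHom := by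
    refine Ideal.span_le.mpr ?_
    rintro _ ⟨d, rfl⟩
    exact hτ _ _ (Ideal.subset_span ⟨d, rfl⟩) (coeff_hessianDet_isHomogeneous _ _ d)
  have h2 := (hessianIdeal_le_ker_iff φ.toRingHom).mp fun F hF => h1 hF
  set τ' : MvPolynomial (MaxVar k) K := ∑ m, monomial (cubicExponent m) (τ m) with hτ'
  have h3 : ∑ m, monomial (cubicExponent m) (φ.toRingHom (X m)) =
      map (algebraMap K (DualNumber K)) (specialCubic K k) +
        C DualNumber.eps * map (algebraMap K (DualNumber K)) τ' := by
    have h4 : ∀ m, φ.toRingHom (X m) = algebraMap K (DualNumber K)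
        (cubicCoeffs (specialCubic K k) m) + DualNumber.eps * algebraMap K (DualNumber K) (τ m) := by
      intro m
      change φ (X m) = _
      rw [hφ, aeval_X, TrivSqZeroExt.algebraMap_eq_inl]
      refine TrivSqZeroExt.ext ?_ ?_ <;> simp
    conv_rhs => rw [← sum_monomial_cubicCoeffs (specialCubic_isHomogeneous (K := K) (k := k))]
    simp only [h4, hτ', map_sum, map_monomial, map_add, Finset.sum_add_distrib, Finset.mul_sum,
      C_mul_monomial]
  rw [h3] at h2
  obtain ⟨w, hw, A', r, hr⟩ := exists_pencil_of_hessianDet_dual hk (sum_monomial_isHomogeneous τ) h2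
  refine ⟨_, ⟨w, hw, A', rfl⟩, fun s => ?_⟩
  rw [Polynomial.coeff_coe, pencilCoeffs, cubicCoeffs, hr, coeff_add, coeff_add, coeff_C_mul,
    coeff_C_mul, coeff_map, coeff_map, Polynomial.coeff_add, Polynomial.coeff_add,
    Polynomial.coeff_C, if_neg one_ne_zero, Polynomial.coeff_X_mul, Polynomial.coeff_C_zero,
    Polynomial.coeff_X_pow_mul', if_neg (by omega), zero_add, add_zero]
  exact congrFun (cubicCoeffs_sum_monomial τ) s

end LocalStructure

/-! ### Points and components of a closed subscheme of `Proj` -/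

section QuotientPoints

variable {K A : Type u} [Field K] [CommRing A] [Algebra K A]
  {𝒜 : ℕ → Submodule K A} [GradedAlgebra 𝒜] (J : HomogeneousIdeal 𝒜)

theorem coe_decompose_quotientGrading (a : A) (n : ℕ) :
    (DirectSum.decompose (quotientGrading 𝒜 J) (Ideal.Quotient.mk J.toIdeal a) n : A ⧸ J.toIdeal) =
      Ideal.Quotient.mk J.toIdeal (DirectSum.decompose 𝒜 a n) := by
  classical
  conv_lhs => rw [← DirectSum.sum_support_decompose 𝒜 a, map_sum, DirectSum.decompose_sum,
    DirectSum.sum_apply, AddSubmonoidClass.coe_finsetSum]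
  have h : ∀ i, (DirectSum.decompose (quotientGrading 𝒜 J)
      (Ideal.Quotient.mk J.toIdeal (DirectSum.decompose 𝒜 a i)) n : A ⧸ J.toIdeal) =
      if i = n then Ideal.Quotient.mk J.toIdeal (DirectSum.decompose 𝒜 a n) else 0 := by
    intro i
    split_ifs with hi
    · subst hi
      exact DirectSum.decompose_of_mem_same _ (quotientGrading_mk_mem 𝒜 J (SetLike.coe_mem _))
    · exact DirectSum.decompose_of_mem_ne _ (quotientGrading_mk_mem 𝒜 J (SetLike.coe_mem _)) hi
  simp only [h, Finset.sum_ite_eq']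
  split_ifs with hn
  · rfl
  · rw [DFinsupp.notMem_support_iff.mp hn]
    simp

theorem le_of_forall_homogeneous {I I' : Ideal A} (hI : I.IsHomogeneous 𝒜)
    (h : ∀ (n : ℕ), ∀ a ∈ 𝒜 n, a ∈ I → a ∈ I') : I ≤ I' := by
  classical
  intro a ha
  rw [← DirectSum.sum_support_decompose 𝒜 a]
  exact sum_mem fun n _ => h n _ (SetLike.coe_mem _) (hI n ha)

/-- The point of `Proj (A ⧸ J)` defined by a point of `Proj A` in `V(J)`. -/
def quotientPoint (x : ProjectiveSpectrum 𝒜) (hx : J ≤ x.asHomogeneousIdeal) :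
    ProjectiveSpectrum (quotientGrading 𝒜 J) where
  asHomogeneousIdeal :=
    { toSubmodule := x.asHomogeneousIdeal.toIdeal.map (Ideal.Quotient.mk J.toIdeal)
      is_homogeneous' := by
        intro n b hb
        obtain ⟨a, ha, rfl⟩ :=
          (Ideal.mem_map_iff_of_surjective _ Ideal.Quotient.mk_surjective).mp hb
        rw [coe_decompose_quotientGrading]
        exact Ideal.mem_map_of_mem _ (x.asHomogeneousIdeal.isHomogeneous n ha) }
  isPrime := Ideal.map_isPrime_of_surjective Ideal.Quotient.mk_surjective
    (by rw [Ideal.mk_ker]; exact hx)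
  not_irrelevant_le h := x.not_irrelevant_le fun a ha => by
    refine (Ideal.mem_quotient_iff_mem (show J.toIdeal ≤ x.asHomogeneousIdeal.toIdeal from hx)).mp
      (h ?_)
    rw [HomogeneousIdeal.mem_irrelevant_iff, GradedRing.proj_apply] at ha ⊢
    rw [coe_decompose_quotientGrading, ha, map_zero]

theorem mk_mem_quotientPoint {x : ProjectiveSpectrum 𝒜} (hx : J ≤ x.asHomogeneousIdeal) {a : A} :
    Ideal.Quotient.mk J.toIdeal a ∈ (quotientPoint J x hx).asHomogeneousIdeal.toIdeal ↔
      a ∈ x.asHomogeneousIdeal.toIdeal :=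
  Ideal.mem_quotient_iff_mem (show J.toIdeal ≤ x.asHomogeneousIdeal.toIdeal from hx)

theorem projQuotientι_quotientPoint (x : ProjectiveSpectrum 𝒜) (hx : J ≤ x.asHomogeneousIdeal) :
    projQuotientι 𝒜 J (quotientPoint J x hx : ProjectiveSpectrum (quotientGrading 𝒜 J)) = x := by
  apply ProjectiveSpectrum.ext
  apply HomogeneousIdeal.toIdeal_injective
  ext a
  exact mk_mem_quotientPoint J hx

theorem ProjectiveSpectrum.closure_singleton (x : ProjectiveSpectrum 𝒜) :
    closure {x} = {y | x.asHomogeneousIdeal ≤ y.asHomogeneousIdeal} := by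
  ext y
  rw [← ProjectiveSpectrum.le_iff_mem_closure]
  rfl

theorem preimage_closure_singleton (x : ProjectiveSpectrum 𝒜) (hx : J ≤ x.asHomogeneousIdeal) :
    (projQuotientι 𝒜 J) ⁻¹' (closure {x} : Set (ProjectiveSpectrum 𝒜)) =
      (closure {quotientPoint J x hx} : Set (ProjectiveSpectrum (quotientGrading 𝒜 J))) := by
  rw [ProjectiveSpectrum.closure_singleton, ProjectiveSpectrum.closure_singleton]
  ext y
  exact (Ideal.map_le_iff_le_comap (f := Ideal.Quotient.mk J.toIdeal)
    (I := x.asHomogeneousIdeal.toIdeal)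
    (K := (ProjectiveSpectrum.asHomogeneousIdeal (𝒜 := quotientGrading 𝒜 J) y).toIdeal)).symm

/-- If the quotient by `J` has, locally at some point, no more equations than a homogeneous prime
ideal, then this prime defines an irreducible component of `V(J)`. -/
theorem closure_quotientPoint_mem_irreducibleComponents (x : ProjectiveSpectrum 𝒜)
    (hx : J ≤ x.asHomogeneousIdeal)
    (h : ∀ (n : ℕ), ∀ a ∈ 𝒜 n, a ∈ x.asHomogeneousIdeal →
      ∃ b, b ∉ x.asHomogeneousIdeal ∧ b * a ∈ J) :
    (closure {quotientPoint J x hx} : Set (projQuotient 𝒜 J)) ∈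
      irreducibleComponents (projQuotient 𝒜 J) := by
  refine ⟨isIrreducible_singleton.closure, fun T hT hle => ?_⟩
  obtain ⟨t, ht⟩ := QuasiSober.sober hT.closure isClosed_closure
  have h0 : (quotientPoint J x hx : projQuotient 𝒜 J) ∈ closure {t} := by
    rw [ht]
    exact subset_closure (hle (subset_closure rfl))
  have h1 : ProjectiveSpectrum.asHomogeneousIdeal (𝒜 := quotientGrading 𝒜 J) t ≤
      (quotientPoint J x hx).asHomogeneousIdeal :=
    (ProjectiveSpectrum.le_iff_mem_closure (𝒜 := quotientGrading 𝒜 J) t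
      (quotientPoint J x hx)).mpr h0
  -- Let `t` be a generization. A form `a` in the ideal of `x` satisfies `b * a = 0` modulo `J` with
  -- `b` outside that ideal. So `b` is outside the smaller prime `t`, which must then contain `a`.
  have h2 : quotientPoint J x hx = t := by
    apply ProjectiveSpectrum.ext
    refine le_antisymm ?_ h1
    refine le_of_forall_homogeneous (𝒜 := quotientGrading 𝒜 J) (HomogeneousIdeal.isHomogeneous _) ?_
    rintro n _ ⟨a, ha, rfl⟩ hmem
    obtain ⟨b, hb, hba⟩ := h n a ha ((mk_mem_quotientPoint J hx).mp hmem)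
    have h3 : Ideal.Quotient.mk J.toIdeal b * Ideal.Quotient.mk J.toIdeal a = 0 := by
      rw [← map_mul]
      exact Ideal.Quotient.eq_zero_iff_mem.mpr hba
    have h4 : Ideal.Quotient.mk J.toIdeal b * Ideal.Quotient.mk J.toIdeal a ∈
        (ProjectiveSpectrum.asHomogeneousIdeal (𝒜 := quotientGrading 𝒜 J) t).toIdeal := by
      rw [h3]; exact zero_mem _
    rcases (ProjectiveSpectrum.isPrime (𝒜 := quotientGrading 𝒜 J) t).mem_or_mem h4 with h5 | h5
    · exact absurd ((mk_mem_quotientPoint J hx).mp (h1 h5)) hb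
    · exact h5
  rw [h2]
  exact subset_closure.trans ht.symm.subset

-- The local ring is a field: a fraction with numerator in the ideal of `x` is killed by an
-- admissible denominator, and any other fraction is invertible.
open HomogeneousLocalization in
theorem isReduced_stalk_quotientPoint (x : ProjectiveSpectrum 𝒜)
    (hx : J ≤ x.asHomogeneousIdeal)
    (h : ∀ (n : ℕ), ∀ a ∈ 𝒜 n, a ∈ x.asHomogeneousIdeal →
      ∃ (m : ℕ), ∃ b ∈ 𝒜 m, b ∉ x.asHomogeneousIdeal ∧ b * a ∈ J) :
    _root_.IsReduced ((projQuotient 𝒜 J).presheaf.stalk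
      (quotientPoint J x hx : ProjectiveSpectrum (quotientGrading 𝒜 J))) := by
  set y := quotientPoint J x hx with hy
  have hred : _root_.IsReduced (HomogeneousLocalization.AtPrime (quotientGrading 𝒜 J)
      y.asHomogeneousIdeal.toIdeal) := by
    refine ⟨fun a ha => ?_⟩
    obtain ⟨⟨d, ⟨_, a, ha', rfl⟩, ⟨_, b, hb', rfl⟩, hb⟩, rfl⟩ := mk_surjective a
    by_cases hax : a ∈ x.asHomogeneousIdeal
    · obtain ⟨m, c, hc, hcx, hca⟩ := h d a ha' hax
      rw [HomogeneousLocalization.AtPrime.mk_eq_zero_iff]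
      refine ⟨m, _, quotientGrading_mk_mem 𝒜 J hc, fun h1 => hcx ((mk_mem_quotientPoint J hx).mp h1),
        ?_⟩
      exact (map_mul (Ideal.Quotient.mk J.toIdeal) c a).symm.trans
        (Ideal.Quotient.eq_zero_iff_mem.mpr hca)
    · exfalso
      let c : NumDenSameDeg (quotientGrading 𝒜 J) y.asHomogeneousIdeal.toIdeal.primeCompl :=
        ⟨d, ⟨_, quotientGrading_mk_mem 𝒜 J ha'⟩, ⟨_, quotientGrading_mk_mem 𝒜 J hb'⟩, hb⟩
      let c' : NumDenSameDeg (quotientGrading 𝒜 J) y.asHomogeneousIdeal.toIdeal.primeCompl :=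
        ⟨d, ⟨_, quotientGrading_mk_mem 𝒜 J hb'⟩, ⟨_, quotientGrading_mk_mem 𝒜 J ha'⟩,
          fun h1 => hax ((mk_mem_quotientPoint J hx).mp h1)⟩
      have h1 : (HomogeneousLocalization.mk c * HomogeneousLocalization.mk c' :
          HomogeneousLocalization.AtPrime (quotientGrading 𝒜 J) y.asHomogeneousIdeal.toIdeal) = 1 := by
        apply val_injective
        simp only [val_mul, val_mk, Localization.mk_mul, val_one]
        rw [← Localization.mk_one, Localization.mk_eq_mk_iff, Localization.r_iff_exists]
        refine ⟨1, ?_⟩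
        simp only [Submonoid.coe_one, one_mul, Submonoid.coe_mul, mul_one]
        exact mul_comm _ _
      have h2 : IsUnit (HomogeneousLocalization.mk c :
          HomogeneousLocalization.AtPrime (quotientGrading 𝒜 J) y.asHomogeneousIdeal.toIdeal) :=
        .of_mul_eq_one _ h1
      exact h2.not_isNilpotent ha
  exact isReduced_of_injective (Proj.stalkIso' (quotientGrading 𝒜 J) y).toRingHom
    (Proj.stalkIso' (quotientGrading 𝒜 J) y).injective

end QuotientPoints

/-! ### Closed points of projective space -/

section Line

variable {σ : Type} {K : Type u} [Field K] [Infinite K] (f : σ → K)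

/-- The homogeneous ideal of the line spanned by `f`. -/
noncomputable def lineIdeal : HomogeneousIdeal (homogeneousSubmodule σ K) where
  toSubmodule := vanishingIdeal K (Set.range fun t : K => fun m => t * f m)
  is_homogeneous' := vanishingIdeal_isHomogeneous (by
    rintro _ ⟨s, rfl⟩ t
    exact ⟨t * s, funext fun m => mul_assoc _ _ _⟩)

variable {f}

theorem mem_lineIdeal {F : MvPolynomial σ K} :
    F ∈ (lineIdeal f).toIdeal ↔ ∀ t : K, aeval (fun m => t * f m) F = 0 :=
  mem_vanishingIdeal_iff.trans Set.forall_mem_range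

theorem mem_lineIdeal_iff_eval {F : MvPolynomial σ K} {d : ℕ} (hF : F.IsHomogeneous d) :
    F ∈ (lineIdeal f).toIdeal ↔ eval f F = 0 := by
  rw [mem_lineIdeal, ← aeval_eq_eval]
  constructor
  · intro h
    simpa using h 1
  · intro h t
    rw [aeval_mul_of_isHomogeneous hF]
    exact mul_eq_zero_of_right _ h

/-- The ideal is the kernel of the map `X m ↦ f m * T` to a polynomial ring in one variable, which
is a domain. -/
instance lineIdeal_isPrime : (lineIdeal f).toIdeal.IsPrime := by
  have key : ∀ (F : MvPolynomial σ K) (t : K),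
      (aeval (fun m => Polynomial.X * Polynomial.C (f m)) F : Polynomial K).eval t =
        aeval (fun m => t * f m) F := by
    intro F t
    have h : (Polynomial.aeval t).comp (aeval (fun m => Polynomial.X * Polynomial.C (f m))) =
        aeval (R := K) fun m => t * f m := by
      refine algHom_ext fun m => ?_
      rw [AlgHom.comp_apply, aeval_X, aeval_X, Polynomial.coe_aeval_eq_eval, Polynomial.eval_mul,
        Polynomial.eval_X, Polynomial.eval_C]
    exact congrArg (fun φ => φ F) h
  have key' : ∀ F : MvPolynomial σ K, F ∈ (lineIdeal f).toIdeal ↔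
      (aeval (fun m => Polynomial.X * Polynomial.C (f m)) F : Polynomial K) = 0 := by
    intro F
    rw [mem_lineIdeal]
    refine ⟨fun h => Polynomial.funext fun t => ?_, fun h t => ?_⟩
    · rw [key, h, Polynomial.eval_zero]
    · rw [← key, h, Polynomial.eval_zero]
  refine ⟨fun h => ?_, fun {F G} hFG => ?_⟩
  · have h1 := mem_lineIdeal.mp ((Ideal.eq_top_iff_one _).mp h) 1
    rw [map_one] at h1
    exact one_ne_zero h1
  · rw [key', map_mul, mul_eq_zero] at hFG
    rwa [key', key']

omit [Infinite K] in
theorem not_irrelevant_le_of_X_notMem {I : HomogeneousIdeal (homogeneousSubmodule σ K)} {s : σ}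
    (h : X s ∉ I.toIdeal) : ¬ HomogeneousIdeal.irrelevant (homogeneousSubmodule σ K) ≤ I :=
  fun hle => h (hle (HomogeneousIdeal.mem_irrelevant_of_mem _ Nat.one_pos (isHomogeneous_X K s)))

theorem X_notMem_lineIdeal {s : σ} (hs : f s ≠ 0) : X s ∉ (lineIdeal f).toIdeal := by
  rwa [mem_lineIdeal_iff_eval (isHomogeneous_X K s), eval_X]

/-- The closed point of projective space with homogeneous coordinates `f`. -/
noncomputable def linePoint (hf : f ≠ 0) : ProjectiveSpectrum (homogeneousSubmodule σ K) where
  asHomogeneousIdeal := lineIdeal f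
  isPrime := lineIdeal_isPrime
  not_irrelevant_le := by
    obtain ⟨s, hs⟩ := Function.ne_iff.mp hf
    exact not_irrelevant_le_of_X_notMem (X_notMem_lineIdeal hs)

end Line

/-! ### The generic point of the maximal locus -/

section MaximalLocus

variable {K : Type u} [Field K] [CharZero K] {k : ℕ}

omit [CharZero K] in
theorem exists_cubicCoeffs_specialCubic_eq_one (hk : 2 ≤ k) :
    ∃ m, cubicCoeffs (specialCubic K k) m = 1 := by
  obtain ⟨k, rfl⟩ := Nat.exists_eq_add_of_le' hk
  obtain ⟨m, hm⟩ := exists_cubicExponent_eq (ι := MaxVar (k + 2))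
    (d := Finsupp.single (Sum.inl 0) 1 + Finsupp.single (Sum.inr 0) 2) (by simp)
  refine ⟨m, ?_⟩
  rw [cubicCoeffs, hm, specialCubic, coeff_add, coeff_sum, Finset.sum_eq_single 0, coeff_X_mul',
    coeff_X_mul']
  · rw [if_pos (by simp), if_neg, add_zero]
    · simp [coeff_X_pow]
    · simp [Fin.ext_iff]
  · intro i _ hi
    rw [coeff_X_mul', if_neg]
    have h : (Sum.inl 0 : MaxVar (k + 2)) ≠ Sum.inl i.castSucc :=
      fun h => hi (Fin.ext (Fin.ext_iff.mp (Sum.inl_injective h)).symm)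
    rw [Finsupp.mem_support_iff, not_not, Finsupp.add_apply, Finsupp.single_eq_of_ne h.symm,
      Finsupp.single_eq_of_ne Sum.inl_ne_inr, add_zero]
  · simp

omit [CharZero K] in
theorem cubicCoeffs_specialCubic_ne_zero (hk : 2 ≤ k) : cubicCoeffs (specialCubic K k) ≠ 0 := by
  obtain ⟨m, hm⟩ := exists_cubicCoeffs_specialCubic_eq_one (K := K) hk
  exact Function.ne_iff.mpr ⟨m, by rw [hm]; exact one_ne_zero⟩

theorem isPointOfCubic_linePoint {f : MvPolynomial (MaxVar k) K} (hf : cubicCoeffs f ≠ 0) :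
    IsPointOfCubic (linePoint hf : ProjectiveSpectrum (homogeneousSubmodule (Sym (MaxVar k) 3) K))
      f :=
  rfl

theorem perazzoIdeal_le_lineIdeal {c : Sym (MaxVar k) 3 → K} (hc : c ∈ perazzoCone K k) :
    perazzoIdeal K k ≤ lineIdeal c := fun _ hF =>
  mem_lineIdeal.mpr fun t => mem_perazzoIdeal.mp hF _ (smul_mem_perazzoCone hc t)

variable (K) in
/-- The generic point of the maximal family. -/
noncomputable def perazzoPoint (hk : 2 ≤ k) :
    ProjectiveSpectrum (homogeneousSubmodule (Sym (MaxVar k) 3) K) where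
  asHomogeneousIdeal := perazzoIdeal K k
  isPrime := perazzoIdeal_isPrime
  not_irrelevant_le h :=
    (linePoint (cubicCoeffs_specialCubic_ne_zero (K := K) hk)).not_irrelevant_le
      (h.trans (perazzoIdeal_le_lineIdeal specialCubic_mem_perazzoCone))

/-- Members of the family lie in the cone, which gives one inclusion. The other holds because a
polynomial vanishing on the family vanishes on the whole cone. -/
theorem maximalLocus_eq_closure (hk : 2 ≤ k) :
    (maximalLocus K k : Set (CubicSpace (MaxVar k) K)) =
      closure {(perazzoPoint K hk : CubicSpace (MaxVar k) K)} := by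
  change (closure {p | _} :
    Set (ProjectiveSpectrum (homogeneousSubmodule (Sym (MaxVar k) 3) K))) = closure {perazzoPoint K hk}
  apply subset_antisymm
  · refine closure_minimal ?_ isClosed_closure
    rintro p ⟨f, hf, hp⟩
    rw [ProjectiveSpectrum.closure_singleton]
    intro F hF
    change F ∈ (ProjectiveSpectrum.asHomogeneousIdeal p).toIdeal
    rw [hp]
    exact perazzoIdeal_le_lineIdeal hf.cubicCoeffs_mem hF
  · refine closure_minimal (Set.singleton_subset_iff.mpr ?_) isClosed_closure
    rw [← ProjectiveSpectrum.zeroLocus_vanishingIdeal_eq_closure]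
    rw [ProjectiveSpectrum.mem_zeroLocus]
    intro F hF
    refine mem_perazzoIdeal.mpr fun c hc => aeval_eq_zero_of_forall_isMaximalPerazzo hk ?_ hc
    intro f hf
    have hf0 : cubicCoeffs f ≠ 0 := by
      intro h0
      apply hf.2.1.ne_zero
      rw [← sum_monomial_cubicCoeffs hf.1, h0]
      simp
    have h1 : F ∈ (lineIdeal (cubicCoeffs f)).toIdeal :=
      (ProjectiveSpectrum.mem_vanishingIdeal _ _).mp hF (linePoint hf0)
        ⟨f, hf, isPointOfCubic_linePoint hf0⟩
    simpa using mem_lineIdeal.mp h1 1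

end MaximalLocus

/-! ### Stalks of an irreducible closed subset with its reduced structure -/

section ReducedSubscheme

open Scheme TopologicalSpace

variable {Y : Scheme.{u}} {Z : Closeds Y}

/-- On an affine neighbourhood the restriction of `s` is non-invertible at all points of `Z`, so it
belongs to the radical ideal that defines the reduced structure. -/
theorem stalkMap_germ_eq_zero_of_disjoint (q : (IdealSheafData.vanishingIdeal Z).subscheme)
    (W : Y.Opens) (hq : (IdealSheafData.vanishingIdeal Z).subschemeι q ∈ W) (s : Γ(Y, W))
    (hs : ∀ z ∈ Z, z ∉ Y.basicOpen s) :
    (IdealSheafData.vanishingIdeal Z).subschemeι.stalkMap q (Y.presheaf.germ W _ hq s) = 0 := by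
  obtain ⟨_, ⟨U, hU, rfl⟩, hqU, hUW⟩ := Y.isBasis_affineOpens.exists_subset_of_mem_open hq W.2
  replace hUW : (U : Y.Opens) ≤ W := hUW
  have h1 : Y.presheaf.germ W _ hq s =
      Y.presheaf.germ U _ hqU (Y.presheaf.map (CategoryTheory.homOfLE hUW).op s) :=
    (TopCat.Presheaf.germ_res_apply Y.presheaf (CategoryTheory.homOfLE hUW) _ hqU s).symm
  set t := Y.presheaf.map (CategoryTheory.homOfLE hUW).op s with ht
  have h2 : t ∈ (IdealSheafData.vanishingIdeal Z).ideal ⟨U, hU⟩ := by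
    rw [IdealSheafData.vanishingIdeal_ideal, PrimeSpectrum.mem_vanishingIdeal]
    intro y hy
    by_contra hty
    have h3 : hU.fromSpec y ∈ Y.basicOpen t := by
      have h4 : y ∈ hU.fromSpec ⁻¹ᵁ Y.basicOpen t := by
        rw [hU.fromSpec_preimage_basicOpen]
        exact hty
      exact h4
    refine hs _ hy ?_
    rw [ht, Scheme.basicOpen_res] at h3
    exact h3.2
  rw [← IdealSheafData.ker_subschemeι_app, RingHom.mem_ker] at h2
  rw [h1, Scheme.Hom.germ_stalkMap_apply]
  erw [h2]
  exact map_zero _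

/-- The kernel of the map to the local ring of an irreducible closed subset, with its reduced
structure. -/
theorem stalkMap_germ_eq_zero_iff {η : Y} (hη : (Z : Set Y) = closure {η})
    (q : (IdealSheafData.vanishingIdeal Z).subscheme)
    (W : Y.Opens) (hq : (IdealSheafData.vanishingIdeal Z).subschemeι q ∈ W) (s : Γ(Y, W)) :
    (IdealSheafData.vanishingIdeal Z).subschemeι.stalkMap q (Y.presheaf.germ W _ hq s) = 0 ↔
      η ∉ Y.basicOpen s := by
  constructor
  · intro h0 hηs
    obtain ⟨η', hη'⟩ : η ∈ Set.range (IdealSheafData.vanishingIdeal Z).subschemeι := by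
      rw [IdealSheafData.range_subschemeι, IdealSheafData.coe_support_vanishingIdeal, hη]
      exact subset_closure rfl
    subst hη'
    -- Since `q` specializes the generic point, a germ vanishing at `q` vanishes at `η'`, where it
    -- is also a unit.
    have hsp : η' ⤳ q := by
      rw [← (IdealSheafData.vanishingIdeal Z).subschemeι.isEmbedding.isInducing.specializes_iff,
        specializes_iff_mem_closure, ← hη]
      have h1 : (IdealSheafData.vanishingIdeal Z).subschemeι q ∈
          Set.range (IdealSheafData.vanishingIdeal Z).subschemeι := ⟨q, rfl⟩
      rwa [IdealSheafData.range_subschemeι, IdealSheafData.coe_support_vanishingIdeal] at h1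
    have h2 := Scheme.Hom.stalkSpecializes_stalkMap_apply
      (IdealSheafData.vanishingIdeal Z).subschemeι η' q hsp (Y.presheaf.germ W _ hq s)
    rw [h0, map_zero] at h2
    rw [TopCat.Presheaf.germ_stalkSpecializes_apply] at h2
    have h3 := (Scheme.mem_basicOpen Y s _ (hsp.map (Scheme.Hom.continuous _) |>.mem_open W.2 hq)).mp hηs
    have h4 := h3.map ((IdealSheafData.vanishingIdeal Z).subschemeι.stalkMap η').hom
    erw [h2] at h4
    exact not_isUnit_zero h4
  · intro h
    refine stalkMap_germ_eq_zero_of_disjoint q W hq s fun z hz hzs => h ?_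
    have h1 : z ∈ closure {η} := hη ▸ hz
    exact (specializes_iff_mem_closure.mpr h1).mem_open (Y.basicOpen s).2 hzs

end ReducedSubscheme

/-! ### Comparison of the local rings of `V(J)` and of the reduced closure -/

section ProjStalks

variable {K A : Type u} [Field K] [CommRing A] [Algebra K A]
  {𝒜 : ℕ → Submodule K A} [GradedAlgebra 𝒜]

open HomogeneousLocalization

theorem HomogeneousLocalization.AtPrime.isUnit_mk_iff (𝔭 : Ideal A) [𝔭.IsPrime]
    (c : NumDenSameDeg 𝒜 𝔭.primeCompl) :
    IsUnit (HomogeneousLocalization.mk c : AtPrime 𝒜 𝔭) ↔ (c.num : A) ∉ 𝔭 := by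
  rw [← HomogeneousLocalization.isUnit_iff_isUnit_val, val_mk, Localization.mk_eq_mk',
    IsLocalization.AtPrime.isUnit_mk'_iff _ 𝔭]
  rfl

theorem mem_basicOpen_sectionInBasicOpen_iff (x η : ProjectiveSpectrum 𝒜)
    (c : NumDenSameDeg 𝒜 x.asHomogeneousIdeal.toIdeal.primeCompl)
    (hη : (c.den : A) ∉ η.asHomogeneousIdeal) :
    η ∈ (Proj 𝒜).basicOpen (U := ProjectiveSpectrum.basicOpen 𝒜 (c.den : A))
      (sectionInBasicOpen 𝒜 x c) ↔
      (c.num : A) ∉ η.asHomogeneousIdeal := by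
  refine (Scheme.mem_basicOpen (Proj 𝒜) _ η hη).trans ?_
  have h := isUnit_map_iff (Proj.stalkIso' 𝒜 η) ((ProjectiveSpectrum.Proj.structureSheaf 𝒜).presheaf.germ _ η hη
    (sectionInBasicOpen 𝒜 x c))
  have h1 := Proj.stalkIso'_germ 𝒜 (ProjectiveSpectrum.basicOpen 𝒜 (c.den : A)) η hη
    (sectionInBasicOpen 𝒜 x c)
  exact h.symm.trans <| (iff_of_eq (congrArg IsUnit h1)).trans (HomogeneousLocalization.AtPrime.isUnit_mk_iff _ _)

/-- Two surjective ring homomorphisms with the same kernel have isomorphic targets. -/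
theorem nonempty_ringEquiv_of_ker_eq {R S T : Type*} [CommRing R] [CommRing S] [CommRing T]
    (φ : R →+* S) (ψ : R →+* T) (hφ : Function.Surjective φ) (hψ : Function.Surjective ψ)
    (h : ∀ a, φ a = 0 ↔ ψ a = 0) : Nonempty (S ≃+* T) :=
  ⟨(RingHom.quotientKerEquivOfSurjective hφ).symm.trans
    ((Ideal.quotEquivOfEq (Ideal.ext h)).trans (RingHom.quotientKerEquivOfSurjective hψ))⟩

/-- If near a point the equations of `V(J)` define the closure of `η`, then the local ring of
`V(J)` is that of the closure of `η` with its reduced structure. -/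
theorem nonempty_stalk_ringEquiv (J : HomogeneousIdeal 𝒜) (η : ProjectiveSpectrum 𝒜)
    (Z : TopologicalSpace.Closeds (Proj 𝒜)) (hZ : (Z : Set (Proj 𝒜)) = closure {(η : Proj 𝒜)})
    (hJη : J ≤ η.asHomogeneousIdeal) (q : (Scheme.IdealSheafData.vanishingIdeal Z).subscheme)
    (x : ProjectiveSpectrum 𝒜) (hqx : (Scheme.IdealSheafData.vanishingIdeal Z).subschemeι q = x)
    (hx : η.asHomogeneousIdeal ≤ x.asHomogeneousIdeal)
    (h : ∀ (n : ℕ), ∀ a ∈ 𝒜 n, a ∈ η.asHomogeneousIdeal →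
      ∃ (m : ℕ), ∃ b ∈ 𝒜 m, b ∉ x.asHomogeneousIdeal ∧ b * a ∈ J) :
    Nonempty ((Scheme.IdealSheafData.vanishingIdeal Z).subscheme.presheaf.stalk q ≃+*
      AtPrime (quotientGrading 𝒜 J)
        (quotientPoint J x (hJη.trans hx)).asHomogeneousIdeal.toIdeal) := by
  subst hqx
  set x : ProjectiveSpectrum 𝒜 := (Scheme.IdealSheafData.vanishingIdeal Z).subschemeι q with hxdef
  let φ : AtPrime 𝒜 x.asHomogeneousIdeal.toIdeal →+*
      (Scheme.IdealSheafData.vanishingIdeal Z).subscheme.presheaf.stalk q :=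
    ((Scheme.IdealSheafData.vanishingIdeal Z).subschemeι.stalkMap q).hom.comp
      (Proj.stalkIso' 𝒜 x).symm.toRingHom
  let ψ : AtPrime 𝒜 x.asHomogeneousIdeal.toIdeal →+* AtPrime (quotientGrading 𝒜 J)
      (quotientPoint J x (hJη.trans hx)).asHomogeneousIdeal.toIdeal :=
    HomogeneousLocalization.localRingHom (quotientGradedHom 𝒜 J) _ _
      (Ideal.ext fun a => (mk_mem_quotientPoint J (hJη.trans hx)).symm)
  -- Both local rings are quotients of the local ring of `Proj 𝒜` at `x`, and both kernels consist
  -- of the fractions with numerator in the ideal of `η`.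
  have hφ : ∀ c : NumDenSameDeg 𝒜 x.asHomogeneousIdeal.toIdeal.primeCompl,
      φ (HomogeneousLocalization.mk c) = 0 ↔ (c.num : A) ∈ η.asHomogeneousIdeal := by
    intro c
    refine (stalkMap_germ_eq_zero_iff (Z := Z) hZ q (ProjectiveSpectrum.basicOpen 𝒜 (c.den : A))
      c.den_mem (sectionInBasicOpen 𝒜 x c)).trans ?_
    exact (not_congr (mem_basicOpen_sectionInBasicOpen_iff x η c fun hm => c.den_mem (hx hm))).trans
      not_not
  have hψ : ∀ c : NumDenSameDeg 𝒜 x.asHomogeneousIdeal.toIdeal.primeCompl,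
      ψ (HomogeneousLocalization.mk c) = 0 ↔ (c.num : A) ∈ η.asHomogeneousIdeal := by
    intro c
    let c' : NumDenSameDeg (quotientGrading 𝒜 J)
        (quotientPoint J x (hJη.trans hx)).asHomogeneousIdeal.toIdeal.primeCompl :=
      ⟨c.deg, ⟨_, quotientGrading_mk_mem 𝒜 J c.num.2⟩, ⟨_, quotientGrading_mk_mem 𝒜 J c.den.2⟩,
        fun hm => c.den_mem ((mk_mem_quotientPoint J (hJη.trans hx)).mp hm)⟩
    have h1 : ψ (HomogeneousLocalization.mk c) = HomogeneousLocalization.mk c' := rfl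
    rw [h1, HomogeneousLocalization.AtPrime.mk_eq_zero_iff]
    constructor
    · rintro ⟨d, _, ⟨b, hb, rfl⟩, hbx, hbc⟩
      have h2 : b * c.num ∈ J.toIdeal := by
        rw [← Ideal.Quotient.eq_zero_iff_mem, map_mul]
        exact hbc
      exact (η.isPrime.mem_or_mem (hJη h2)).resolve_left fun hbη =>
        hbx ((mk_mem_quotientPoint J (hJη.trans hx)).mpr (hx hbη))
    · intro hc
      obtain ⟨m, b, hb, hbx, hbc⟩ := h _ _ c.num.2 hc
      refine ⟨m, _, quotientGrading_mk_mem 𝒜 J hb,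
        fun hm => hbx ((mk_mem_quotientPoint J (hJη.trans hx)).mp hm), ?_⟩
      exact (map_mul (Ideal.Quotient.mk J.toIdeal) b c.num).symm.trans
        (Ideal.Quotient.eq_zero_iff_mem.mpr hbc)
  refine nonempty_ringEquiv_of_ker_eq φ ψ ?_ ?_ ?_
  · exact ((Scheme.IdealSheafData.vanishingIdeal Z).subschemeι.stalkMap_surjective q).comp
      (Proj.stalkIso' 𝒜 x).symm.surjective
  · intro a
    obtain ⟨⟨d, ⟨_, a, ha, rfl⟩, ⟨_, b, hb, rfl⟩, hbx⟩, rfl⟩ := mk_surjective a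
    exact ⟨HomogeneousLocalization.mk ⟨d, ⟨a, ha⟩, ⟨b, hb⟩,
      fun hm => hbx ((mk_mem_quotientPoint J (hJη.trans hx)).mpr hm)⟩, rfl⟩
  · intro a
    obtain ⟨c, rfl⟩ := mk_surjective a
    rw [hφ, hψ]

end ProjStalks

/-! ### Heights of maximal ideals in finitely generated domains -/

section HeightOfMaximalIdeals

/-- View the ring as polynomials in one variable over the ring in the others. By the Jacobson
property a maximal ideal contracts to a maximal ideal, and the height grows by exactly one. -/
theorem MvPolynomial.height_of_isMaximal {K : Type*} [Field K] {n : ℕ} :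
    ∀ (P : Ideal (MvPolynomial (Fin n) K)), P.IsMaximal → P.height = n := by
  induction n with
  | zero =>
    intro P hP
    have h1 := Ideal.height_le_ringKrullDim_of_ne_top hP.ne_top
    rw [MvPolynomial.ringKrullDim_of_isNoetherianRing, ringKrullDim_eq_zero_of_field] at h1
    simpa using h1
  | succ n ih =>
    intro P hP
    set e := (finSuccEquiv K n).toRingEquiv with he
    set Q : Ideal (Polynomial (MvPolynomial (Fin n) K)) := P.map e with hQ
    have hQm : Q.IsMaximal := Ideal.map_isMaximal_of_equiv e
    have h1 : Q.height = P.height := e.height_map P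
    have h2 : (Q.comap Polynomial.C).IsMaximal :=
      Polynomial.isMaximal_comap_C_of_isJacobsonRing Q
    have h3 : Q.LiesOver (Q.comap Polynomial.C) := ⟨rfl⟩
    rw [← h1, Polynomial.height_eq_height_add_one (Q.comap Polynomial.C) Q, ih _ h2]
    norm_cast

/-- All maximal ideals of a domain of finite type over a field have the same height. -/
theorem ringKrullDim_le_height_of_isMaximal {K A : Type*} [Field K] [CommRing A] [IsDomain A]
    [Algebra K A] [Algebra.FiniteType K A] (M : Ideal A) [M.IsMaximal] :
    ringKrullDim A ≤ M.height := by
  -- Noether normalization: `A` is integral over a polynomial ring in `n` variables. Incomparability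
  -- bounds `dim A` by `n`, and going down bounds the height of `M` below by `n`.
  obtain ⟨n, g, hg, hfin⟩ := exists_integral_inj_algHom_of_fg K A
  algebraize [g.toRingHom]
  have : Algebra.IsIntegral (MvPolynomial (Fin n) K) A := ⟨hfin⟩
  have : FaithfulSMul (MvPolynomial (Fin n) K) A :=
    (faithfulSMul_iff_algebraMap_injective _ _).mpr hg
  have : IsNoetherianRing A := Algebra.FiniteType.isNoetherianRing K A
  have h1 : (M.under (MvPolynomial (Fin n) K)).IsMaximal :=
    Ideal.isMaximal_comap_of_isIntegral_of_isMaximal M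
  have h2 : (M.under (MvPolynomial (Fin n) K)).height = n := MvPolynomial.height_of_isMaximal _ h1
  rw [Ideal.height_eq_height_add_of_liesOver_of_hasGoingDown
    (M.under (MvPolynomial (Fin n) K)) M, h2]
  have h3 : ringKrullDim A ≤ ringKrullDim (MvPolynomial (Fin n) K) :=
    Order.krullDim_le_of_strictMono (PrimeSpectrum.comap (algebraMap (MvPolynomial (Fin n) K) A))
      fun _ _ h => Ideal.IsIntegral.comap_lt_comap h
  rw [MvPolynomial.ringKrullDim_of_isNoetherianRing, ringKrullDim_eq_zero_of_field, zero_add,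
    Nat.card_eq_fintype_card, Fintype.card_fin] at h3
  refine h3.trans ?_
  norm_cast
  exact le_self_add

/-- If `O` is the quotient by a principal ideal of the localization of `A` at `M`, then its
dimension is at least the height of `M` minus one. -/
theorem height_le_ringKrullDim_add_one {A O : Type*} [CommRing A] [IsNoetherianRing A] [CommRing O]
    (M : Ideal A) [M.IsPrime] (ε : A →+* O) (hu : ∀ b ∉ M, IsUnit (ε b))
    (hs : ∀ a : O, ∃ b c, c ∉ M ∧ a * ε c = ε b) {x : A} (hx : x ∈ M)
    (hker : ∀ b, ε b = 0 → b ∈ Ideal.span {x}) : M.height ≤ ringKrullDim O + 1 := by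
  rw [← IsLocalization.AtPrime.ringKrullDim_eq_height M (Localization.AtPrime M)]
  set R := Localization.AtPrime M
  let φ : R →+* O := IsLocalization.lift (M := M.primeCompl) (g := ε) fun b => hu b b.2
  have hφ : Function.Surjective φ := by
    intro a
    obtain ⟨b, c, hc, hbc⟩ := hs a
    refine ⟨IsLocalization.mk' R b (⟨c, hc⟩ : M.primeCompl), ?_⟩
    rw [IsLocalization.lift_mk'_spec, ← hbc, mul_comm]
  have hk : RingHom.ker φ ≤ Ideal.span {algebraMap A R x} := by
    intro r hr
    obtain ⟨b, c, rfl⟩ := IsLocalization.exists_mk'_eq M.primeCompl r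
    rw [RingHom.mem_ker, IsLocalization.lift_mk'_spec, mul_zero] at hr
    rw [IsLocalization.mk'_eq_mul_mk'_one]
    refine Ideal.mul_mem_right _ _ ?_
    have h1 := Ideal.mem_map_of_mem (algebraMap A R) (hker b hr)
    rwa [Ideal.map_span, Set.image_singleton] at h1
  have h1 : ringKrullDim (R ⧸ Ideal.span {algebraMap A R x}) ≤ ringKrullDim O := by
    rw [← ringKrullDim_eq_of_ringEquiv (RingHom.quotientKerEquivOfSurjective hφ)]
    exact ringKrullDim_le_of_surjective (Ideal.Quotient.factor hk) (Ideal.Quotient.factor_surjective hk)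
  have h2 := ringKrullDim_le_ringKrullDim_quotient_add_card {algebraMap A R x} (by
    rw [Finset.coe_singleton, Set.singleton_subset_iff, IsLocalRing.ringJacobson_eq_maximalIdeal]
    exact (IsLocalization.AtPrime.to_map_mem_maximal_iff R M x).mpr hx)
  rw [Finset.coe_singleton, Finset.card_singleton, Nat.cast_one] at h2
  exact h2.trans (add_le_add_left h1 1)

end HeightOfMaximalIdeals

/-! ### The cone, its affine point and the local ring in projective space -/

section Homogenization

/-- Homogenization with respect to a variable. -/
theorem exists_isHomogeneous_sub_mem_span {σ K : Type*} [Field K] (s₀ : σ) (F : MvPolynomial σ K) :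
    ∃ (d : ℕ) (G : MvPolynomial σ K), G.IsHomogeneous d ∧
      F - G ∈ Ideal.span {(X s₀ - 1 : MvPolynomial σ K)} := by
  refine ⟨F.totalDegree, ∑ i ∈ Finset.range (F.totalDegree + 1),
    homogeneousComponent i F * X s₀ ^ (F.totalDegree - i), ?_, ?_⟩
  · refine IsHomogeneous.sum _ _ _ fun i hi => ?_
    have h1 := (homogeneousComponent_isHomogeneous i F).mul
      (isHomogeneous_X_pow (R := K) s₀ (F.totalDegree - i))
    rwa [Nat.add_sub_cancel' (Nat.lt_succ_iff.mp (Finset.mem_range.mp hi))] at h1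
  · nth_rewrite 1 [← sum_homogeneousComponent F]
    rw [← Finset.sum_sub_distrib]
    refine sum_mem fun i _ => ?_
    rw [← mul_one_sub]
    refine Ideal.mul_mem_left _ _ (Ideal.mem_span_singleton.mpr ?_)
    rw [← dvd_neg, neg_sub]
    exact sub_one_dvd_pow_sub_one _ _

end Homogenization

section DimensionOfLocalRing

variable {σ : Type} [Finite σ] {K : Type u} [Field K]
  {J I : HomogeneousIdeal (homogeneousSubmodule σ K)}
  {p : Ideal (MvPolynomial σ K ⧸ J.toIdeal)} [p.IsPrime] {f : σ → K} {s₀ : σ}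

/-- If the local ring at the point `f` of `V(J)` is that of `V(I)`, then the dimension of the cone
over `V(I)` is at most that of the local ring plus one. -/
theorem ringKrullDim_quotient_le_ringKrullDim_projLocalRing [I.toIdeal.IsPrime]
    (hp : ∀ d F, F.IsHomogeneous d → (Ideal.Quotient.mk J.toIdeal F ∈ p ↔ eval f F = 0))
    (h₀ : Ideal.Quotient.mk J.toIdeal (X s₀) ∉ p) (hf : f s₀ = 1)
    (hI : ∀ F ∈ I.toIdeal, eval f F = 0) (hJI : J ≤ I)
    (h : ∀ d F, F.IsHomogeneous d → F ∈ I.toIdeal →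
      ∃ n B, B.IsHomogeneous n ∧ eval f B ≠ 0 ∧ B * F ∈ J.toIdeal) :
    ringKrullDim (MvPolynomial σ K ⧸ I.toIdeal) ≤ ringKrullDim (ProjLocalRing J p) + 1 := by
  have hev : ∀ d F, F.IsHomogeneous d → (ProjLocalRing.ev J p s₀ h₀ F = 0 ↔ F ∈ I.toIdeal) := by
    intro d F hF
    rw [ProjLocalRing.ev_of_isHomogeneous J h₀ hF, ProjLocalRing.frac_eq_zero_iff]
    constructor
    · rintro ⟨n, B, hB, hBp, hBF⟩
      refine (Ideal.IsPrime.mem_or_mem ‹_› (hJI hBF)).resolve_left fun hBI => hBp ?_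
      exact (hp n B hB).mpr (hI B hBI)
    · intro hFI
      obtain ⟨n, B, hB, hBf, hBF⟩ := h d F hF hFI
      exact ⟨n, B, hB, fun hm => hBf ((hp n B hB).mp hm), hBF⟩
  have hev' : ∀ F ∈ I.toIdeal, ProjLocalRing.ev J p s₀ h₀ F = 0 := by
    have h1 : I.toIdeal ≤ RingHom.ker (ProjLocalRing.ev J p s₀ h₀) :=
      le_of_forall_homogeneous I.isHomogeneous fun n F hF hFI => (hev n F hF).mpr hFI
    exact fun F hF => h1 hF
  -- Dehomogenization is passage to the slice `X s₀ = 1` of the cone; this one equation costs at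
  -- most one dimension.
  have hX : ProjLocalRing.ev J p s₀ h₀ (X s₀ - 1) = 0 := by
    have h1 := ProjLocalRing.frac_mul_ev J h₀ (isHomogeneous_X K s₀) (isHomogeneous_X K s₀) h₀
    have h2 := ProjLocalRing.isUnit_ev_of_isHomogeneous J h₀ (isHomogeneous_X K s₀) h₀
    have h3 : ProjLocalRing.ev J p s₀ h₀ (X s₀) =
        ProjLocalRing.frac J (isHomogeneous_X K s₀) (isHomogeneous_X K s₀) h₀ := aeval_X _ _
    rw [← h3] at h1
    rw [map_sub, map_one, sub_eq_zero]
    exact h2.mul_left_injective (h1.trans (one_mul _).symm)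
  let ev₀ : (MvPolynomial σ K ⧸ I.toIdeal) →+* K := Ideal.Quotient.lift I.toIdeal (eval f) hI
  let M : Ideal (MvPolynomial σ K ⧸ I.toIdeal) := RingHom.ker ev₀
  have hM : M.IsMaximal := RingHom.ker_isMaximal_of_surjective ev₀ fun c =>
    ⟨Ideal.Quotient.mk _ (C c), by simp [ev₀]⟩
  have hsub : ∀ F G : MvPolynomial σ K, F - G ∈ Ideal.span {(X s₀ - 1 : MvPolynomial σ K)} →
      eval f F = eval f G ∧ ProjLocalRing.ev J p s₀ h₀ F = ProjLocalRing.ev J p s₀ h₀ G := by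
    intro F G hFG
    obtain ⟨H, hH⟩ := Ideal.mem_span_singleton.mp hFG
    constructor
    · rw [← sub_eq_zero, ← map_sub, hH, map_mul]
      simp [hf]
    · rw [← sub_eq_zero, ← map_sub, hH, map_mul, hX, zero_mul]
  refine (ringKrullDim_le_height_of_isMaximal (K := K) M).trans ?_
  refine height_le_ringKrullDim_add_one M
    (Ideal.Quotient.lift I.toIdeal (ProjLocalRing.ev J p s₀ h₀).toRingHom hev') ?_ ?_
    (x := Ideal.Quotient.mk _ (X s₀ - 1)) ?_ ?_
  · intro b hb
    obtain ⟨F, rfl⟩ := Ideal.Quotient.mk_surjective b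
    obtain ⟨d, G, hG, hFG⟩ := exists_isHomogeneous_sub_mem_span s₀ F
    have hFf : eval f F ≠ 0 := hb
    change IsUnit (ProjLocalRing.ev J p s₀ h₀ F)
    rw [(hsub F G hFG).2]
    refine ProjLocalRing.isUnit_ev_of_isHomogeneous J h₀ hG fun hm => hFf ?_
    rw [(hsub F G hFG).1]
    exact (hp d G hG).mp hm
  · intro a
    obtain ⟨d, F, G, hF, hG, hGp, rfl⟩ := ProjLocalRing.exists_eq_frac J a
    refine ⟨Ideal.Quotient.mk _ F, Ideal.Quotient.mk _ G, fun hm => hGp ((hp d G hG).mpr hm), ?_⟩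
    exact ProjLocalRing.frac_mul_ev J h₀ hF hG hGp
  · change eval f (X s₀ - 1) = 0
    simp [hf]
  · intro b hb
    obtain ⟨F, rfl⟩ := Ideal.Quotient.mk_surjective b
    obtain ⟨d, G, hG, hFG⟩ := exists_isHomogeneous_sub_mem_span s₀ F
    have hF0 : ProjLocalRing.ev J p s₀ h₀ F = 0 := hb
    rw [(hsub F G hFG).2, hev d G hG] at hF0
    obtain ⟨H, hH⟩ := Ideal.mem_span_singleton.mp hFG
    refine Ideal.mem_span_singleton.mpr ⟨Ideal.Quotient.mk _ H, ?_⟩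
    rw [← map_mul, ← hH, map_sub, Ideal.Quotient.eq_zero_iff_mem.mpr hF0, sub_zero]

end DimensionOfLocalRing

/-! ### Dimension of a projective variety and of its cone -/

section ConeDimension

open TopologicalSpace

variable {σ : Type} {K : Type u} [Field K]

theorem mem_irrelevant_iff_constantCoeff {F : MvPolynomial σ K} :
    F ∈ HomogeneousIdeal.irrelevant (homogeneousSubmodule σ K) ↔ constantCoeff F = 0 := by
  have h1 : (DirectSum.decompose (homogeneousSubmodule σ K) F 0 : MvPolynomial σ K) =
      homogeneousComponent 0 F := decomposition.decompose'_apply F 0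
  rw [HomogeneousIdeal.mem_irrelevant_iff, GradedRing.proj_apply, h1, homogeneousComponent_zero,
    C_eq_zero]
  rfl

/-- A point of projective space, as an ideal, is strictly contained in the ideal of the vertex. -/
theorem ProjectiveSpectrum.asHomogeneousIdeal_lt_ker_constantCoeff
    (y : ProjectiveSpectrum (homogeneousSubmodule σ K)) :
    y.asHomogeneousIdeal.toIdeal < RingHom.ker (constantCoeff (σ := σ) (R := K)) := by
  refine lt_of_le_not_ge (fun F hF => ?_) fun hle =>
    y.not_irrelevant_le fun F hF => hle (mem_irrelevant_iff_constantCoeff.mp hF)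
  have h1 := y.asHomogeneousIdeal.isHomogeneous 0 hF
  have h2 : (DirectSum.decompose (homogeneousSubmodule σ K) F 0 : MvPolynomial σ K) =
      homogeneousComponent 0 F := decomposition.decompose'_apply F 0
  rw [h2, homogeneousComponent_zero] at h1
  by_contra hne
  exact y.isPrime.ne_top (Ideal.eq_top_of_isUnit_mem _ h1 ((Ne.isUnit hne).map C))

/-- The dimension of a projective variety is smaller than that of its cone. -/
theorem topologicalKrullDim_add_one_le_ringKrullDim (I : HomogeneousIdeal (homogeneousSubmodule σ K))
    (Z : Closeds (Proj (homogeneousSubmodule σ K))) [Nonempty Z]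
    (hZ : ∀ y : ProjectiveSpectrum (homogeneousSubmodule σ K),
      (y : Proj (homogeneousSubmodule σ K)) ∈ Z → I ≤ y.asHomogeneousIdeal) :
    topologicalKrullDim Z + 1 ≤ ringKrullDim (MvPolynomial σ K ⧸ I.toIdeal) := by
  have hgen : ∀ C : IrreducibleCloseds Z, ∃ y : Proj (homogeneousSubmodule σ K),
      I ≤ ProjectiveSpectrum.asHomogeneousIdeal y ∧ IsGenericPoint y
        (IrreducibleCloseds.map Subtype.val continuous_subtype_val C :
          Set (Proj (homogeneousSubmodule σ K))) := by
    intro C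
    obtain ⟨y, hy⟩ := QuasiSober.sober
      (IrreducibleCloseds.map Subtype.val continuous_subtype_val C).isIrreducible
      (IrreducibleCloseds.map Subtype.val continuous_subtype_val C).isClosed
    have h2 : closure (Subtype.val '' (C : Set Z)) ⊆ Z :=
      closure_minimal (by rintro _ ⟨z, -, rfl⟩; exact z.2) Z.isClosed
    exact ⟨y, hZ y (h2 hy.mem), hy⟩
  choose y' hyI hyC using hgen
  let y : IrreducibleCloseds Z → ProjectiveSpectrum (homogeneousSubmodule σ K) := y'
  have hle : ∀ a b : IrreducibleCloseds Z,
      IrreducibleCloseds.map Subtype.val continuous_subtype_val a ≤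
        IrreducibleCloseds.map Subtype.val continuous_subtype_val b ↔
      (y b).asHomogeneousIdeal ≤ (y a).asHomogeneousIdeal := by
    intro a b
    refine Iff.trans ?_ (ProjectiveSpectrum.le_iff_mem_closure _ (y b) (y a)).symm
    have h1 : y' a ∈ closure {y' b} ↔ closure {y' a} ⊆ closure {y' b} := by
      rw [isClosed_closure.closure_subset_iff, Set.singleton_subset_iff]
    rw [hyC a, hyC b] at h1
    exact (h1.trans (by rw [SetLike.coe_subset_coe])).symm.trans (by rw [← hyC b]; rfl)
  have hlt : ∀ C C' : IrreducibleCloseds Z, C < C' →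
      (y C').asHomogeneousIdeal.toIdeal < (y C).asHomogeneousIdeal.toIdeal := by
    intro C C' hCC'
    have h1 := IrreducibleCloseds.map_strictMono_of_isInducing
      (Topology.IsInducing.subtypeVal (t := (Z : Set (Proj (homogeneousSubmodule σ K))))) hCC'
    rw [lt_iff_le_not_ge] at h1 ⊢
    exact ⟨(hle C C').mp h1.1, fun h4 => h1.2 ((hle C' C).mpr h4)⟩
  let P : (Q : Ideal (MvPolynomial σ K)) → Q.IsPrime → I.toIdeal ≤ Q →
      PrimeSpectrum (MvPolynomial σ K ⧸ I.toIdeal) := fun Q hQ hIQ =>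
    ⟨Q.map (Ideal.Quotient.mk I.toIdeal),
      Ideal.map_isPrime_of_surjective Ideal.Quotient.mk_surjective (by rwa [Ideal.mk_ker])⟩
  have hP : ∀ Q hQ hIQ Q' hQ' hIQ', Q < Q' → P Q hQ hIQ < P Q' hQ' hIQ' := by
    intro Q hQ hIQ Q' hQ' hIQ' hlt
    have h1 : Q.map (Ideal.Quotient.mk I.toIdeal) ≤ Q'.map (Ideal.Quotient.mk I.toIdeal) :=
      Ideal.map_mono hlt.le
    refine lt_of_le_of_ne h1 fun heq => hlt.ne ?_
    have h2 := congrArg (fun p => (PrimeSpectrum.asIdeal p).comap (Ideal.Quotient.mk I.toIdeal)) heq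
    simpa only [P, Ideal.comap_map_quotientMk, sup_eq_right.mpr hIQ, sup_eq_right.mpr hIQ'] using h2
  have hV : ∀ C, I.toIdeal ≤ RingHom.ker (constantCoeff (σ := σ) (R := K)) := fun C =>
    le_trans (hyI C) (ProjectiveSpectrum.asHomogeneousIdeal_lt_ker_constantCoeff (y C)).le
  obtain ⟨z⟩ := ‹Nonempty Z›
  let C₀ : IrreducibleCloseds Z :=
    ⟨closure {z}, isIrreducible_singleton.closure, isClosed_closure⟩
  have : Nonempty (IrreducibleCloseds Z) := ⟨C₀⟩
  have h1 : Order.krullDim (WithBot (IrreducibleCloseds Z)) ≤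
      Order.krullDim (PrimeSpectrum (MvPolynomial σ K ⧸ I.toIdeal))ᵒᵈ := by
    -- Irreducible closed subsets go to the primes of their generic points, with order reversed. The
    -- added bottom element goes to the ideal of the vertex, strictly above all of them, and
    -- accounts for the extra dimension.
    refine Order.krullDim_le_of_strictMono (fun C => OrderDual.toDual (C.recBotCoe
      (P (RingHom.ker constantCoeff) (RingHom.ker_isPrime _) (hV C₀))
      fun C => P (y C).asHomogeneousIdeal.toIdeal (y C).isPrime (hyI C))) ?_
    intro C C' hCC'
    induction C' with
    | bot => exact absurd hCC' not_lt_bot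
    | coe C' =>
      induction C with
      | bot =>
        exact hP _ (y C').isPrime (hyI C') _ (RingHom.ker_isPrime _) (hV C₀)
          (ProjectiveSpectrum.asHomogeneousIdeal_lt_ker_constantCoeff _)
      | coe C =>
        exact hP _ (y C').isPrime (hyI C') _ (y C).isPrime (hyI C)
          (hlt C C' (WithBot.coe_lt_coe.mp hCC'))
  rwa [Order.krullDim_withBot, Order.krullDim_orderDual] at h1

end ConeDimension

/-! ### Local rings, tangent spaces and the dimension of the locus -/

section LowerBound

open TopologicalSpace

/-- The dimension of a local ring of a closed subset, with its reduced structure, is at most the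
dimension of this subset. -/
theorem ringKrullDim_stalk_le_topologicalKrullDim {Y : Scheme.{u}} (Z : Closeds Y)
    (q : (Scheme.IdealSheafData.vanishingIdeal Z).subscheme) :
    ringKrullDim ((Scheme.IdealSheafData.vanishingIdeal Z).subscheme.presheaf.stalk q) ≤
      topologicalKrullDim Z := by
  set i := (Scheme.IdealSheafData.vanishingIdeal Z).subschemeι with hi
  have hmem : ∀ x, i x ∈ Z := by
    intro x
    have h1 : i x ∈ Set.range i := ⟨x, rfl⟩
    rwa [hi, Scheme.IdealSheafData.range_subschemeι,
      Scheme.IdealSheafData.coe_support_vanishingIdeal] at h1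
  have h1 : Topology.IsInducing (Set.codRestrict i (Z : Set Y) hmem) :=
    i.isEmbedding.isInducing.codRestrict hmem
  have h2 := ((Scheme.IdealSheafData.vanishingIdeal Z).subscheme.fromSpecStalk
    q).isEmbedding.isInducing
  rw [← PrimeSpectrum.topologicalKrullDim_eq_ringKrullDim]
  exact h2.topologicalKrullDim_le.trans h1.topologicalKrullDim_le

theorem zariskiTangentDim_eq_ringKrullDim (Y : Scheme.{u}) (y : Y)
    [IsRegularLocalRing (Y.presheaf.stalk y)] :
    (zariskiTangentDim Y y : WithBot ℕ∞) = ringKrullDim (Y.presheaf.stalk y) := by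
  rw [zariskiTangentDim, Subspace.dual_finrank_eq]
  exact (IsRegularLocalRing.iff_finrank_cotangentSpace _).mp ‹_›

end LowerBound

/-! ### Assembly at the special cubic -/

section Main

variable {K : Type u} [Field K] [CharZero K] {k : ℕ}

theorem mem_maximalLocus (hk : 2 ≤ k) {y : CubicSpace (MaxVar k) K} :
    y ∈ maximalLocus K k ↔ perazzoIdeal K k ≤ ProjectiveSpectrum.asHomogeneousIdeal y := by
  rw [← SetLike.mem_coe, maximalLocus_eq_closure hk]
  exact (ProjectiveSpectrum.le_iff_mem_closure _ (perazzoPoint K hk) y).symm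

theorem hessianHomogeneousIdeal_le_perazzoIdeal :
    hessianHomogeneousIdeal (MaxVar k) K ≤ perazzoIdeal K k :=
  hessianIdeal_le_perazzoIdeal

variable (K) in
/-- The special cubic as a point of the Hessian scheme. -/
noncomputable def specialPoint (hk : 2 ≤ k) : ProjectiveSpectrum
    (quotientGrading (homogeneousSubmodule (Sym (MaxVar k) 3) K)
      (hessianHomogeneousIdeal (MaxVar k) K)) :=
  quotientPoint (hessianHomogeneousIdeal (MaxVar k) K)
    (linePoint (cubicCoeffs_specialCubic_ne_zero (K := K) hk))
    (hessianHomogeneousIdeal_le_perazzoIdeal.trans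
      (perazzoIdeal_le_lineIdeal specialCubic_mem_perazzoCone))

theorem mk_mem_specialPoint (hk : 2 ≤ k) (d : ℕ) (F : CubicCoordRing (MaxVar k) K)
    (hF : F.IsHomogeneous d) :
    Ideal.Quotient.mk (hessianHomogeneousIdeal (MaxVar k) K).toIdeal F ∈
      (specialPoint K hk).asHomogeneousIdeal.toIdeal ↔ eval (cubicCoeffs (specialCubic K k)) F = 0 :=
  (mk_mem_quotientPoint _ _).trans (mem_lineIdeal_iff_eval hF)

instance (hk : 2 ≤ k) : (specialPoint K hk).asHomogeneousIdeal.toIdeal.IsPrime :=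
  (specialPoint K hk).isPrime

/-- The Hessian scheme is regular at the special cubic, and coincides there with the closure of the
maximal family. -/
theorem isRegularLocalRing_specialPoint (hk : 2 ≤ k) :
    IsRegularLocalRing (ProjLocalRing (hessianHomogeneousIdeal (MaxVar k) K)
      (specialPoint K hk).asHomogeneousIdeal.toIdeal) ∧
    ∀ d F, F.IsHomogeneous d → F ∈ (perazzoIdeal K k).toIdeal → ∃ n B, B.IsHomogeneous n ∧
      eval (cubicCoeffs (specialCubic K k)) B ≠ 0 ∧
      B * F ∈ (hessianHomogeneousIdeal (MaxVar k) K).toIdeal := by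
  obtain ⟨s₀, hs₀⟩ := exists_cubicCoeffs_specialCubic_eq_one (K := K) hk
  have h₀ : Ideal.Quotient.mk (hessianHomogeneousIdeal (MaxVar k) K).toIdeal (X s₀) ∉
      (specialPoint K hk).asHomogeneousIdeal.toIdeal := by
    rw [mk_mem_specialPoint hk 1 _ (isHomogeneous_X K s₀), eval_X, hs₀]
    exact one_ne_zero
  obtain ⟨h1, h2⟩ := ProjLocalRing.isRegularLocalRing_of_arcs (hessianHomogeneousIdeal (MaxVar k) K)
    (mk_mem_specialPoint hk) h₀ hs₀ (perazzoArcs K k)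
    (fun c hc s => constantCoeff_of_mem_perazzoArcs hc s)
    (fun c hc F hF => aeval_eq_zero_of_mem_perazzoArcs hc
      (mem_perazzoIdeal.mp (hessianIdeal_le_perazzoIdeal hF)))
    (exists_perazzoArc hk)
  exact ⟨h1, fun d F hF hFI => h2 d F hF fun c hc =>
    aeval_eq_zero_of_mem_perazzoArcs hc (mem_perazzoIdeal.mp hFI)⟩

/-- The dimension gained by passing to the cone cancels the one lost on the slice `X s₀ = 1`. -/
theorem topologicalKrullDim_maximalLocus_le (hk : 2 ≤ k) :
    topologicalKrullDim (maximalLocus K k) ≤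
      ringKrullDim (ProjLocalRing (hessianHomogeneousIdeal (MaxVar k) K)
        (specialPoint K hk).asHomogeneousIdeal.toIdeal) := by
  obtain ⟨s₀, hs₀⟩ := exists_cubicCoeffs_specialCubic_eq_one (K := K) hk
  have h₀ : Ideal.Quotient.mk (hessianHomogeneousIdeal (MaxVar k) K).toIdeal (X s₀) ∉
      (specialPoint K hk).asHomogeneousIdeal.toIdeal := by
    rw [mk_mem_specialPoint hk 1 _ (isHomogeneous_X K s₀), eval_X, hs₀]
    exact one_ne_zero
  obtain ⟨hreg, hkey⟩ := isRegularLocalRing_specialPoint (K := K) hk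
  have h1 := ringKrullDim_quotient_le_ringKrullDim_projLocalRing (I := perazzoIdeal K k)
    (mk_mem_specialPoint hk) h₀ hs₀
    (fun F hF => mem_perazzoIdeal.mp hF _ specialCubic_mem_perazzoCone)
    hessianHomogeneousIdeal_le_perazzoIdeal hkey
  have : Nonempty (maximalLocus K k) :=
    ⟨⟨(perazzoPoint K hk : CubicSpace (MaxVar k) K), (mem_maximalLocus hk).mpr le_rfl⟩⟩
  have h2 := topologicalKrullDim_add_one_le_ringKrullDim (perazzoIdeal K k) (maximalLocus K k)
    fun y hy => (mem_maximalLocus hk).mp hy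
  exact ENat.WithBot.add_le_add_one_right_iff.mp (h2.trans h1)

end Main

theorem mainTheorem9 {K : Type*} [Field K] [IsAlgClosed K] [CharZero K] (k : ℕ) (hk : 2 ≤ k) :
    (∃ (p : HessianScheme (MaxVar k) K) (q : MaximalVariety K k),
      IsPointOfCubic (HessianScheme.incl (MaxVar k) K p) (specialCubic K k) ∧
      IsPointOfCubic (MaximalVariety.incl K k q) (specialCubic K k) ∧
      (zariskiTangentDim (HessianScheme (MaxVar k) K) p : WithBot ℕ∞) =
        topologicalKrullDim (maximalLocus K k) ∧
      IsRegularLocalRing ((MaximalVariety K k).presheaf.stalk q)) ∧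
    (maximalLocus K k : Set (CubicSpace (MaxVar k) K)) ⊆
      Set.range (HessianScheme.incl (MaxVar k) K) ∧
    HessianScheme.incl (MaxVar k) K ⁻¹' (maximalLocus K k : Set (CubicSpace (MaxVar k) K)) ∈
      irreducibleComponents (HessianScheme (MaxVar k) K) ∧
    ∃ η : HessianScheme (MaxVar k) K,
      IsGenericPoint η
        (HessianScheme.incl (MaxVar k) K ⁻¹'
          (maximalLocus K k : Set (CubicSpace (MaxVar k) K))) ∧
      _root_.IsReduced ((HessianScheme (MaxVar k) K).presheaf.stalk η) := by
  set J := hessianHomogeneousIdeal (MaxVar k) K with hJ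
  have hJη : J ≤ (perazzoPoint K hk).asHomogeneousIdeal := hessianHomogeneousIdeal_le_perazzoIdeal
  set x := linePoint (cubicCoeffs_specialCubic_ne_zero (K := K) hk) with hxdef
  have hηx : (perazzoPoint K hk).asHomogeneousIdeal ≤ x.asHomogeneousIdeal :=
    perazzoIdeal_le_lineIdeal specialCubic_mem_perazzoCone
  obtain ⟨hreg, hkey⟩ := isRegularLocalRing_specialPoint (K := K) hk
  have hkey' : ∀ (n : ℕ), ∀ a ∈ homogeneousSubmodule (Sym (MaxVar k) 3) K n,
      a ∈ (perazzoPoint K hk).asHomogeneousIdeal → ∃ (m : ℕ),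
        ∃ b ∈ homogeneousSubmodule (Sym (MaxVar k) 3) K m, b ∉ x.asHomogeneousIdeal ∧ b * a ∈ J := by
    intro n F hF hFI
    obtain ⟨m, B, hB, hBf, hBF⟩ := hkey n F hF hFI
    exact ⟨m, B, hB, fun hm => hBf ((mem_lineIdeal_iff_eval hB).mp hm), hBF⟩
  have hxZ : (x : CubicSpace (MaxVar k) K) ∈ (maximalLocus K k : Set (CubicSpace (MaxVar k) K)) :=
    (mem_maximalLocus hk).mpr hηx
  obtain ⟨q, hq⟩ : (x : CubicSpace (MaxVar k) K) ∈ Set.range (MaximalVariety.incl K k) := by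
    rw [Scheme.IdealSheafData.range_subschemeι, Scheme.IdealSheafData.coe_support_vanishingIdeal]
    exact hxZ
  -- Near the special cubic the Hessian equations already define `X_max`, so regularity passes from
  -- `ℋ` to `X_max`.
  obtain ⟨e⟩ := nonempty_stalk_ringEquiv J (perazzoPoint K hk) (maximalLocus K k)
    (maximalLocus_eq_closure hk) hJη q x hq hηx hkey'
  have hregq : IsRegularLocalRing ((MaximalVariety K k).presheaf.stalk q) :=
    IsRegularLocalRing.of_ringEquiv (R := ProjLocalRing J
      (specialPoint K hk).asHomogeneousIdeal.toIdeal) e.symm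
  let e' := Proj.stalkIso' (quotientGrading (homogeneousSubmodule (Sym (MaxVar k) 3) K) J)
    (specialPoint K hk)
  have hregp : IsRegularLocalRing ((HessianScheme (MaxVar k) K).presheaf.stalk
      (specialPoint K hk)) :=
    IsRegularLocalRing.of_ringEquiv (R := ProjLocalRing J
      (specialPoint K hk).asHomogeneousIdeal.toIdeal) e'.symm
  have hpre := maximalLocus_eq_closure (K := K) hk
  refine ⟨⟨specialPoint K hk, q, ?_, ?_, ?_, hregq⟩, ?_, ?_, quotientPoint J _ hJη, ?_, ?_⟩
  · rw [specialPoint]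
    erw [projQuotientι_quotientPoint]
    exact isPointOfCubic_linePoint _
  · rw [hq]
    exact isPointOfCubic_linePoint _
  -- By regularity the tangent dimension is the Krull dimension of the common local ring. The upper
  -- bound by `dim X_max` uses the stalk of `X_max`, and the lower bound uses the cone.
  · refine (zariskiTangentDim_eq_ringKrullDim (HessianScheme (MaxVar k) K)
      (specialPoint K hk)).trans (le_antisymm ?_ ?_)
    · refine le_trans (le_of_eq ?_) (ringKrullDim_stalk_le_topologicalKrullDim (maximalLocus K k) q)
      exact (ringKrullDim_eq_of_ringEquiv e').trans (ringKrullDim_eq_of_ringEquiv e).symm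
    · exact (topologicalKrullDim_maximalLocus_le hk).trans_eq (ringKrullDim_eq_of_ringEquiv e').symm
  · intro y hy
    exact ⟨_, projQuotientι_quotientPoint J y (hJη.trans ((mem_maximalLocus hk).mp hy))⟩
  · rw [hpre]
    have h1 := preimage_closure_singleton J (perazzoPoint K hk) hJη
    have h2 := closure_quotientPoint_mem_irreducibleComponents J (perazzoPoint K hk) hJη
      fun n a ha haη => by
        obtain ⟨m, b, hb, hbx, hba⟩ := hkey' n a ha haη
        exact ⟨b, fun hm => hbx (hηx hm), hba⟩
    exact h1 ▸ h2
  · rw [hpre]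
    exact (preimage_closure_singleton J (perazzoPoint K hk) hJη).symm
  · exact isReduced_stalk_quotientPoint J (perazzoPoint K hk) hJη fun n a ha haη => by
      obtain ⟨m, b, hb, hbx, hba⟩ := hkey' n a ha haη
      exact ⟨m, b, hb, fun hm => hbx (hηx hm), hba⟩
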